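/- Let $a,r,l,k>0$ and $h\ge 0$. For $f$ put $Af(x,u)=\tfrac12 a f''(x)+u f'(x)$ and $Bf(x,\xi)=f(x+\xi)-f(x)$, and put $C_A(x,u)=rx^2+lu^2$, $C_B(x,\xi)=k+h|\xi|$. A pair $(\mu,\rho)$, with $\mu$ a probability measure on $\mathbb R\times\mathbb R$ and $\rho$ a finite measure on $\mathbb R\times(\mathbb R\setminus\{0\})$, is feasible if for every $f\in C^2(\mathbb R)$ with compact support the integrals exist and $$\int Af\,d\mu+\int Bf\,d\rho=0 .$$ Let $I(a,r,l,k,h)=\inf_{(\mu,\rho)\text{ feasible}} c(\mu,\rho)$ with $c(\mu,\rho)=\int C_A\,d\mu+\int C_B\,d\rho\in[0,\infty]$. Then there are $\iota\in(0,1)$ and $0<\xi^*\le U$, with $\xi^*=U$ if and only if $h=0$, such that, with $I^V=\iota a\sqrt{rl}$ and $$w(x)=\begin{cases}\sqrt{rl}\,x^2-2al\,\ln {}_1F_1\!\big(\tfrac{1-\iota}{4};\tfrac12;\sqrt{\tfrac{r}{a^2l}}\,x^2\big),&|x|\le U,\\ w(U)+h(|x|-U),&|x|>U,\end{cases}\qquad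 u^*(x)=-\frac{w'(x)}{2l},$$ where ${}_1F_1(\alpha;\beta;z)=\sum_{j\ge0}\frac{(\alpha)_j}{(\beta)_j}\frac{z^j}{j!}$, the following holds. 1. (Free boundary problem and value function.) (a) $w\in C^1(\mathbb R)\cap C^2(\mathbb R\setminus\{\pm U\})$, and for $x\ne\pm U$ the point $u^*(x)$ is the unique minimiser of $u\mapsto Aw(x,u)+C_A(x,u)$. (b) $Aw(x,u^*(x))+C_A(x,u^*(x))=I^V$ for $|x|<U$; $Aw(x,u)+C_A(x,u)\ge I^V$ for all $x\neq\pm U$, $u\in\mathbb R$; $Bw(x,\xi)+C_B(x,\xi)\ge0$ for all $x$ and $\xi\ne0$, with equality when $|x|\ge U$ and $x+\xi=\operatorname{sgn}(x)(U-\xi^*)$. In particular $w(\pm U\mp\xi^*)+k+h\xi^*=w(\pm U)$. (c) $w'(\pm U)=w'(\pm(U-\xi^*))=\pm h$; $w''(U-)<0$ and $w''((-U)+)<0$; $w'<-h$ on $(-U,-U+\xi^*)$, $-h<w'<h$ on $(-U+\xi^*,U-\xi^*)$, and $w'>h$ on $(U-\xi^*,U)$. (d) $\mu(\{\pm U\}\times\mathbb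 R)=0$ for every feasible $(\mu,\rho)$ with $c(\mu,\rho)<\infty$. There are compactly supported $w_n\in C^2(\mathbb R)$ and $\theta\ge0$ such that $Aw_n\to Aw$ pointwise on $(\mathbb R\setminus\{\pm U\})\times\mathbb R$, $Bw_n\to Bw$ pointwise, $|Aw_n|\le\theta(1+C_A)$ for $x\neq\pm U$, and $|Bw_n|\le\theta C_B$. There is a feasible $(\mu,\rho)$ with $Aw+C_A=I^V$ $\mu$-a.e. and $Bw+C_B=0$ $\rho$-a.e. 2. $I(a,r,l,k,h)=\iota a\sqrt{rl}$. 3. There is exactly one $p^*\in C^0([-U,U])\cap C^2((-U,U)\setminus\{-U+\xi^*,U-\xi^*\})$ (all one-sided limits below existing) with $$\tfrac12a p''-(u^*p)'=0\ \text{ on }(-U,U)\setminus\{-U+\xi^*,U-\xi^*\},\qquad p(\pm U)=0,\qquad \int_{-U}^Up=1,$$ and, if $\xi^*<U$, $$\tfrac12a\,p'((-U)+)=\tfrac12a\,p'((-U+\xi^*)-)-\tfrac12a\,p'((-U+\xi^*)+),\qquad \tfrac12a\,p'(U-)=\tfrac12a\,p'((U-\xi^*)+)-\tfrac12a\,p'((U-\xi^*)-),$$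 while if $\xi^*=U$ these two conditions are replaced by $\tfrac12a\,p'((-U)+)-\tfrac12a\,p'(U-)=\tfrac12a\,p'(0-)-\tfrac12a\,p'(0+)$. Moreover $p^*\ge0$ on $[-U,U]$, the numbers $\rho^*_-=\tfrac12a\,p^{*\prime}((-U)+)$ and $\rho^*_+=-\tfrac12a\,p^{*\prime}(U-)$ are nonnegative, and the pair $$\mu^*(dx,du)=p^*(x)1_{[-U,U]}(x)\,dx\otimes\delta_{u^*(x)}(du),\qquad \rho^*=\rho^*_-\,\delta_{(-U,\xi^*)}+\rho^*_+\,\delta_{(U,-\xi^*)}$$ is feasible with $c(\mu^*,\rho^*)=I(a,r,l,k,h)$. 4. $\mu^*$ and $\rho^*$ are the stationary distribution and boundary measure of the process $dX^*=\sqrt a\,dW+u^*(X^*)\,dt+\xi^*dN^--\xi^*dN^+$ on $[-U,U]$, where $N^-$ and $N^+$ count the visits of $X^*_{t-}$ to $-U$ and $U$, in the following sense. Let $X^*$ be progressive with values in $[-U,U]$, let $N^\pm$ be adapted, nondecreasing, right-continuous and $\mathbb N$-valued with $N^\pm_0=0$, let $X^*-\xi^*N^-+\xi^*N^+$ be continuous,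 let $N^\pm$ jump (by $1$) exactly at the times $t>0$ with $X^*_{t-}=\pm U$, let $f(X^*_t)-\int_0^tAf(X^*_s,u^*(X^*_s))ds-Bf(-U,\xi^*)N^-_t-Bf(U,-\xi^*)N^+_t$ be a martingale for every compactly supported $f\in C^2(\mathbb R)$, and let the law of $X^*_t$ not depend on $t$. Then $(X^*_t,u^*(X^*_t))$ has law $\mu^*$, and $\mathbb E[N^\pm_t]=\rho^*_\pm t$, for every $t\ge0$. -/

import Mathlib

open MeasureTheory Set Filter Topology

noncomputable section

namespace ImpulseLP

/-- Kummer's confluent hypergeometric function `₁F₁(α; β; z) = ∑ (α)ₖ/(β)ₖ zᵏ/k!`. -/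
def kummer (α β z : ℝ) : ℝ :=
  ∑' k : ℕ, (ascPochhammer ℝ k).eval α / (ascPochhammer ℝ k).eval β * (z ^ k / (k.factorial : ℝ))

/-- `A f (x, u) = ½ a f''(x) + u f'(x)`. -/
def genA (a : ℝ) (f : ℝ → ℝ) (x u : ℝ) : ℝ :=
  1 / 2 * a * deriv (deriv f) x + u * deriv f x

/-- `B f (x, ξ) = f(x + ξ) - f(x)`. -/
def genB (f : ℝ → ℝ) (x ξ : ℝ) : ℝ := f (x + ξ) - f x

/-- Running cost `r x² + l u²`. -/
def costA (r l x u : ℝ) : ℝ := r * x ^ 2 + l * u ^ 2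

/-- Intervention cost `k + h |ξ|`. -/
def costB (k h ξ : ℝ) : ℝ := k + h * |ξ|

/-- `(μ, ρ)` satisfies the constraint of the linear program. A finite measure on
`ℝ × (ℝ ∖ {0})` is represented by a finite measure on `ℝ × ℝ` that does not charge `ℝ × {0}`. -/
structure IsFeasible (a : ℝ) (μ ρ : Measure (ℝ × ℝ)) : Prop where
  prob : IsProbabilityMeasure μ
  finite : IsFiniteMeasure ρ
  no_zero_jump : ρ {z | z.2 = 0} = 0
  constraint : ∀ f : ℝ → ℝ, ContDiff ℝ 2 f → HasCompactSupport f →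
    Integrable (fun z : ℝ × ℝ => genA a f z.1 z.2) μ ∧
    Integrable (fun z : ℝ × ℝ => genB f z.1 z.2) ρ ∧
    ∫ z, genA a f z.1 z.2 ∂μ + ∫ z, genB f z.1 z.2 ∂ρ = 0

/-- The cost `c(μ, ρ)`, with values in `[0, ∞]`. -/
def cost (r l k h : ℝ) (μ ρ : Measure (ℝ × ℝ)) : ENNReal :=
  ∫⁻ z, ENNReal.ofReal (costA r l z.1 z.2) ∂μ + ∫⁻ z, ENNReal.ofReal (costB k h z.2) ∂ρ

/-- The value `I(a, r, l, k, h)` of the linear program. -/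
def lpValue (a r l k h : ℝ) : ENNReal :=
  ⨅ (μ : Measure (ℝ × ℝ)) (ρ : Measure (ℝ × ℝ)) (_ : IsFeasible a μ ρ), cost r l k h μ ρ

/-- `(w, I)` is a value function of the linear program, with `w` of class `C²` off the closed
set `N`. -/
structure IsValueFunction (a r l k h : ℝ) (N : Set ℝ) (w : ℝ → ℝ) (I : ℝ) : Prop where
  contDiff_one : ContDiff ℝ 1 w
  contDiffOn_two : ContDiffOn ℝ 2 w Nᶜ
  null : ∀ μ ρ : Measure (ℝ × ℝ), IsFeasible a μ ρ → cost r l k h μ ρ < ⊤ →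
    μ (N ×ˢ (univ : Set ℝ)) = 0
  approx : ∃ (wn : ℕ → ℝ → ℝ) (θ : ℝ), 0 ≤ θ ∧
    (∀ n, ContDiff ℝ 2 (wn n) ∧ HasCompactSupport (wn n)) ∧
    (∀ x ∉ N, ∀ u : ℝ, Tendsto (fun n => genA a (wn n) x u) atTop (𝓝 (genA a w x u))) ∧
    (∀ x ξ : ℝ, ξ ≠ 0 → Tendsto (fun n => genB (wn n) x ξ) atTop (𝓝 (genB w x ξ))) ∧
    (∀ n, ∀ x ∉ N, ∀ u : ℝ, |genA a (wn n) x u| ≤ θ * (1 + costA r l x u)) ∧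
    (∀ n, ∀ x ξ : ℝ, ξ ≠ 0 → |genB (wn n) x ξ| ≤ θ * costB k h ξ)
  continuation : ∀ x ∉ N, ∀ u : ℝ, I ≤ genA a w x u + costA r l x u
  intervention : ∀ x ξ : ℝ, ξ ≠ 0 → 0 ≤ genB w x ξ + costB k h ξ
  attained : ∃ μ ρ : Measure (ℝ × ℝ), IsFeasible a μ ρ ∧
    (∀ᵐ z ∂μ, genA a w z.1 z.2 + costA r l z.1 z.2 = I) ∧
    (∀ᵐ z ∂ρ, genB w z.1 z.2 + costB k h z.2 = 0)

/-- The candidate `w`: explicit on `[-U, U]`, extended outside with slope `± h`. -/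
def wFun (a r l h ι U : ℝ) (x : ℝ) : ℝ :=
  let G : ℝ → ℝ := fun y => √(r * l) * y ^ 2
    - 2 * a * l * Real.log (kummer ((1 - ι) / 4) (1 / 2) (√(r / (a ^ 2 * l)) * y ^ 2))
  if |x| ≤ U then G x else G U + h * (|x| - U)

/-- The feedback control `u*(x) = -w'(x) / (2 l)`. -/
def uStar (l : ℝ) (w : ℝ → ℝ) (x : ℝ) : ℝ := -deriv w x / (2 * l)

/-- The free boundary problem solved by `w`, on top of membership in `C¹(ℝ) ∩ C²(ℝ ∖ {±U})`. -/
structure IsFreeBoundarySolution (a r l k h : ℝ) (U ξ : ℝ) (w : ℝ → ℝ) (I : ℝ) : Prop where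
  pde : ∀ x ∈ Ioo (-U) U, genA a w x (uStar l w x) + costA r l x (uStar l w x) = I
  value_fit : genB w U (-ξ) + costB k h (-ξ) = 0 ∧ genB w (-U) ξ + costB k h ξ = 0
  smooth_fit : deriv w U = h ∧ deriv w (U - ξ) = h ∧
    deriv w (-U) = -h ∧ deriv w (-U + ξ) = -h
  second_deriv : (∃ c < 0, Tendsto (deriv (deriv w)) (𝓝[<] U) (𝓝 c)) ∧
    (∃ c < 0, Tendsto (deriv (deriv w)) (𝓝[>] (-U)) (𝓝 c))
  slope_left : ∀ x ∈ Ioo (-U) (-U + ξ), deriv w x < -h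
  slope_mid : ∀ x ∈ Ioo (-U + ξ) (U - ξ), -h < deriv w x ∧ deriv w x < h
  slope_right : ∀ x ∈ Ioo (U - ξ) U, h < deriv w x
  outer_right : ∀ x, U ≤ x → genB w x (U - ξ - x) + costB k h (U - ξ - x) = 0
  outer_left : ∀ x, x ≤ -U → genB w x (-U + ξ - x) + costB k h (-U + ξ - x) = 0

/-- `p` solves the adjoint equation on `[-U, U]` with drift `u` and jumps from `±U` to `±(U - ξ)`,
and `ρm`, `ρp` are the boundary weights. When `ξ = U` both jumps land at `0`, and the two jump
conditions are replaced by their sum. Here `dl = p'((-U)+)`, `dr = p'(U-)`, and `el, el'`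
(resp. `er, er'`) are the left and right limits of `p'` at `-U + ξ` (resp. `U - ξ`). -/
structure IsAdjointSolution (a U ξ : ℝ) (u : ℝ → ℝ) (p : ℝ → ℝ) (ρm ρp : ℝ) : Prop where
  continuousOn : ContinuousOn p (Icc (-U) U)
  contDiffOn : ContDiffOn ℝ 2 p (Ioo (-U) U \ {-U + ξ, U - ξ})
  ode : ∀ x ∈ Ioo (-U) U \ {-U + ξ, U - ξ},
    1 / 2 * a * deriv (deriv p) x - deriv (fun y => u y * p y) x = 0
  boundary : p (-U) = 0 ∧ p U = 0
  jump : ∃ dl dr el el' er er' : ℝ,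
    Tendsto (deriv p) (𝓝[>] (-U)) (𝓝 dl) ∧
    Tendsto (deriv p) (𝓝[<] U) (𝓝 dr) ∧
    Tendsto (deriv p) (𝓝[<] (-U + ξ)) (𝓝 el) ∧
    Tendsto (deriv p) (𝓝[>] (-U + ξ)) (𝓝 el') ∧
    Tendsto (deriv p) (𝓝[<] (U - ξ)) (𝓝 er) ∧
    Tendsto (deriv p) (𝓝[>] (U - ξ)) (𝓝 er') ∧
    (ξ < U → 1 / 2 * a * dl = 1 / 2 * a * el - 1 / 2 * a * el' ∧
      1 / 2 * a * dr = 1 / 2 * a * er' - 1 / 2 * a * er) ∧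
    (ξ = U → 1 / 2 * a * dl - 1 / 2 * a * dr = 1 / 2 * a * el - 1 / 2 * a * el') ∧
    ρm = 1 / 2 * a * dl ∧ ρp = -(1 / 2 * a * dr)
  mass : ∫ x in (-U)..U, p x = 1

/-- `p(x) dx` on `[-U, U]`. -/
def densMeasure (U : ℝ) (p : ℝ → ℝ) : Measure ℝ :=
  (volume.restrict (Icc (-U) U)).withDensity fun x => ENNReal.ofReal (p x)

/-- `μ*(dx, du) = p(x) dx ⊗ δ_{u(x)}(du)` on `[-U, U] × ℝ`. -/
def muStar (U : ℝ) (p u : ℝ → ℝ) : Measure (ℝ × ℝ) :=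
  (densMeasure U p).map fun x => (x, u x)

/-- `ρ* = ρm δ_{(-U, ξ)} + ρp δ_{(U, -ξ)}`. -/
def rhoStar (U ξ ρm ρp : ℝ) : Measure (ℝ × ℝ) :=
  ENNReal.ofReal ρm • Measure.dirac ((-U, ξ) : ℝ × ℝ) +
    ENNReal.ofReal ρp • Measure.dirac ((U, -ξ) : ℝ × ℝ)

/-- `X` is a version with time-independent one-dimensional marginals of the controlled process
`dX = √a dW + u(X) dt + ξ dNm - ξ dNp` on `[-U, U]`, in the martingale formulation: `Nm` counts the
jumps (by `ξ`) made when `X` reaches `-U`, and `Np` those (by `-ξ`) made when `X` reaches `U`. -/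
structure IsStationaryControlled (a U ξ : ℝ) (u : ℝ → ℝ)
    {Ω : Type*} {m : MeasurableSpace Ω} (P : Measure Ω) (𝓕 : Filtration NNReal m)
    (X : NNReal → Ω → ℝ) (Nm Np : NNReal → Ω → ℕ) : Prop where
  progressive : IsStronglyProgressive 𝓕 X
  adapted_m : StronglyAdapted 𝓕 Nm
  adapted_p : StronglyAdapted 𝓕 Np
  mem : ∀ t ω, X t ω ∈ Icc (-U) U
  count_zero : ∀ ω, Nm 0 ω = 0 ∧ Np 0 ω = 0
  count_mono : ∀ ω, Monotone (fun t => Nm t ω) ∧ Monotone (fun t => Np t ω)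
  count_right : ∀ ω t, ∀ᶠ s in 𝓝[>] t, Nm s ω = Nm t ω ∧ Np s ω = Np t ω
  continuous_part : ∀ ω, Continuous fun t => X t ω - ξ * (Nm t ω : ℝ) + ξ * (Np t ω : ℝ)
  jumps : ∀ ω t y, 0 < t → Tendsto (fun s => X s ω) (𝓝[<] t) (𝓝 y) →
    ∀ᶠ s in 𝓝[<] t, Nm t ω = Nm s ω + (open Classical in if y = -U then 1 else 0) ∧
      Np t ω = Np s ω + (open Classical in if y = U then 1 else 0)
  martingale : ∀ f : ℝ → ℝ, ContDiff ℝ 2 f → HasCompactSupport f →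
    Martingale (fun (t : NNReal) ω => f (X t ω)
      - (∫ s in (0 : ℝ)..t, genA a f (X s.toNNReal ω) (u (X s.toNNReal ω)))
      - genB f (-U) ξ * (Nm t ω : ℝ) - genB f U (-ξ) * (Np t ω : ℝ)) 𝓕 P
  stationary : ∀ t, P.map (X t) = P.map (X 0)

end ImpulseLP

end

open ImpulseLP

noncomputable section

namespace ImpulseLP

/-! ### Exponential generating functions with bounded coefficients -/

/-! Minimising over `u`, the dynamic programming equation on the continuation interval is `½ a w'' -
w'² / (4 l) + r x² = I`. With `w' = 2 a l s`, `c = √(r / (a² l))` and `I = ι a √(r l)` it becomes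
the Riccati equation `s' = s² + ι c - c² x²`. Putting `s = -v' / v` linearises it to Weber's
equation `v'' = (c² x² - ι c) v`, whose even solution is a Gaussian times a Kummer function, so that
`w = -2 a l log v`. The unknowns are `ι` and the level crossings `b = U - ξ` and `U`. With `H = h /
(2 a l)` and `K = k / (2 a l)`, smooth fit reads `s b = s U = H`, and value fit says that the area
between `s` and `H` over `[b, U]` is `K`.

Existence of the free boundary. The product `v² s'` is strictly decreasing on the half-line
(`strictAntiOn_sq_mul_weberD`), so `s` rises to a single peak and then falls. For `ι < 1` it becomes
negative (`exists_weberS_neg`). Any level `0 ≤ H` below the peak is thus crossed exactly once on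
each side of it. The area above `H` is zero at `ι = 0` and as large as desired at `ι = 1`, where `s
= c x`, and it is continuous in `ι`; intermediate values give the area `K` (`exists_excessArea_eq`,
`exists_isWeberFreeBoundary`).

Lower bound. The same picture gives the variational inequalities. The function `w - h x` decreases
up to `b`, increases up to `U` and is constant afterwards, so no jump gains more than its cost.
Outside `[-U, U]` the inequality for `A w` comes from `s' U < 0`. A feasible pair of finite cost has
no atom in its state marginal, and `w` is a dominated limit of Steklov averages times cutoffs, so
the linear constraint extends to `w` (`IsFeasible.integral_eq_zero`). Adding it to the cost gives at
least `I` (`IsFeasible.le_cost`).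

Attainment. On `[-U, U]` the optimal drift is `a v' / v`, so solutions of the adjoint equation are
`v² (α + β E)` with `E` the scale function of density `1 / v²`. Three such branches glued at `±b`
give the density (`isAdjointSolution_density`), and the boundary and jump conditions force this
gluing (`eq_density_of_isAdjointSolution`). Integration by parts makes the pair feasible; it lives
where the variational inequalities are equalities, so its cost is `I`.

The process. Taking expectations in the martingale identity shows that a stationary law, with the
mean jump counts, solves the weak adjoint equation. For each continuous `φ` one can solve `A f = φ -
∫ φ p` with `B f = 0` at both jumps (`exists_poisson_solution`). Testing with this `f` identifies
the law, and test functions concentrated at one endpoint then identify each mean count. -/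

/-- The exponential generating function `∑ rₙ zⁿ / n!`. -/
def egf (r : ℕ → ℝ) (z : ℝ) : ℝ := ∑' n : ℕ, r n * (z ^ n / (n.factorial : ℝ))

theorem norm_egf_term_le {r : ℕ → ℝ} (hr : ∀ n, |r n| ≤ 1) {R z : ℝ} (hz : |z| ≤ R) (n : ℕ) :
    ‖r n * (z ^ n / (n.factorial : ℝ))‖ ≤ R ^ n / (n.factorial : ℝ) := by
  rw [norm_mul, norm_div, norm_pow, Real.norm_eq_abs, Real.norm_eq_abs, Real.norm_natCast]
  have h1 : |z| ^ n ≤ R ^ n := pow_le_pow_left₀ (abs_nonneg z) hz n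
  calc |r n| * (|z| ^ n / (n.factorial : ℝ)) ≤ 1 * (|z| ^ n / (n.factorial : ℝ)) := by
        gcongr; exact hr n
    _ ≤ R ^ n / (n.factorial : ℝ) := by rw [one_mul]; gcongr

theorem summable_egf {r : ℕ → ℝ} (hr : ∀ n, |r n| ≤ 1) (z : ℝ) :
    Summable fun n : ℕ => r n * (z ^ n / (n.factorial : ℝ)) :=
  .of_norm_bounded (Real.summable_pow_div_factorial |z|)
    fun n => norm_egf_term_le hr le_rfl n

/-- Differentiation only shifts the coefficients, so the bound `|r n| ≤ 1` is inherited and the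
lemma can be iterated. -/
theorem hasDerivAt_egf {r : ℕ → ℝ} (hr : ∀ n, |r n| ≤ 1) (z : ℝ) :
    HasDerivAt (egf r) (egf (fun n => r (n + 1)) z) z := by
  set R : ℝ := |z| + 1
  have hR : 0 ≤ R := by positivity
  set u : ℕ → ℝ := fun n => if n = 0 then 0 else R ^ (n - 1) / ((n - 1).factorial : ℝ) with hu
  have husum : Summable u := by
    rw [← summable_nat_add_iff 1]
    simpa [hu] using Real.summable_pow_div_factorial R
  set g' : ℕ → ℝ → ℝ := fun n y =>
    if n = 0 then 0 else r n * (y ^ (n - 1) / ((n - 1).factorial : ℝ)) with hg'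
  have key : HasDerivAt (fun y => ∑' n : ℕ, r n * (y ^ n / (n.factorial : ℝ)))
      (∑' n, g' n z) z := by
    refine hasDerivAt_tsum_of_isPreconnected (t := Metric.ball 0 R) (u := u) husum
      Metric.isOpen_ball (convex_ball (0 : ℝ) R).isPreconnected ?_ ?_
      (Metric.mem_ball_self (by positivity)) (summable_egf hr 0) (by simp [R])
    · intro n y _
      rcases n with _ | n
      · simpa [hg'] using hasDerivAt_const y (r 0)
      · have h := ((hasDerivAt_pow (n + 1) y).div_const ((n + 1).factorial : ℝ)).const_mul
          (r (n + 1))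
        refine h.congr_deriv ?_
        have : (n.factorial : ℝ) ≠ 0 := by positivity
        simp only [hg', Nat.add_eq_zero_iff, one_ne_zero, and_false, if_false,
          Nat.add_sub_cancel, Nat.factorial_succ]
        push_cast
        field_simp
    · intro n y hy
      rcases n with _ | n
      · simp [hg', hu]
      · have hy' : |y| ≤ R := by
          have := Metric.mem_ball.1 hy
          rw [dist_zero_right] at this
          exact this.le
        simpa [hg', hu] using norm_egf_term_le (r := fun n => r (n + 1)) (fun n => hr _) hy' n
  refine key.congr_deriv ?_
  have hs : Summable fun n => g' n z := by
    rw [← summable_nat_add_iff 1]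
    simpa [hg'] using summable_egf (r := fun n => r (n + 1)) (fun n => hr _) z
  rw [hs.tsum_eq_zero_add]
  simp [hg', egf]

/-- The Euler operator `z d/dz` multiplies the coefficient of `zⁿ / n!` by `n`. In this form
differential equations can be compared coefficient by coefficient. -/
theorem mul_egf_succ {r : ℕ → ℝ} (hr : ∀ n, |r n| ≤ 1) (z : ℝ) :
    HasSum (fun n : ℕ => (n * r n) * (z ^ n / (n.factorial : ℝ)))
      (z * egf (fun n => r (n + 1)) z) := by
  have h1 : HasSum (fun n : ℕ => z * (r (n + 1) * (z ^ n / (n.factorial : ℝ))))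
      (z * egf (fun n => r (n + 1)) z) :=
    ((summable_egf (r := fun n => r (n + 1)) (fun n => hr _) z).hasSum).mul_left z
  rw [← hasSum_nat_add_iff' 1]
  simp only [Finset.range_one, Finset.sum_singleton, Nat.cast_zero, zero_mul, sub_zero]
  refine h1.congr_fun fun n => ?_
  have : (n.factorial : ℝ) ≠ 0 := by positivity
  simp only [Nat.factorial_succ]
  push_cast
  field_simp
  ring

/-! ### Kummer's function for `0 ≤ α ≤ β` -/

/-- The ratio `(α)ₙ / (β)ₙ` of Pochhammer symbols. -/
def pochRatio (α β : ℝ) (n : ℕ) : ℝ :=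
  (ascPochhammer ℝ n).eval α / (ascPochhammer ℝ n).eval β

theorem kummer_eq_egf (α β : ℝ) : kummer α β = egf (pochRatio α β) := rfl

theorem pochRatio_zero (α β : ℝ) : pochRatio α β 0 = 1 := by simp [pochRatio]

theorem pochRatio_succ (α : ℝ) {β : ℝ} (n : ℕ) :
    pochRatio α β (n + 1) = pochRatio α β n * ((α + n) / (β + n)) := by
  simp only [pochRatio, ascPochhammer_succ_eval]
  rw [mul_div_mul_comm]

/-- Each factor `(α + n) / (β + n)` lies in `[0, 1]`; this is where `0 ≤ α ≤ β` enters, and it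
places Kummer's series among those with bounded coefficients. -/
theorem pochRatio_mem {α β : ℝ} (hα : 0 ≤ α) (hαβ : α ≤ β) (hβ : 0 < β) (n : ℕ) :
    0 ≤ pochRatio α β n ∧ pochRatio α β n ≤ 1 := by
  induction n with
  | zero => simp [pochRatio_zero]
  | succ n ih =>
    rw [pochRatio_succ]
    have h0 : 0 ≤ (α + n) / (β + n) := by positivity
    have h1 : (α + n) / (β + n) ≤ 1 := by
      rw [div_le_one (by positivity)]; linarith
    exact ⟨mul_nonneg ih.1 h0, mul_le_one₀ ih.2 h0 h1⟩

theorem abs_pochRatio_le {α β : ℝ} (hα : 0 ≤ α) (hαβ : α ≤ β) (hβ : 0 < β) (n : ℕ) :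
    |pochRatio α β n| ≤ 1 := by
  rw [abs_of_nonneg (pochRatio_mem hα hαβ hβ n).1]; exact (pochRatio_mem hα hαβ hβ n).2

/-- Kummer's differential equation `z M'' + (β - z) M' = α M`. -/
theorem kummer_ode {α β : ℝ} (hα : 0 ≤ α) (hαβ : α ≤ β) (hβ : 0 < β) (z : ℝ) :
    z * egf (fun n => pochRatio α β (n + 2)) z + (β - z) * egf (fun n => pochRatio α β (n + 1)) z
      = α * egf (pochRatio α β) z := by
  have hr := abs_pochRatio_le hα hαβ hβ
  have h1 := mul_egf_succ (r := fun n => pochRatio α β (n + 1)) (fun n => hr _) z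
  have h2 := mul_egf_succ hr z
  have h3 := ((summable_egf (r := fun n => pochRatio α β (n + 1)) (fun n => hr _) z).hasSum).mul_left β
  have h4 := ((summable_egf hr z).hasSum).mul_left α
  have h5 := ((h1.add h3).sub h2).sub h4
  -- The coefficient of `zⁿ / n!` is `(β + n) rₙ₊₁ - (α + n) rₙ`, which the recursion for the
  -- Pochhammer ratio makes zero.
  have h7 := h5.unique (hasSum_zero.congr_fun fun n => by
    rw [pochRatio_succ]
    have : β + n ≠ 0 := by positivity
    field_simp
    ring)
  simp only [egf] at h7 ⊢
  linarith

theorem one_le_kummer {α β z : ℝ} (hα : 0 ≤ α) (hαβ : α ≤ β) (hβ : 0 < β) (hz : 0 ≤ z) :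
    1 ≤ kummer α β z := by
  have hs := summable_egf (abs_pochRatio_le hα hαβ hβ) z
  have := hs.le_tsum 0 fun n _ => mul_nonneg (pochRatio_mem hα hαβ hβ n).1 (by positivity)
  simpa [pochRatio_zero, kummer_eq_egf, egf] using this

/-- Weierstrass test: the majorant `|z|ⁿ / n!` does not depend on `α`. The intermediate value
arguments in `ι` rest on this continuity. -/
theorem continuousOn_egf_pochRatio {β : ℝ} (hβ : 0 < β) (j : ℕ) (z : ℝ) :
    ContinuousOn (fun α => egf (fun n => pochRatio α β (n + j)) z) (Icc 0 β) := by
  refine continuousOn_tsum (u := fun n : ℕ => |z| ^ n / (n.factorial : ℝ)) (fun n => ?_)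
    (Real.summable_pow_div_factorial |z|) fun n α hα => ?_
  · simp only [pochRatio]
    fun_prop
  · exact norm_egf_term_le (r := fun n => pochRatio α β (n + j))
      (fun n => abs_pochRatio_le hα.1 hα.2 hβ _) le_rfl n

/-! ### The even solution of `v'' = (c² x² - ι c) v` -/

/-- The even solution of `v'' = (c² x² - ι c) v` with `v 0 = 1`. -/
def weberV (c ι x : ℝ) : ℝ :=
  Real.exp (-(c * x ^ 2 / 2)) * kummer ((1 - ι) / 4) (1 / 2) (c * x ^ 2)

/-- The derivative of `weberV`. -/
def weberV' (c ι x : ℝ) : ℝ :=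
  Real.exp (-(c * x ^ 2 / 2)) *
    (2 * c * x * egf (fun n => pochRatio ((1 - ι) / 4) (1 / 2) (n + 1)) (c * x ^ 2)
      - c * x * kummer ((1 - ι) / 4) (1 / 2) (c * x ^ 2))

section
variable {c ι : ℝ}

theorem weber_param (hι : ι ∈ Icc (0 : ℝ) 1) (n : ℕ) :
    |pochRatio ((1 - ι) / 4) (1 / 2) n| ≤ 1 :=
  abs_pochRatio_le (by linarith [hι.2]) (by linarith [hι.1]) (by norm_num) n

theorem hasDerivAt_weberV (hι : ι ∈ Icc (0 : ℝ) 1) (x : ℝ) :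
    HasDerivAt (weberV c ι) (weberV' c ι x) x := by
  have hr := weber_param hι
  have hz : HasDerivAt (fun x : ℝ => c * x ^ 2) (2 * c * x) x :=
    ((hasDerivAt_pow 2 x).const_mul c).congr_deriv (by push_cast; ring)
  have he : HasDerivAt (fun x : ℝ => Real.exp (-(c * x ^ 2 / 2)))
      (Real.exp (-(c * x ^ 2 / 2)) * (-(c * x))) x :=
    ((hz.div_const 2).neg.exp).congr_deriv (by simp; ring)
  have hM := (hasDerivAt_egf hr (c * x ^ 2)).comp x hz
  refine (he.mul hM).congr_deriv ?_
  simp only [weberV', kummer_eq_egf, Function.comp]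
  ring

theorem hasDerivAt_weberV' (hι : ι ∈ Icc (0 : ℝ) 1) (x : ℝ) :
    HasDerivAt (weberV' c ι) ((c ^ 2 * x ^ 2 - ι * c) * weberV c ι x) x := by
  have hr := weber_param hι
  have hz : HasDerivAt (fun x : ℝ => c * x ^ 2) (2 * c * x) x :=
    ((hasDerivAt_pow 2 x).const_mul c).congr_deriv (by push_cast; ring)
  have he : HasDerivAt (fun x : ℝ => Real.exp (-(c * x ^ 2 / 2)))
      (Real.exp (-(c * x ^ 2 / 2)) * (-(c * x))) x :=
    ((hz.div_const 2).neg.exp).congr_deriv (by simp; ring)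
  have hM := (hasDerivAt_egf hr (c * x ^ 2)).comp x hz
  have hM' := (hasDerivAt_egf (r := fun n => pochRatio ((1 - ι) / 4) (1 / 2) (n + 1))
    (fun n => hr _) (c * x ^ 2)).comp x hz
  have h1 : HasDerivAt (fun x : ℝ => 2 * c * x) (2 * c) x := by
    simpa using (hasDerivAt_id x).const_mul (2 * c)
  have h2 : HasDerivAt (fun x : ℝ => c * x) c x := by
    simpa using (hasDerivAt_id x).const_mul c
  have ode := kummer_ode (α := (1 - ι) / 4) (β := 1 / 2) (by linarith [hι.2])
    (by linarith [hι.1]) (by norm_num) (c * x ^ 2)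
  refine (he.mul ((h1.mul hM').sub (h2.mul hM))).congr_deriv ?_
  simp only [weberV, kummer_eq_egf, Function.comp, Pi.mul_apply, Pi.sub_apply]
  -- With `z = c x²`, Weber's equation is `4 c e^{-c x² / 2}` times Kummer's equation.
  linear_combination (4 * c * Real.exp (-(c * x ^ 2 / 2))) * ode

theorem weberV_pos (hc : 0 ≤ c) (hι : ι ∈ Icc (0 : ℝ) 1) (x : ℝ) : 0 < weberV c ι x :=
  mul_pos (Real.exp_pos _) (zero_lt_one.trans_le (one_le_kummer (by linarith [hι.2])
    (by linarith [hι.1]) (by norm_num) (by positivity)))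

theorem weberV_neg (x : ℝ) : weberV c ι (-x) = weberV c ι x := by simp [weberV]

theorem weberV'_neg (x : ℝ) : weberV' c ι (-x) = -weberV' c ι x := by simp [weberV']; ring

theorem weberV'_zero : weberV' c ι 0 = 0 := by simp [weberV']

theorem kummer_zero (α β : ℝ) : kummer α β 0 = 1 := by
  rw [kummer_eq_egf, egf, tsum_eq_single 0]
  · simp [pochRatio_zero]
  · intro n hn; simp [hn]

theorem weberV_zero : weberV c ι 0 = 1 := by simp [weberV, kummer_zero]

theorem pochRatio_zero_left (β : ℝ) (n : ℕ) : pochRatio 0 β (n + 1) = 0 := by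
  simp [pochRatio]

/-- At `ι = 1` the first Kummer parameter is zero, the series stops at its constant term, and `v` is
the Gaussian `e^{-c x² / 2}`. -/
theorem weberV'_one (x : ℝ) : weberV' c 1 x = -(c * x) * weberV c 1 x := by
  have h : egf (fun n => pochRatio ((1 - 1) / 4) (1 / 2) (n + 1)) (c * x ^ 2) = 0 := by
    simp [egf, pochRatio_zero_left]
  simp only [weberV', weberV, h]
  ring

theorem continuousOn_weberV_param (x : ℝ) :
    ContinuousOn (fun ι => weberV c ι x) (Icc 0 1) := by
  have h := (continuousOn_egf_pochRatio (β := 1 / 2) (by norm_num) 0 (c * x ^ 2)).comp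
    (f := fun ι : ℝ => (1 - ι) / 4) (s := Icc 0 1) (by fun_prop)
    fun ι hι => ⟨by linarith [hι.2], by linarith [hι.1]⟩
  exact continuousOn_const.mul h

theorem continuousOn_weberV'_param (x : ℝ) :
    ContinuousOn (fun ι => weberV' c ι x) (Icc 0 1) := by
  have hm : MapsTo (fun ι : ℝ => (1 - ι) / 4) (Icc 0 1) (Icc 0 (1 / 2)) :=
    fun ι hι => ⟨by linarith [hι.2], by linarith [hι.1]⟩
  have h := fun j => (continuousOn_egf_pochRatio (β := 1 / 2) (by norm_num) j (c * x ^ 2)).comp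
    (f := fun ι : ℝ => (1 - ι) / 4) (s := Icc 0 1) (by fun_prop) hm
  exact continuousOn_const.mul ((continuousOn_const.mul (h 1)).sub (continuousOn_const.mul (h 0)))

end

/-! ### The Riccati equation `s' = s² + ι c - c² x²` -/

/-- The negative logarithmic derivative of `weberV`. -/
def weberS (c ι x : ℝ) : ℝ := -(weberV' c ι x / weberV c ι x)

/-- The right-hand side of the Riccati equation. -/
def weberD (c ι x : ℝ) : ℝ := weberS c ι x ^ 2 + ι * c - c ^ 2 * x ^ 2

section
variable {c ι : ℝ}

theorem hasDerivAt_weberS (hc : 0 ≤ c) (hι : ι ∈ Icc (0 : ℝ) 1) (x : ℝ) :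
    HasDerivAt (weberS c ι) (weberD c ι x) x := by
  have hv := (weberV_pos hc hι x).ne'
  refine ((hasDerivAt_weberV' hι x).div (hasDerivAt_weberV hι x) hv).neg.congr_deriv ?_
  simp only [weberD, weberS]
  field_simp
  ring

theorem continuous_weberS (hc : 0 ≤ c) (hι : ι ∈ Icc (0 : ℝ) 1) : Continuous (weberS c ι) :=
  continuous_iff_continuousAt.2 fun x => (hasDerivAt_weberS hc hι x).continuousAt

theorem continuous_weberD (hc : 0 ≤ c) (hι : ι ∈ Icc (0 : ℝ) 1) : Continuous (weberD c ι) :=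
  (((continuous_weberS hc hι).pow 2).add continuous_const).sub (by fun_prop)

theorem weberS_neg (x : ℝ) : weberS c ι (-x) = -weberS c ι x := by
  simp only [weberS, weberV_neg, weberV'_neg, neg_div]

theorem weberS_zero : weberS c ι 0 = 0 := by simp [weberS, weberV'_zero]

theorem weberD_neg (x : ℝ) : weberD c ι (-x) = weberD c ι x := by simp [weberD, weberS_neg]

theorem weberD_zero : weberD c ι 0 = ι * c := by simp [weberD, weberS_zero]

theorem weberS_one (hc : 0 ≤ c) (x : ℝ) : weberS c 1 x = c * x := by
  have hv := (weberV_pos hc (right_mem_Icc.2 zero_le_one) x).ne'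
  rw [weberS, weberV'_one, mul_div_assoc, div_self hv]
  ring

/-- Since `v² s' = v'² - v v''`, the linear equation gives `(v² s')' = -2 c² x v²`. Consequently
`s'` changes sign at most once on the half-line. -/
theorem strictAntiOn_sq_mul_weberD (hc : 0 < c) (hι : ι ∈ Icc (0 : ℝ) 1) :
    StrictAntiOn (fun x => weberV c ι x ^ 2 * weberD c ι x) (Ici 0) := by
  have hd : ∀ x, HasDerivAt (fun x => weberV c ι x ^ 2 * weberD c ι x)
      (-2 * c ^ 2 * x * weberV c ι x ^ 2) x := by
    intro x
    have h1 : (fun x => weberV c ι x ^ 2 * weberD c ι x)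
        = fun x => weberV' c ι x ^ 2 + (ι * c - c ^ 2 * x ^ 2) * weberV c ι x ^ 2 := by
      funext x
      have hv := (weberV_pos hc.le hι x).ne'
      simp only [weberD, weberS]
      field_simp
      ring
    rw [h1]
    have h2 : HasDerivAt (fun x : ℝ => ι * c - c ^ 2 * x ^ 2) (-(2 * c ^ 2 * x)) x :=
      (((hasDerivAt_pow 2 x).const_mul (c ^ 2)).const_sub (ι * c)).congr_deriv
        (by push_cast; ring)
    refine (((hasDerivAt_weberV' hι x).pow 2).add
      (h2.mul ((hasDerivAt_weberV hι x).pow 2))).congr_deriv ?_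
    simp only [Pi.pow_apply]
    push_cast
    ring
  refine strictAntiOn_of_deriv_neg (convex_Ici 0)
    (fun x _ => (hd x).continuousAt.continuousWithinAt) fun x hx => ?_
  rw [interior_Ici] at hx
  rw [(hd x).deriv]
  have h1 : 0 < c ^ 2 * x * weberV c ι x ^ 2 :=
    mul_pos (mul_pos (pow_pos hc 2) hx) (pow_pos (weberV_pos hc.le hι x) 2)
  linarith

/-- Once the slope `s'` is nonpositive, it is negative forever. -/
theorem weberD_neg_of_nonpos (hc : 0 < c) (hι : ι ∈ Icc (0 : ℝ) 1) {x y : ℝ} (hx : 0 ≤ x)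
    (hxy : x < y) (hD : weberD c ι x ≤ 0) : weberD c ι y < 0 := by
  have h := strictAntiOn_sq_mul_weberD hc hι (mem_Ici.2 hx) (mem_Ici.2 (hx.trans hxy.le)) hxy
  have h1 : weberV c ι x ^ 2 * weberD c ι x ≤ 0 := mul_nonpos_of_nonneg_of_nonpos (sq_nonneg _) hD
  by_contra! h2
  have h3 : 0 ≤ weberV c ι y ^ 2 * weberD c ι y := mul_nonneg (sq_nonneg _) h2
  simp only at h
  linarith

/-- Sturm comparison: the Wronskian of the two solutions vanishes at `0` and has derivative `(ι₂ -
ι₁) c v₁ v₂ ≥ 0`. -/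
theorem weberS_mono_param (hc : 0 < c) {ι₁ ι₂ : ℝ} (h₁ : ι₁ ∈ Icc (0 : ℝ) 1)
    (h₂ : ι₂ ∈ Icc (0 : ℝ) 1) (h : ι₁ ≤ ι₂) {x : ℝ} (hx : 0 ≤ x) :
    weberS c ι₁ x ≤ weberS c ι₂ x := by
  set W : ℝ → ℝ := fun x => weberV' c ι₁ x * weberV c ι₂ x - weberV c ι₁ x * weberV' c ι₂ x with hW
  have hd : ∀ x, HasDerivAt W ((ι₂ - ι₁) * c * (weberV c ι₁ x * weberV c ι₂ x)) x := by
    intro x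
    refine (((hasDerivAt_weberV' h₁ x).mul (hasDerivAt_weberV h₂ x)).sub
      ((hasDerivAt_weberV h₁ x).mul (hasDerivAt_weberV' h₂ x))).congr_deriv ?_
    ring
  have hm : Monotone W := monotone_of_deriv_nonneg (fun x => (hd x).differentiableAt) fun x => by
    rw [(hd x).deriv]
    exact mul_nonneg (mul_nonneg (sub_nonneg.2 h) hc.le)
      (mul_pos (weberV_pos hc.le h₁ x) (weberV_pos hc.le h₂ x)).le
  have h0 : 0 ≤ W x := by
    have := hm hx
    simpa [hW, weberV'_zero] using this
  have e : weberS c ι₂ x - weberS c ι₁ x = W x / (weberV c ι₁ x * weberV c ι₂ x) := by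
    have := (weberV_pos hc.le h₁ x).ne'
    have := (weberV_pos hc.le h₂ x).ne'
    simp only [weberS, hW]
    field_simp
    ring
  have := div_nonneg h0 (mul_pos (weberV_pos hc.le h₁ x) (weberV_pos hc.le h₂ x)).le
  linarith

theorem weberS_le (hc : 0 < c) (hι : ι ∈ Icc (0 : ℝ) 1) {x : ℝ} (hx : 0 ≤ x) :
    weberS c ι x ≤ c * x := by
  rw [← weberS_one hc.le]
  exact weberS_mono_param hc hι (right_mem_Icc.2 zero_le_one) hι.2 hx

/-- If `s` stayed nonnegative, the bound `s ≤ c x` would improve itself through the Riccati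
equation. It gives `s' ≤ ι c`, hence `s ≤ ι c x`, hence `s' ≤ ι c - (1 - ι²) c² x²`, and the
resulting cubic bound tends to `-∞`. -/
theorem exists_weberS_neg (hc : 0 < c) (hι : ι ∈ Icc (0 : ℝ) 1) (h1 : ι < 1) :
    ∃ x, 0 < x ∧ weberS c ι x < 0 := by
  by_contra! hs
  have hs0 : ∀ x, 0 ≤ x → 0 ≤ weberS c ι x := fun x hx => by
    rcases hx.eq_or_lt with rfl | hx
    · exact weberS_zero.ge
    · exact hs x hx
  have hle : ∀ x, 0 ≤ x → weberS c ι x ≤ ι * c * x := by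
    have hd : ∀ x, HasDerivAt (fun x => ι * c * x - weberS c ι x) (ι * c - weberD c ι x) x :=
      fun x => (((hasDerivAt_id x).const_mul (ι * c)).congr_deriv (by simp)).sub
        (hasDerivAt_weberS hc.le hι x)
    have hm : MonotoneOn (fun x => ι * c * x - weberS c ι x) (Ici 0) := by
      refine monotoneOn_of_deriv_nonneg (convex_Ici 0)
        (fun x _ => (hd x).continuousAt.continuousWithinAt)
        (fun x _ => (hd x).differentiableAt.differentiableWithinAt) fun x hx => ?_
      rw [interior_Ici] at hx
      rw [(hd x).deriv, weberD]
      have := weberS_le hc hι (le_of_lt hx)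
      have := pow_le_pow_left₀ (hs0 x (le_of_lt hx)) this 2
      nlinarith
    intro x hx
    have := hm (mem_Ici.2 le_rfl) (mem_Ici.2 hx) hx
    simp only [mul_zero, weberS_zero, sub_zero] at this
    linarith
  have hle' : ∀ x, 0 ≤ x → weberS c ι x ≤ ι * c * x - (1 - ι ^ 2) * c ^ 2 * x ^ 3 / 3 := by
    have hd : ∀ x, HasDerivAt
        (fun x => ι * c * x - (1 - ι ^ 2) * c ^ 2 * x ^ 3 / 3 - weberS c ι x)
        (ι * c - (1 - ι ^ 2) * c ^ 2 * x ^ 2 - weberD c ι x) x := by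
      intro x
      have h3 : HasDerivAt (fun x : ℝ => (1 - ι ^ 2) * c ^ 2 * x ^ 3 / 3)
          ((1 - ι ^ 2) * c ^ 2 * x ^ 2) x :=
        (((hasDerivAt_pow 3 x).const_mul ((1 - ι ^ 2) * c ^ 2)).div_const 3).congr_deriv
          (by push_cast; ring)
      exact ((((hasDerivAt_id x).const_mul (ι * c)).congr_deriv (by simp)).sub h3).sub
        (hasDerivAt_weberS hc.le hι x)
    have hm : MonotoneOn (fun x => ι * c * x - (1 - ι ^ 2) * c ^ 2 * x ^ 3 / 3 - weberS c ι x)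
        (Ici 0) := by
      refine monotoneOn_of_deriv_nonneg (convex_Ici 0)
        (fun x _ => (hd x).continuousAt.continuousWithinAt)
        (fun x _ => (hd x).differentiableAt.differentiableWithinAt) fun x hx => ?_
      rw [interior_Ici] at hx
      rw [(hd x).deriv, weberD]
      have := pow_le_pow_left₀ (hs0 x (le_of_lt hx)) (hle x (le_of_lt hx)) 2
      nlinarith
    intro x hx
    have := hm (mem_Ici.2 le_rfl) (mem_Ici.2 hx) hx
    simp [weberS_zero] at this
    linarith
  set d : ℝ := (1 - ι ^ 2) * c with hd
  have hd0 : 0 < d := mul_pos (by nlinarith [hι.1]) hc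
  set x : ℝ := 1 + 3 / d with hx
  have hx1 : 1 ≤ x := by rw [hx]; linarith [div_pos three_pos hd0]
  have hxd : 3 < d * x := by
    rw [hx, mul_add, mul_div_cancel₀ _ hd0.ne']; linarith
  have h2 := hle' x (by linarith)
  have h3 := hs0 x (by linarith)
  have h4 : 3 < d * x * x := by nlinarith
  have h5 : ι * c * x - (1 - ι ^ 2) * c ^ 2 * x ^ 3 / 3 = c * x * (ι - d * x * x / 3) := by
    rw [hd]; ring
  have h6 : c * x * (ι - d * x * x / 3) < 0 :=
    mul_neg_of_pos_of_neg (mul_pos hc (by linarith)) (by linarith)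
  linarith

/-- At `ι = 0` the slope `s'` vanishes at the origin, hence is negative beyond it. -/
theorem weberS_nonpos_of_param_zero (hc : 0 < c) {x : ℝ} (hx : 0 ≤ x) : weberS c 0 x ≤ 0 := by
  have h0 : (0 : ℝ) ∈ Icc (0 : ℝ) 1 := left_mem_Icc.2 zero_le_one
  have hm : AntitoneOn (weberS c 0) (Ici 0) := by
    refine antitoneOn_of_deriv_nonpos (convex_Ici 0)
      (continuous_weberS hc.le h0).continuousOn
      (fun x _ => (hasDerivAt_weberS hc.le h0 x).differentiableAt.differentiableWithinAt)
      fun x hx => ?_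
    rw [interior_Ici] at hx
    rw [(hasDerivAt_weberS hc.le h0 x).deriv]
    exact (weberD_neg_of_nonpos hc h0 le_rfl hx (by simp [weberD_zero])).le
  simpa [weberS_zero] using hm (mem_Ici.2 le_rfl) (mem_Ici.2 hx) hx

/-- `s` increases up to some point and decreases afterwards, if it takes a negative value. -/
theorem exists_peak (hc : 0 < c) (hι : ι ∈ Icc (0 : ℝ) 1) (hι0 : 0 < ι) {R : ℝ} (hR : 0 < R)
    (hs : weberS c ι R < 0) :
    ∃ X ∈ Ioo 0 R, StrictMonoOn (weberS c ι) (Icc 0 X) ∧ StrictAntiOn (weberS c ι) (Ici X) ∧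
      ∀ y, X < y → weberD c ι y < 0 := by
  have hd := hasDerivAt_weberS hc.le hι
  -- The mean value theorem between `s 0 = 0` and `s R < 0` gives a point of negative slope; as the
  -- slope at `0` is `ι c > 0`, it vanishes in between, at the peak.
  obtain ⟨z, hz, hz'⟩ := exists_hasDerivAt_eq_slope (weberS c ι) (weberD c ι) hR
    (continuous_weberS hc.le hι).continuousOn fun x _ => hd x
  rw [weberS_zero, sub_zero, sub_zero] at hz'
  have hDz : weberD c ι z < 0 := hz' ▸ div_neg_of_neg_of_pos hs hR
  have hD0 : 0 < weberD c ι 0 := by rw [weberD_zero]; positivity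
  obtain ⟨X, hX, hDX⟩ := intermediate_value_Icc' hz.1.le
    (continuous_weberD hc.le hι).continuousOn ⟨hDz.le, hD0.le⟩
  have hX0 : 0 < X := hX.1.lt_of_ne fun h => by rw [← h] at hDX; linarith
  refine ⟨X, ⟨hX0, hX.2.trans_lt hz.2⟩, ?_, ?_, fun y hy =>
    weberD_neg_of_nonpos hc hι hX0.le hy hDX.le⟩
  · refine strictMonoOn_of_deriv_pos (convex_Icc 0 X) (continuous_weberS hc.le hι).continuousOn
      fun x hx => ?_
    rw [interior_Icc] at hx
    rw [(hd x).deriv]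
    by_contra! h
    exact (weberD_neg_of_nonpos hc hι hx.1.le hx.2 h).ne hDX
  · refine strictAntiOn_of_deriv_neg (convex_Ici X) (continuous_weberS hc.le hι).continuousOn
      fun x hx => ?_
    rw [interior_Ici] at hx
    rw [(hd x).deriv]
    exact weberD_neg_of_nonpos hc hι hX0.le hx hDX.le

/-! ### The free boundary -/

/-- The area between the graph of `s` and the level `H` over `[0, R]`. -/
def excessArea (c H R ι : ℝ) : ℝ := ∫ x in (0 : ℝ)..R, max (weberS c ι x - H) 0

theorem continuousOn_excessArea (hc : 0 < c) {H R : ℝ} (hH : 0 ≤ H) (hR : 0 ≤ R) :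
    ContinuousOn (excessArea c H R) (Icc 0 1) := by
  intro ι₀ hι₀
  refine intervalIntegral.continuousWithinAt_of_dominated_interval (bound := fun _ => c * R)
    ?_ ?_ (by simp) ?_
  · filter_upwards [self_mem_nhdsWithin] with ι hι
    exact (((continuous_weberS hc.le hι).sub continuous_const).max
      continuous_const).aestronglyMeasurable
  · filter_upwards [self_mem_nhdsWithin] with ι hι
    refine Eventually.of_forall fun x hx => ?_
    rw [uIoc_of_le hR] at hx
    rw [Real.norm_of_nonneg (le_max_right _ _)]
    refine max_le ?_ (by positivity)
    have h1 := weberS_le hc hι hx.1.le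
    have h2 : c * x ≤ c * R := mul_le_mul_of_nonneg_left hx.2 hc.le
    linarith
  · refine Eventually.of_forall fun x _ => ?_
    have h : ContinuousWithinAt (fun ι => weberS c ι x) (Icc 0 1) ι₀ :=
      ((continuousOn_weberV'_param x ι₀ hι₀).div (continuousOn_weberV_param x ι₀ hι₀)
        (weberV_pos hc.le hι₀ x).ne').neg
    exact (h.sub continuousWithinAt_const).max continuousWithinAt_const

theorem excessArea_intervalIntegrable (hc : 0 < c) (hι : ι ∈ Icc (0 : ℝ) 1) (H p q : ℝ) :
    IntervalIntegrable (fun x => max (weberS c ι x - H) 0) volume p q :=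
  (((continuous_weberS hc.le hι).sub continuous_const).max continuous_const).intervalIntegrable _ _

/-- The window `[0, R]` has to reach a point where `s` is negative, but how far that is depends on
`ι`. So the intermediate value theorem is used twice. It first finds `ι₁ < 1` with area above `K`.
The window is then enlarged until `s` is negative at its end for `ι₁`, and the second use on `[0,
ι₁]` keeps it negative there because `s` increases with `ι`. -/
theorem exists_excessArea_eq (hc : 0 < c) {H K : ℝ} (hH : 0 ≤ H) (hK : 0 < K) :
    ∃ ι ∈ Ioo (0 : ℝ) 1, ∃ R > 0, weberS c ι R < 0 ∧ excessArea c H R ι = K := by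
  have h1m : (1 : ℝ) ∈ Icc (0 : ℝ) 1 := right_mem_Icc.2 zero_le_one
  have h0 : ∀ R, 0 ≤ R → excessArea c H R 0 = 0 := by
    intro R hR
    rw [excessArea, intervalIntegral.integral_congr (g := fun _ => (0 : ℝ))]
    · simp
    · intro x hx
      rw [uIcc_of_le hR] at hx
      exact max_eq_right (by linarith [weberS_nonpos_of_param_zero hc hx.1])
  obtain ⟨R, hR, hRK⟩ : ∃ R > 0, K < excessArea c H R 1 := by
    -- Here `c R / 2 - H = K + 1 + c / 2` and `R ≥ 1`, so `∫ (c x - H) = R (c R / 2 - H)` exceeds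
    -- `K`.
    refine ⟨2 * (H + K + 1) / c + 1, by positivity, ?_⟩
    set R := 2 * (H + K + 1) / c + 1 with hRdef
    have hR0 : 0 ≤ R := by positivity
    have hle : ∫ x in (0 : ℝ)..R, (c * x - H) ≤ excessArea c H R 1 := by
      refine intervalIntegral.integral_mono_on hR0 (by
        apply Continuous.intervalIntegrable; fun_prop)
        (excessArea_intervalIntegrable hc h1m H 0 R) fun x _ => ?_
      rw [weberS_one hc.le]
      exact le_max_left _ _
    have hint : ∫ x in (0 : ℝ)..R, (c * x - H) = c * R ^ 2 / 2 - H * R := by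
      rw [intervalIntegral.integral_sub (by apply Continuous.intervalIntegrable; fun_prop)
        (by simp), intervalIntegral.integral_const_mul, integral_id]
      simp
      ring
    have hcR : c * R = 2 * (H + K + 1) + c := by
      rw [hRdef]; field_simp
    have hR1 : 1 ≤ R := by
      have : 0 ≤ 2 * (H + K + 1) / c := by positivity
      linarith
    nlinarith
  -- Aiming at the midpoint between `K` and the area at `ι = 1` leaves room on both sides: `ι₁ < 1`,
  -- with area still above `K`.
  obtain ⟨ι₁, hι₁, hι₁K⟩ := intermediate_value_Ioo zero_le_one
    (continuousOn_excessArea hc hH hR.le)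
    (show (K + excessArea c H R 1) / 2 ∈ Ioo (excessArea c H R 0) (excessArea c H R 1) by
      rw [h0 R hR.le]; constructor <;> linarith)
  have hι₁' : ι₁ ∈ Icc (0 : ℝ) 1 := Ioo_subset_Icc_self hι₁
  obtain ⟨X, hX, hsX⟩ := exists_weberS_neg hc hι₁' hι₁.2
  obtain ⟨Y, hY, -, hanti, -⟩ := exists_peak hc hι₁' hι₁.1 hX hsX
  set R' := max R X with hR'
  have hsR' : weberS c ι₁ R' < 0 := by
    refine (hanti.antitoneOn (mem_Ici.2 hY.2.le)
      (mem_Ici.2 (hY.2.le.trans (le_max_right R X))) (le_max_right R X)).trans_lt hsX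
  have hR'0 : 0 < R' := hR.trans_le (le_max_left _ _)
  have hbig : K < excessArea c H R' ι₁ := by
    have h2 : excessArea c H R ι₁ ≤ excessArea c H R' ι₁ := by
      unfold excessArea
      rw [← intervalIntegral.integral_add_adjacent_intervals
        (excessArea_intervalIntegrable hc hι₁' H 0 R)
        (excessArea_intervalIntegrable hc hι₁' H R R')]
      have := intervalIntegral.integral_nonneg (μ := volume) (le_max_left R X)
        fun x _ => le_max_right (weberS c ι₁ x - H) 0
      linarith
    linarith
  obtain ⟨ι, hι, hιK⟩ := intermediate_value_Ioo hι₁.1.le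
    ((continuousOn_excessArea hc hH hR'0.le).mono (Icc_subset_Icc_right hι₁.2.le))
    (show K ∈ Ioo (excessArea c H R' 0) (excessArea c H R' ι₁) by
      rw [h0 R' hR'0.le]; exact ⟨hK, hbig⟩)
  refine ⟨ι, ⟨hι.1, hι.2.trans hι₁.2⟩, R', hR'0, ?_, hιK⟩
  exact (weberS_mono_param hc ⟨hι.1.le, (hι.2.trans hι₁.2).le⟩ hι₁' hι.2.le hR'0.le).trans_lt hsR'

/-- `ι`, `b = U - ξ` and `U` determined by the free boundary conditions, at the level of `s`. -/
structure IsWeberFreeBoundary (c H K ι b U : ℝ) : Prop where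
  c_pos : 0 < c
  H_nonneg : 0 ≤ H
  K_pos : 0 < K
  param : ι ∈ Ioo (0 : ℝ) 1
  b_nonneg : 0 ≤ b
  b_lt : b < U
  b_eq_zero_iff : b = 0 ↔ H = 0
  at_b : weberS c ι b = H
  at_U : weberS c ι U = H
  slope_U : weberD c ι U < 0
  inner : ∀ x ∈ Ioo 0 b, 0 < weberS c ι x ∧ weberS c ι x < H
  outer : ∀ x ∈ Ioo b U, H < weberS c ι x
  area : ∫ x in b..U, (weberS c ι x - H) = K

/-- The excess area is positive, so the peak lies above `H`; the level is met once on the rising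
side, at `b`, and once on the falling side, at `U`. The positive part vanishes on `[0, b]` and `[U,
R]`, so the excess area is the integral over `[b, U]`. -/
theorem exists_isWeberFreeBoundary (hc : 0 < c) {H K : ℝ} (hH : 0 ≤ H) (hK : 0 < K) :
    ∃ ι b U, IsWeberFreeBoundary c H K ι b U := by
  obtain ⟨ι, hι, R, hR, hsR, harea⟩ := exists_excessArea_eq hc hH hK
  have hι' : ι ∈ Icc (0 : ℝ) 1 := Ioo_subset_Icc_self hι
  have hcont := continuous_weberS hc.le hι'
  obtain ⟨X, hX, hmono, hanti, hD⟩ := exists_peak hc hι' hι.1 hR hsR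
  have hHX : H < weberS c ι X := by
    by_contra! hle
    have h0 : excessArea c H R ι = 0 := by
      rw [excessArea, intervalIntegral.integral_congr (g := fun _ => (0 : ℝ))]
      · simp
      · intro x hx
        rw [uIcc_of_le hR.le] at hx
        refine max_eq_right ?_
        rcases le_total x X with h | h
        · linarith [hmono.monotoneOn ⟨hx.1, h⟩ (right_mem_Icc.2 hX.1.le) h]
        · linarith [hanti.antitoneOn (mem_Ici.2 le_rfl) (mem_Ici.2 h) h]
    linarith
  obtain ⟨b, hb, hsb⟩ := intermediate_value_Icc hX.1.le hcont.continuousOn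
    (show H ∈ Icc (weberS c ι 0) (weberS c ι X) by rw [weberS_zero]; exact ⟨hH, hHX.le⟩)
  obtain ⟨U, hU, hsU⟩ := intermediate_value_Icc' hX.2.le hcont.continuousOn
    (show H ∈ Icc (weberS c ι R) (weberS c ι X) from ⟨by linarith, hHX.le⟩)
  have hbX : b < X := hb.2.lt_of_ne fun h => by rw [h] at hsb; linarith
  have hXU : X < U := hU.1.lt_of_ne fun h => by rw [← h] at hsU; linarith
  have hbU : b < U := hbX.trans hXU
  have houter : ∀ x ∈ Ioo b U, H < weberS c ι x := by
    intro x hx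
    rcases le_total x X with h | h
    · rw [← hsb]; exact hmono hb ⟨hb.1.trans hx.1.le, h⟩ hx.1
    · rw [← hsU]; exact hanti (mem_Ici.2 h) (mem_Ici.2 hXU.le) hx.2
  refine ⟨ι, b, U, hc, hH, hK, hι, hb.1, hbU, ⟨?_, ?_⟩, hsb, hsU, hD U hXU, ?_, houter, ?_⟩
  · rintro rfl; rw [← hsb, weberS_zero]
  · rintro rfl
    by_contra hb0
    have hpos : 0 < b := hb.1.lt_of_ne (Ne.symm hb0)
    have := hmono (left_mem_Icc.2 hX.1.le) hb hpos
    rw [hsb, weberS_zero] at this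
    exact this.false
  · intro x hx
    have hxm : x ∈ Icc 0 X := ⟨hx.1.le, hx.2.le.trans hb.2⟩
    refine ⟨?_, ?_⟩
    · rw [← weberS_zero (c := c) (ι := ι)]; exact hmono (left_mem_Icc.2 hX.1.le) hxm hx.1
    · rw [← hsb]; exact hmono hxm hb hx.2
  · have hi := excessArea_intervalIntegrable hc hι' H
    have e1 : ∫ x in (0 : ℝ)..b, max (weberS c ι x - H) 0 = 0 := by
      rw [intervalIntegral.integral_congr (g := fun _ => (0 : ℝ))]
      · simp
      · intro x hx
        rw [uIcc_of_le hb.1] at hx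
        exact max_eq_right (by
          linarith [hmono.monotoneOn ⟨hx.1, hx.2.trans hb.2⟩ hb hx.2])
    have e2 : ∫ x in b..U, max (weberS c ι x - H) 0 = ∫ x in b..U, (weberS c ι x - H) := by
      refine intervalIntegral.integral_congr fun x hx => ?_
      rw [uIcc_of_le hbU.le] at hx
      refine max_eq_left ?_
      rcases hx.1.eq_or_lt with rfl | h1
      · linarith
      rcases hx.2.eq_or_lt with rfl | h2
      · linarith
      linarith [houter x ⟨h1, h2⟩]
    have e3 : ∫ x in U..R, max (weberS c ι x - H) 0 = 0 := by
      rw [intervalIntegral.integral_congr (g := fun _ => (0 : ℝ))]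
      · simp
      · intro x hx
        rw [uIcc_of_le hU.2] at hx
        exact max_eq_right (by
          linarith [hanti.antitoneOn (mem_Ici.2 hXU.le) (mem_Ici.2 (hXU.le.trans hx.1)) hx.1])
    have := intervalIntegral.integral_add_adjacent_intervals (hi 0 b) (hi b U)
    have := intervalIntegral.integral_add_adjacent_intervals (hi 0 U) (hi U R)
    unfold excessArea at harea
    linarith

end

/-! ### The candidate `w` and its derivatives -/

/-- The projection of `x` to `[-U, U]`. -/
def clampTo (U x : ℝ) : ℝ := max (-U) (min U x)

theorem continuous_clampTo (U : ℝ) : Continuous (clampTo U) := by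
  unfold clampTo; fun_prop

theorem clampTo_of_abs_le {U x : ℝ} (h : |x| ≤ U) : clampTo U x = x := by
  rw [clampTo, min_eq_right (abs_le.1 h).2, max_eq_right (abs_le.1 h).1]

theorem clampTo_of_ge {U x : ℝ} (hU : 0 ≤ U) (h : U ≤ x) : clampTo U x = U := by
  rw [clampTo, min_eq_left h, max_eq_right (by linarith)]

theorem clampTo_neg {U : ℝ} (hU : 0 ≤ U) (x : ℝ) : clampTo U (-x) = -clampTo U x := by
  unfold clampTo
  rcases le_total U x with h1 | h1 <;> rcases le_total x (-U) with h2 | h2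
  · have : x = U := by linarith
    have : U = 0 := by linarith
    simp_all
  · rw [min_eq_left h1, min_eq_right (by linarith), max_eq_left (by linarith),
      max_eq_right (by linarith)]
  · rw [min_eq_right h1, min_eq_left (by linarith), max_eq_left h2, max_eq_right (by linarith)]
    simp
  · rw [min_eq_right h1, min_eq_right (by linarith), max_eq_right h2, max_eq_right (by linarith)]

theorem clampTo_of_le {U x : ℝ} (hU : 0 ≤ U) (h : x ≤ -U) : clampTo U x = -U := by
  have h1 := clampTo_neg hU x
  rw [clampTo_of_ge hU (by linarith)] at h1
  linarith

theorem clampTo_mem {U : ℝ} (hU : 0 ≤ U) (x : ℝ) : |clampTo U x| ≤ U :=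
  abs_le.2 ⟨le_max_left _ _, max_le (by linarith) (min_le_left _ _)⟩

theorem lipschitzWith_clampTo (U : ℝ) : LipschitzWith 1 (clampTo U) := by
  have := (LipschitzWith.id (α := ℝ)).const_min U |>.const_max (-U)
  exact this

section Scaling
variable {a r l : ℝ}

theorem sqrt_ratio_sq (ha : 0 < a) (hr : 0 < r) (hl : 0 < l) :
    a ^ 2 * l * √(r / (a ^ 2 * l)) ^ 2 = r := by
  rw [Real.sq_sqrt (by positivity)]; field_simp

theorem sqrt_mul_eq (ha : 0 < a) (hr : 0 < r) (hl : 0 < l) :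
    √(r * l) = a * l * √(r / (a ^ 2 * l)) := by
  rw [Real.sqrt_eq_iff_mul_self_eq (by positivity) (by positivity)]
  have := sqrt_ratio_sq ha hr hl
  linear_combination -l * this

end Scaling

namespace IsWeberFreeBoundary

section Basic
variable {c H K ι b U : ℝ} (F : IsWeberFreeBoundary c H K ι b U)
include F

theorem mem_param : ι ∈ Icc (0 : ℝ) 1 := Ioo_subset_Icc_self F.param

theorem U_pos : 0 < U := F.b_nonneg.trans_lt F.b_lt

theorem continuous_s : Continuous (weberS c ι) := continuous_weberS F.c_pos.le F.mem_param

theorem s_le_of_mem {x : ℝ} (h0 : 0 ≤ x) (hx : x ≤ b) : 0 ≤ weberS c ι x ∧ weberS c ι x ≤ H := by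
  rcases h0.eq_or_lt with rfl | h0
  · rw [weberS_zero]; exact ⟨le_rfl, F.H_nonneg⟩
  rcases hx.eq_or_lt with rfl | hx
  · rw [F.at_b]; exact ⟨F.H_nonneg, le_rfl⟩
  exact ⟨(F.inner x ⟨h0, hx⟩).1.le, (F.inner x ⟨h0, hx⟩).2.le⟩

theorem H_le_s {x : ℝ} (h0 : b ≤ x) (hx : x ≤ U) : H ≤ weberS c ι x := by
  rcases h0.eq_or_lt with rfl | h0
  · exact F.at_b.ge
  rcases hx.eq_or_lt with rfl | hx
  · exact F.at_U.ge
  exact (F.outer x ⟨h0, hx⟩).le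

/-- On the negative half-line `s` is odd and nonnegative on `[0, U]`, so its clamped value is
nonpositive and lies below `H ≥ 0`. -/
theorem s_clamp_le {x : ℝ} (hx : x ≤ b) : weberS c ι (clampTo U x) ≤ H := by
  rcases le_total 0 x with h0 | h0
  · rw [clampTo_of_abs_le (by rw [abs_of_nonneg h0]; exact hx.trans F.b_lt.le)]
    exact (F.s_le_of_mem h0 hx).2
  · set y := clampTo U (-x) with hy
    have h1 : clampTo U x = -y := by rw [hy, clampTo_neg F.U_pos.le, neg_neg]
    have hy0 : 0 ≤ y := le_max_of_le_right (le_min F.U_pos.le (by linarith))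
    have hyU : y ≤ U := (abs_le.1 (clampTo_mem F.U_pos.le (-x))).2
    rw [h1, weberS_neg]
    rcases le_total y b with h | h
    · linarith [(F.s_le_of_mem hy0 h).1, F.H_nonneg]
    · linarith [F.H_le_s h hyU, F.H_nonneg]

theorem H_le_s_clamp {x : ℝ} (hx : b ≤ x) : H ≤ weberS c ι (clampTo U x) := by
  rcases le_total x U with h | h
  · rw [clampTo_of_abs_le (by rw [abs_of_nonneg (F.b_nonneg.trans hx)]; exact h)]
    exact F.H_le_s hx h
  · rw [clampTo_of_ge F.U_pos.le h, F.at_U]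

theorem s_clamp_of_ge {x : ℝ} (hx : U ≤ x) : weberS c ι (clampTo U x) = H := by
  rw [clampTo_of_ge F.U_pos.le hx, F.at_U]

theorem s_clamp_of_le {x : ℝ} (hx : x ≤ -U) : weberS c ι (clampTo U x) = -H := by
  rw [clampTo_of_le F.U_pos.le hx, weberS_neg, F.at_U]

theorem continuous_s_clamp : Continuous fun x => weberS c ι (clampTo U x) :=
  F.continuous_s.comp (continuous_clampTo U)

end Basic

variable {a r l k h ι b U : ℝ} (ha : 0 < a) (hr : 0 < r) (hl : 0 < l)
  (F : IsWeberFreeBoundary √(r / (a ^ 2 * l)) (h / (2 * a * l)) (k / (2 * a * l)) ι b U)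

-- The Gaussian factor of `v` produces the quadratic term of `w`: this is the logarithmic
-- substitution `w = -2 a l log v`.
include ha hr hl in
theorem inner_formula_eq (hι : ι ∈ Icc (0 : ℝ) 1) (y : ℝ) :
    √(r * l) * y ^ 2
      - 2 * a * l * Real.log (kummer ((1 - ι) / 4) (1 / 2) (√(r / (a ^ 2 * l)) * y ^ 2))
    = -(2 * a * l * Real.log (weberV √(r / (a ^ 2 * l)) ι y)) := by
  have h1 : 0 < kummer ((1 - ι) / 4) (1 / 2) (√(r / (a ^ 2 * l)) * y ^ 2) :=
    zero_lt_one.trans_le (one_le_kummer (by linarith [hι.2]) (by linarith [hι.1]) (by norm_num)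
      (by positivity))
  rw [weberV, Real.log_mul (Real.exp_pos _).ne' h1.ne', Real.log_exp, sqrt_mul_eq ha hr hl]
  ring

theorem wFun_neg (x : ℝ) : wFun a r l h ι U (-x) = wFun a r l h ι U x := by
  simp [wFun]

-- Clamping freezes `s` at `±H` outside `[-U, U]`, which reproduces the slopes `±h`. A single
-- integral of a continuous function then covers the whole line, and the `C¹` fit at `±U` needs no
-- separate check.
include ha hr hl F in
theorem wFun_eq_integral (x : ℝ) : wFun a r l h ι U x
    = ∫ t in (0 : ℝ)..x, 2 * a * l * weberS √(r / (a ^ 2 * l)) ι (clampTo U t) := by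
  set c := √(r / (a ^ 2 * l)) with hc
  have hι := F.mem_param
  have hcont : Continuous fun t => 2 * a * l * weberS c ι (clampTo U t) :=
    continuous_const.mul F.continuous_s_clamp
  have hG : ∀ y, HasDerivAt (fun y => -(2 * a * l * Real.log (weberV c ι y)))
      (2 * a * l * weberS c ι y) y := fun y =>
    (((hasDerivAt_weberV hι y).log (weberV_pos F.c_pos.le hι y).ne').const_mul
      (2 * a * l)).neg.congr_deriv (by rw [weberS]; ring)
  have hin : ∀ x, 0 ≤ x → x ≤ U → -(2 * a * l * Real.log (weberV c ι x))
      = ∫ t in (0 : ℝ)..x, 2 * a * l * weberS c ι (clampTo U t) := by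
    intro x h0 hx
    rw [intervalIntegral.integral_congr (g := fun t => 2 * a * l * weberS c ι t),
      intervalIntegral.integral_eq_sub_of_hasDerivAt (fun y _ => hG y)
        ((continuous_const.mul F.continuous_s).intervalIntegrable _ _)]
    · simp [weberV_zero]
    · intro t ht
      rw [uIcc_of_le h0] at ht
      simp only
      rw [clampTo_of_abs_le (by rw [abs_of_nonneg ht.1]; exact ht.2.trans hx)]
  have hpos : ∀ x, 0 ≤ x → wFun a r l h ι U x
      = ∫ t in (0 : ℝ)..x, 2 * a * l * weberS c ι (clampTo U t) := by
    intro x h0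
    have hform := inner_formula_eq ha hr hl hι
    simp only [← hc] at hform
    simp only [wFun, abs_of_nonneg h0, ← hc, hform]
    split_ifs with hx
    · exact hin x h0 hx
    · push Not at hx
      rw [← intervalIntegral.integral_add_adjacent_intervals (hcont.intervalIntegrable 0 U)
        (hcont.intervalIntegrable U x), ← hin U F.U_pos.le le_rfl,
        intervalIntegral.integral_congr (a := U) (g := fun _ => h)]
      · simp; ring
      · intro t ht
        rw [uIcc_of_le hx.le] at ht
        simp only
        rw [F.s_clamp_of_ge ht.1]
        field_simp
  rcases le_total 0 x with h0 | h0
  · exact hpos x h0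
  · rw [← wFun_neg, hpos (-x) (by linarith)]
    have h1 := intervalIntegral.integral_comp_neg (a := 0) (b := -x)
      (f := fun t => -(2 * a * l * weberS c ι (clampTo U t)))
    simp only [clampTo_neg F.U_pos.le, weberS_neg, mul_neg, neg_neg, neg_zero] at h1
    rw [h1, intervalIntegral.integral_neg, ← intervalIntegral.integral_symm]

include ha hr hl F in
theorem hasDerivAt_wFun (x : ℝ) : HasDerivAt (wFun a r l h ι U)
    (2 * a * l * weberS √(r / (a ^ 2 * l)) ι (clampTo U x)) x := by
  have hcont : Continuous fun t => 2 * a * l * weberS √(r / (a ^ 2 * l)) ι (clampTo U t) :=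
    continuous_const.mul F.continuous_s_clamp
  rw [funext (wFun_eq_integral ha hr hl F)]
  exact hcont.integral_hasStrictDerivAt 0 x |>.hasDerivAt

include ha hr hl F in
theorem deriv_wFun : deriv (wFun a r l h ι U)
    = fun x => 2 * a * l * weberS √(r / (a ^ 2 * l)) ι (clampTo U x) :=
  funext fun x => (hasDerivAt_wFun ha hr hl F x).deriv

include ha hr hl F in
theorem deriv_wFun_of_abs_le {x : ℝ} (hx : |x| ≤ U) : deriv (wFun a r l h ι U) x
    = 2 * a * l * weberS √(r / (a ^ 2 * l)) ι x := by
  rw [(hasDerivAt_wFun ha hr hl F x).deriv, clampTo_of_abs_le hx]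

include ha hr hl F in
theorem deriv_wFun_of_ge {x : ℝ} (hx : U ≤ x) : deriv (wFun a r l h ι U) x = h := by
  rw [(hasDerivAt_wFun ha hr hl F x).deriv, F.s_clamp_of_ge hx]; field_simp

include ha hr hl F in
theorem deriv_wFun_of_le {x : ℝ} (hx : x ≤ -U) : deriv (wFun a r l h ι U) x = -h := by
  rw [(hasDerivAt_wFun ha hr hl F x).deriv, F.s_clamp_of_le hx]; field_simp

include ha hr hl F in
theorem deriv_wFun_eventuallyEq {x : ℝ} (hx : |x| < U) : deriv (wFun a r l h ι U)
    =ᶠ[𝓝 x] fun x => 2 * a * l * weberS √(r / (a ^ 2 * l)) ι x := by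
  filter_upwards [(isOpen_lt continuous_abs continuous_const).mem_nhds hx] with y hy
  exact deriv_wFun_of_abs_le ha hr hl F (le_of_lt hy)

include ha hr hl F in
theorem deriv_deriv_wFun {x : ℝ} (hx : |x| < U) : deriv (deriv (wFun a r l h ι U)) x
    = 2 * a * l * weberD √(r / (a ^ 2 * l)) ι x := by
  rw [(deriv_wFun_eventuallyEq ha hr hl F hx).deriv_eq]
  exact ((hasDerivAt_weberS F.c_pos.le F.mem_param x).const_mul _).deriv

include ha hr hl F in
theorem deriv_wFun_eventuallyEq_const {x : ℝ} (hx : U < |x|) :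
    ∃ d, |d| = |h| ∧ deriv (wFun a r l h ι U) =ᶠ[𝓝 x] fun _ => d := by
  rcases lt_abs.1 hx with h1 | h1
  · refine ⟨h, rfl, ?_⟩
    filter_upwards [lt_mem_nhds h1] with y hy using deriv_wFun_of_ge ha hr hl F (le_of_lt hy)
  · refine ⟨-h, abs_neg h, ?_⟩
    filter_upwards [gt_mem_nhds (show x < -U by linarith)] with y hy using
      deriv_wFun_of_le ha hr hl F (le_of_lt hy)

include F in
theorem abs_ne_of_notMem {x : ℝ} (hx : x ∉ ({-U, U} : Set ℝ)) : |x| < U ∨ U < |x| := by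
  refine lt_or_gt_of_ne fun h => hx ?_
  rcases (abs_eq F.U_pos.le).1 h with h | h <;> simp [h]

include ha hr hl F in
theorem contDiff_one_wFun : ContDiff ℝ 1 (wFun a r l h ι U) := by
  rw [contDiff_one_iff_deriv, deriv_wFun ha hr hl F]
  exact ⟨fun x => (hasDerivAt_wFun ha hr hl F x).differentiableAt,
    continuous_const.mul F.continuous_s_clamp⟩

include ha hr hl F in
theorem contDiffAt_deriv_wFun {x : ℝ} (hx : x ∉ ({-U, U} : Set ℝ)) :
    ContDiffAt ℝ 1 (deriv (wFun a r l h ι U)) x := by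
  rcases abs_ne_of_notMem F hx with hx | hx
  · have hs : ContDiff ℝ 1 (weberS √(r / (a ^ 2 * l)) ι) := by
      rw [contDiff_one_iff_deriv,
        funext fun x => (hasDerivAt_weberS F.c_pos.le F.mem_param x).deriv]
      exact ⟨fun x => (hasDerivAt_weberS F.c_pos.le F.mem_param x).differentiableAt,
        continuous_weberD F.c_pos.le F.mem_param⟩
    exact (contDiff_const.mul hs).contDiffAt.congr_of_eventuallyEq
      (deriv_wFun_eventuallyEq ha hr hl F hx)
  · obtain ⟨d, -, hd⟩ := deriv_wFun_eventuallyEq_const ha hr hl F hx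
    exact contDiffAt_const.congr_of_eventuallyEq hd

include ha hr hl F in
theorem contDiffOn_two_wFun : ContDiffOn ℝ 2 (wFun a r l h ι U) ({-U, U} : Set ℝ)ᶜ := by
  have ho : IsOpen ({-U, U} : Set ℝ)ᶜ := (Set.toFinite {-U, U}).isClosed.isOpen_compl
  rw [show (2 : WithTop ℕ∞) = 1 + 1 by norm_num, contDiffOn_succ_iff_deriv_of_isOpen ho]
  refine ⟨fun x _ => (hasDerivAt_wFun ha hr hl F x).differentiableAt.differentiableWithinAt,
    by simp, fun x hx => (contDiffAt_deriv_wFun ha hr hl F hx).contDiffWithinAt⟩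

/-! ### The free boundary problem -/

include ha hl F in
theorem nonneg_h : 0 ≤ h := by
  have h1 := mul_nonneg F.H_nonneg (show 0 ≤ 2 * a * l by positivity)
  rwa [div_mul_cancel₀ _ (by positivity)] at h1

-- This is the area condition multiplied by `2 a l`, since `w' = 2 a l (s - H) + h` on `[b, U]`.
include ha hr hl F in
theorem wFun_U_sub_wFun_b : wFun a r l h ι U U - wFun a r l h ι U b = k + h * (U - b) := by
  have hcont : Continuous fun t => 2 * a * l * weberS √(r / (a ^ 2 * l)) ι (clampTo U t) :=
    continuous_const.mul F.continuous_s_clamp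
  have h1 : ∀ t ∈ uIcc b U, 2 * a * l * weberS √(r / (a ^ 2 * l)) ι (clampTo U t)
      = 2 * a * l * (weberS √(r / (a ^ 2 * l)) ι t - h / (2 * a * l)) + h := by
    intro t ht
    rw [uIcc_of_le F.b_lt.le] at ht
    rw [clampTo_of_abs_le (by rw [abs_of_nonneg (F.b_nonneg.trans ht.1)]; exact ht.2)]
    field_simp
    ring
  rw [wFun_eq_integral ha hr hl F, wFun_eq_integral ha hr hl F,
    intervalIntegral.integral_interval_sub_left (hcont.intervalIntegrable _ _)
      (hcont.intervalIntegrable _ _), intervalIntegral.integral_congr h1,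
    intervalIntegral.integral_add _ (by simp), intervalIntegral.integral_const_mul, F.area]
  · simp
    field_simp
  · exact (continuous_const.mul (F.continuous_s.sub continuous_const)).intervalIntegrable _ _

include F in
theorem wFun_of_ge {x : ℝ} (hx : U ≤ x) :
    wFun a r l h ι U x = wFun a r l h ι U U + h * (x - U) := by
  have hU := F.U_pos
  rcases hx.eq_or_lt with rfl | hx
  · simp
  · simp only [wFun, not_le.2 hx, if_false, abs_of_pos hU, abs_of_pos (hU.trans hx), le_refl,
      if_true]

-- Completing the square in `v` isolates the minimiser; what remains is constant by the Riccati
-- equation.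
include ha hr hl F in
theorem genA_add_costA_of_abs_lt {x : ℝ} (hx : |x| < U) (v : ℝ) :
    genA a (wFun a r l h ι U) x v + costA r l x v = ι * a * √(r * l)
      + l * (v - uStar l (wFun a r l h ι U) x) ^ 2 := by
  rw [uStar, genA, costA, deriv_deriv_wFun ha hr hl F hx, deriv_wFun_of_abs_le ha hr hl F hx.le,
    weberD, sqrt_mul_eq ha hr hl]
  have h1 := sqrt_ratio_sq ha hr hl
  set c := √(r / (a ^ 2 * l))
  rw [← h1]
  field_simp
  ring

include ha hr hl F in
theorem genA_add_costA_of_lt_abs {x : ℝ} (hx : U < |x|) (v : ℝ) :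
    genA a (wFun a r l h ι U) x v + costA r l x v = r * x ^ 2 - h ^ 2 / (4 * l)
      + l * (v - uStar l (wFun a r l h ι U) x) ^ 2 := by
  obtain ⟨d, hd, hev⟩ := deriv_wFun_eventuallyEq_const ha hr hl F hx
  have h2 : d ^ 2 = h ^ 2 := by rw [← sq_abs d, hd, sq_abs]
  rw [uStar, genA, costA, hev.deriv_eq, hev.self_of_nhds, deriv_const, ← h2]
  field_simp
  ring

-- At `|x| = U` the strict inequality is `a² l` times `s' U < 0`, with `s U = H` inserted. It
-- persists further out because `r x²` grows.
include ha hr hl F in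
theorem le_of_lt_abs {x : ℝ} (hx : U < |x|) :
    ι * a * √(r * l) ≤ r * x ^ 2 - h ^ 2 / (4 * l) := by
  have hD := F.slope_U
  rw [weberD, F.at_U] at hD
  rw [sqrt_mul_eq ha hr hl]
  have h1 := sqrt_ratio_sq ha hr hl
  set c := √(r / (a ^ 2 * l))
  have h2 : U ^ 2 ≤ x ^ 2 := by
    rw [← sq_abs x]; exact pow_le_pow_left₀ F.U_pos.le hx.le 2
  have h3 : r * U ^ 2 ≤ r * x ^ 2 := mul_le_mul_of_nonneg_left h2 hr.le
  have h4 : a ^ 2 * l * ((h / (2 * a * l)) ^ 2 + ι * c - c ^ 2 * U ^ 2) < 0 :=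
    mul_neg_of_pos_of_neg (by positivity) hD
  have h5 : a ^ 2 * l * ((h / (2 * a * l)) ^ 2 + ι * c - c ^ 2 * U ^ 2)
      = h ^ 2 / (4 * l) + ι * a * (a * l * c) - (a ^ 2 * l * c ^ 2) * U ^ 2 := by
    field_simp; ring
  rw [h5, h1] at h4
  linarith

include ha hr hl F in
theorem le_genA_add_costA {x : ℝ} (hx : x ∉ ({-U, U} : Set ℝ)) (v : ℝ) :
    ι * a * √(r * l) ≤ genA a (wFun a r l h ι U) x v + costA r l x v := by
  have h1 : 0 ≤ l * (v - uStar l (wFun a r l h ι U) x) ^ 2 := by positivity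
  rcases abs_ne_of_notMem F hx with hx | hx
  · rw [genA_add_costA_of_abs_lt ha hr hl F hx]; linarith
  · rw [genA_add_costA_of_lt_abs ha hr hl F hx]
    linarith [le_of_lt_abs ha hr hl F hx]

include ha hr hl F in
theorem genA_uStar_lt {x : ℝ} (hx : x ∉ ({-U, U} : Set ℝ)) {v : ℝ}
    (hv : v ≠ uStar l (wFun a r l h ι U) x) :
    genA a (wFun a r l h ι U) x (uStar l (wFun a r l h ι U) x)
        + costA r l x (uStar l (wFun a r l h ι U) x)
      < genA a (wFun a r l h ι U) x v + costA r l x v := by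
  have h1 : 0 < l * (v - uStar l (wFun a r l h ι U) x) ^ 2 :=
    mul_pos hl (pow_pos (abs_pos.2 (sub_ne_zero.2 hv)) 2 |>.trans_eq (sq_abs _))
  rcases abs_ne_of_notMem F hx with hx | hx
  · rw [genA_add_costA_of_abs_lt ha hr hl F hx, genA_add_costA_of_abs_lt ha hr hl F hx]
    simpa using h1
  · rw [genA_add_costA_of_lt_abs ha hr hl F hx, genA_add_costA_of_lt_abs ha hr hl F hx]
    simpa using h1

-- The function `φ = w - h x` decreases up to `b`, increases from `b` to `U` and is constant from
-- `U` on. Its largest increase over an interval is therefore `φ U - φ b`, which value fit makes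
-- equal to `k`.
include ha hr hl F in
theorem wFun_sub_le {x y : ℝ} (hxy : y ≤ x) :
    wFun a r l h ι U x - wFun a r l h ι U y ≤ k + h * (x - y) := by
  have hκ : 0 < 2 * a * l := by positivity
  have hk : 0 < k := by
    have h1 := mul_pos F.K_pos hκ
    rwa [div_mul_cancel₀ _ hκ.ne'] at h1
  set φ : ℝ → ℝ := fun x => wFun a r l h ι U x - h * x with hφ
  have hd : ∀ x, HasDerivAt φ
      (2 * a * l * (weberS √(r / (a ^ 2 * l)) ι (clampTo U x) - h / (2 * a * l))) x := fun x =>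
    ((hasDerivAt_wFun ha hr hl F x).sub ((hasDerivAt_id x).const_mul h)).congr_deriv
      (by field_simp)
  have hcont : Continuous φ := continuous_iff_continuousAt.2 fun x => (hd x).continuousAt
  have hanti : AntitoneOn φ (Iic b) := by
    refine antitoneOn_of_deriv_nonpos (convex_Iic b) hcont.continuousOn
      (fun x _ => (hd x).differentiableAt.differentiableWithinAt) fun x hx => ?_
    rw [interior_Iic] at hx
    rw [(hd x).deriv]
    exact mul_nonpos_of_nonneg_of_nonpos hκ.le (sub_nonpos.2 (F.s_clamp_le (le_of_lt hx)))
  have hmono : MonotoneOn φ (Ici b) := by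
    refine monotoneOn_of_deriv_nonneg (convex_Ici b) hcont.continuousOn
      (fun x _ => (hd x).differentiableAt.differentiableWithinAt) fun x hx => ?_
    rw [interior_Ici] at hx
    rw [(hd x).deriv]
    exact mul_nonneg hκ.le (sub_nonneg.2 (F.H_le_s_clamp (le_of_lt hx)))
  have hmin : ∀ y, φ b ≤ φ y := fun y => by
    rcases le_total y b with h | h
    · exact hanti h (mem_Iic.2 le_rfl) h
    · exact hmono (mem_Ici.2 le_rfl) h h
  have hval : φ U - φ b = k := by
    have := wFun_U_sub_wFun_b ha hr hl F
    simp only [hφ]; linarith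
  have hle : φ x - φ y ≤ k := by
    rcases le_total x b with hxb | hxb
    · linarith [hanti (hxy.trans hxb) hxb hxy]
    · have h1 : φ x ≤ φ U := by
        rcases le_total x U with h2 | h2
        · exact hmono hxb (mem_Ici.2 F.b_lt.le) h2
        · simp only [hφ]
          rw [wFun_of_ge F h2]
          linarith
      linarith [hmin y]
  simp only [hφ] at hle
  linarith

include ha hr hl F in
theorem genB_add_costB_nonneg (x ξ : ℝ) :
    0 ≤ genB (wFun a r l h ι U) x ξ + costB k h ξ := by
  rw [genB, costB]
  rcases le_total 0 ξ with h0 | h0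
  · have h1 := wFun_sub_le ha hr hl F (x := -x) (y := -(x + ξ)) (by linarith)
    rw [wFun_neg, wFun_neg] at h1
    rw [abs_of_nonneg h0]
    linarith
  · have h1 := wFun_sub_le ha hr hl F (x := x) (y := x + ξ) (by linarith)
    rw [abs_of_nonpos h0]
    linarith

include ha hr hl F in
theorem isFreeBoundarySolution : IsFreeBoundarySolution a r l k h U (U - b)
    (wFun a r l h ι U) (ι * a * √(r * l)) := by
  have hκ : 0 < 2 * a * l := by positivity
  have hU := F.U_pos
  have hb := F.b_nonneg
  have hbU := F.b_lt
  have hh := nonneg_h ha hl F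
  have hwb := wFun_U_sub_wFun_b ha hr hl F
  have hH : 2 * a * l * (h / (2 * a * l)) = h := mul_div_cancel₀ _ hκ.ne'
  have habs : ∀ x, -U < x → x < U → |x| ≤ U := fun x h1 h2 => abs_le.2 ⟨h1.le, h2.le⟩
  have e1 : U - (U - b) = b := by ring
  have e2 : -U + (U - b) = -b := by ring
  have houter : ∀ x, U ≤ x → genB (wFun a r l h ι U) x (b - x) + costB k h (b - x) = 0 := by
    intro x hx
    rw [genB, costB, show x + (b - x) = b by ring, abs_of_nonpos (by linarith),
      wFun_of_ge F hx]
    linear_combination -hwb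
  have houter' : ∀ x, x ≤ -U → genB (wFun a r l h ι U) x (-b - x) + costB k h (-b - x) = 0 := by
    intro x hx
    have := houter (-x) (by linarith)
    rw [genB, costB] at this ⊢
    rw [show -x + (b - -x) = -(x + (-b - x)) by ring, wFun_neg, wFun_neg,
      show b - -x = -(-b - x) by ring, abs_neg] at this
    exact this
  have hcD := continuous_weberD F.c_pos.le F.mem_param
  have hs_pos : ∀ x ∈ Ioo (-b) b, -h < deriv (wFun a r l h ι U) x ∧
      deriv (wFun a r l h ι U) x < h := by
    have hpos : ∀ x, 0 ≤ x → x < b → -h < deriv (wFun a r l h ι U) x ∧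
        deriv (wFun a r l h ι U) x < h := by
      intro x h0 hx
      rw [deriv_wFun_of_abs_le ha hr hl F (habs x (by linarith) (by linarith))]
      -- For `h = 0` one has `b = 0`, and there is no `x` with `0 ≤ x < b`.
      have hhpos : 0 < h := hh.lt_of_ne fun h' => by
        have : b = 0 := F.b_eq_zero_iff.2 (by rw [← h', zero_div])
        linarith
      rcases h0.eq_or_lt with rfl | h0
      · rw [weberS_zero, mul_zero]; exact ⟨by linarith, hhpos⟩
      · have h1 := F.inner x ⟨h0, hx⟩
        constructor
        · linarith [mul_pos hκ h1.1]
        · rw [← hH]; exact mul_lt_mul_of_pos_left h1.2 hκ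
    intro x hx
    rcases le_total 0 x with h0 | h0
    · exact hpos x h0 hx.2
    · have h1 := hpos (-x) (by linarith) (by linarith [hx.1])
      rw [deriv_wFun ha hr hl F] at h1 ⊢
      simp only [clampTo_neg hU.le, weberS_neg] at h1
      constructor <;> linarith
  have hright : ∀ x ∈ Ioo b U, h < deriv (wFun a r l h ι U) x := by
    intro x hx
    rw [deriv_wFun_of_abs_le ha hr hl F (habs x (by linarith [hx.1]) hx.2), ← hH]
    exact mul_lt_mul_of_pos_left (F.outer x hx) hκ
  have hdU : deriv (wFun a r l h ι U) U = h := deriv_wFun_of_ge ha hr hl F le_rfl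
  have hdb : deriv (wFun a r l h ι U) b = h := by
    rw [deriv_wFun_of_abs_le ha hr hl F (habs b (by linarith) hbU), F.at_b, hH]
  have hodd : ∀ x, deriv (wFun a r l h ι U) (-x) = -deriv (wFun a r l h ι U) x := by
    intro x
    rw [deriv_wFun ha hr hl F]
    simp only [clampTo_neg hU.le, weberS_neg, mul_neg]
  refine ⟨?_, ?_, ?_, ⟨?_, ?_⟩, ?_, ?_, ?_, ?_, ?_⟩
  · intro x hx
    rw [genA_add_costA_of_abs_lt ha hr hl F (abs_lt.2 hx)]
    simp
  · constructor
    · have := houter U le_rfl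
      rwa [show b - U = -(U - b) by ring] at this
    · have := houter' (-U) le_rfl
      rwa [show -b - -U = U - b by ring] at this
  · rw [e1, e2, hodd, hodd, hdU, hdb]; simp
  · refine ⟨2 * a * l * weberD √(r / (a ^ 2 * l)) ι U,
      mul_neg_of_pos_of_neg hκ F.slope_U, ?_⟩
    refine ((continuous_const.mul hcD).tendsto U).mono_left nhdsWithin_le_nhds |>.congr' ?_
    filter_upwards [Ioo_mem_nhdsLT (show -U < U by linarith)] with x hx
    exact (deriv_deriv_wFun ha hr hl F (abs_lt.2 hx)).symm
  · refine ⟨2 * a * l * weberD √(r / (a ^ 2 * l)) ι U,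
      mul_neg_of_pos_of_neg hκ F.slope_U, ?_⟩
    rw [← weberD_neg]
    refine ((continuous_const.mul hcD).tendsto (-U)).mono_left nhdsWithin_le_nhds |>.congr' ?_
    filter_upwards [Ioo_mem_nhdsGT (show -U < U by linarith)] with x hx
    exact (deriv_deriv_wFun ha hr hl F (abs_lt.2 hx)).symm
  · intro x hx
    rw [e2] at hx
    have := hright (-x) ⟨by linarith [hx.2], by linarith [hx.1]⟩
    rw [hodd] at this
    linarith
  · rw [e1, e2]; exact hs_pos
  · rw [e1]; exact hright
  · rw [e1]; exact houter
  · rw [e2]; exact houter'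

end IsWeberFreeBoundary

/-! ### Cutoff functions -/

/-- A smooth cutoff equal to `1` on `(-1, 1)` and vanishing off `[-2, 2]`, with its first two
derivatives. -/
structure IsCutoff (χ χ' χ'' : ℝ → ℝ) (K : ℝ) : Prop where
  hasDerivAt : ∀ x, HasDerivAt χ (χ' x) x
  hasDerivAt' : ∀ x, HasDerivAt χ' (χ'' x) x
  continuous'' : Continuous χ''
  nonneg : 0 ≤ K
  bound : ∀ x, |χ x| ≤ K ∧ |χ' x| ≤ K ∧ |χ'' x| ≤ K
  eq_zero : ∀ x, 2 < |x| → χ x = 0 ∧ χ' x = 0 ∧ χ'' x = 0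
  eq_one : ∀ x, |x| < 1 → χ x = 1 ∧ χ' x = 0 ∧ χ'' x = 0

theorem exists_isCutoff : ∃ χ χ' χ'' K, IsCutoff χ χ' χ'' K := by
  let χ : ContDiffBump (0 : ℝ) := ⟨1, 2, one_pos, one_lt_two⟩
  have hs : ContDiff ℝ 2 (χ : ℝ → ℝ) := χ.contDiff
  have h1 : ContDiff ℝ 1 (deriv (χ : ℝ → ℝ)) := ((contDiff_succ_iff_deriv (n := 1)).1 hs).2.2
  have hc := χ.hasCompactSupport
  have h2 : Continuous (deriv (deriv (χ : ℝ → ℝ))) := h1.continuous_deriv le_rfl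
  obtain ⟨K0, hK0⟩ := hc.exists_bound_of_continuous hs.continuous
  obtain ⟨K1, hK1⟩ := hc.deriv.exists_bound_of_continuous h1.continuous
  obtain ⟨K2, hK2⟩ := hc.deriv.deriv.exists_bound_of_continuous h2
  refine ⟨χ, deriv χ, deriv (deriv χ), max K0 (max K1 K2),
    fun x => (hs.differentiable (by norm_num) x).hasDerivAt,
    fun x => (h1.differentiable (by norm_num) x).hasDerivAt, h2,
    (norm_nonneg _).trans ((hK0 0).trans (le_max_left _ _)), fun x => ⟨?_, ?_, ?_⟩, ?_, ?_⟩
  · exact (hK0 x).trans (le_max_left _ _)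
  · exact (hK1 x).trans ((le_max_left _ _).trans (le_max_right _ _))
  · exact (hK2 x).trans ((le_max_right _ _).trans (le_max_right _ _))
  · intro x hx
    have hev : (χ : ℝ → ℝ) =ᶠ[𝓝 x] fun _ => 0 := by
      filter_upwards [(isOpen_lt continuous_const continuous_abs).mem_nhds hx] with y hy
      exact χ.zero_of_le_dist (by rw [Real.dist_eq, sub_zero]; exact le_of_lt hy)
    refine ⟨hev.self_of_nhds, ?_, ?_⟩
    · rw [hev.deriv_eq]; simp
    · rw [hev.deriv.deriv_eq]; simp
  · intro x hx
    have hev : (χ : ℝ → ℝ) =ᶠ[𝓝 x] fun _ => 1 := by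
      filter_upwards [(isOpen_lt continuous_abs continuous_const).mem_nhds hx] with y hy
      exact χ.one_of_mem_closedBall (by
        rw [Metric.mem_closedBall, Real.dist_eq, sub_zero]; exact le_of_lt hy)
    refine ⟨hev.self_of_nhds, ?_, ?_⟩
    · rw [hev.deriv_eq]; simp
    · rw [hev.deriv.deriv_eq]; simp

/-- Two successive derivatives give `C²`. -/
theorem contDiff_two_of_hasDerivAt {f f' f'' : ℝ → ℝ} (h1 : ∀ x, HasDerivAt f (f' x) x)
    (h2 : ∀ x, HasDerivAt f' (f'' x) x) (hc : Continuous f'') : ContDiff ℝ 2 f := by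
  rw [show (2 : WithTop ℕ∞) = 1 + 1 by norm_num, contDiff_succ_iff_deriv,
    funext fun x => (h1 x).deriv, contDiff_one_iff_deriv, funext fun x => (h2 x).deriv]
  exact ⟨fun x => (h1 x).differentiableAt, by simp, fun x => (h2 x).differentiableAt, hc⟩

theorem genA_of_hasDerivAt {f f' f'' : ℝ → ℝ} (h1 : ∀ x, HasDerivAt f (f' x) x)
    (h2 : ∀ x, HasDerivAt f' (f'' x) x) (a x u : ℝ) :
    genA a f x u = 1 / 2 * a * f'' x + u * f' x := by
  rw [genA, funext fun x => (h1 x).deriv, (h2 x).deriv]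

theorem IsCutoff.continuous {χ χ' χ'' : ℝ → ℝ} {K : ℝ} (hχ : IsCutoff χ χ' χ'' K) :
    Continuous χ ∧ Continuous χ' :=
  ⟨continuous_iff_continuousAt.2 fun x => (hχ.hasDerivAt x).continuousAt,
    continuous_iff_continuousAt.2 fun x => (hχ.hasDerivAt' x).continuousAt⟩

/-! ### Finite cost -/

section Cost
variable {a r l k h : ℝ} {μ ρ : Measure (ℝ × ℝ)}

theorem costA_nonneg (hr : 0 < r) (hl : 0 < l) (x u : ℝ) : 0 ≤ costA r l x u := by
  unfold costA; positivity

theorem costB_pos (hk : 0 < k) (hh : 0 ≤ h) (ξ : ℝ) : 0 < costB k h ξ := by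
  unfold costB; positivity

theorem integrable_costA (hr : 0 < r) (hl : 0 < l) (hc : cost r l k h μ ρ < ⊤) :
    Integrable (fun z : ℝ × ℝ => costA r l z.1 z.2) μ := by
  refine ⟨Continuous.aestronglyMeasurable (by unfold costA; fun_prop), ?_⟩
  rw [hasFiniteIntegral_iff_ofReal (Eventually.of_forall fun z => costA_nonneg hr hl _ _)]
  exact (ENNReal.add_lt_top.1 hc).1

theorem integrable_costB (hk : 0 < k) (hh : 0 ≤ h) (hc : cost r l k h μ ρ < ⊤) :
    Integrable (fun z : ℝ × ℝ => costB k h z.2) ρ := by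
  refine ⟨Continuous.aestronglyMeasurable (by unfold costB; fun_prop), ?_⟩
  rw [hasFiniteIntegral_iff_ofReal (Eventually.of_forall fun z => (costB_pos hk hh _).le)]
  exact (ENNReal.add_lt_top.1 hc).2

theorem abs_le_one_add_costA (hr : 0 < r) (hl : 0 < l) (x u : ℝ) :
    |u| ≤ (1 + 1 / l) * (1 + costA r l x u) := by
  have h1 : |u| ≤ 1 + u ^ 2 := by
    rw [← sq_abs u]; nlinarith [sq_nonneg (|u| - 1), abs_nonneg u]
  have h2 : (1 + 1 / l) * (1 + costA r l x u)
      = 1 + u ^ 2 + (1 / l + r * x ^ 2 + l * u ^ 2 + r * x ^ 2 / l) := by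
    unfold costA; field_simp; ring
  rw [h2]
  have : 0 ≤ 1 / l + r * x ^ 2 + l * u ^ 2 + r * x ^ 2 / l := by positivity
  linarith

/-- The state marginal of a feasible measure of finite cost has no atoms. -/
theorem IsFeasible.measure_singleton_prod (hf : IsFeasible a μ ρ) (ha : 0 < a) (hr : 0 < r)
    (hl : 0 < l) (hc : cost r l k h μ ρ < ⊤) (y : ℝ) :
    μ ({y} ×ˢ (univ : Set ℝ)) = 0 := by
  have := hf.prob
  have := hf.finite
  obtain ⟨χ, χ', χ'', K, hχ⟩ := exists_isCutoff
  -- The rescalings `m⁻² ψ (m (x - y))` tend to zero with their first derivatives, while their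
  -- second derivatives stay bounded and tend to `2` at `y` and to `0` elsewhere. The limit of the
  -- constraint is then `a μ({y} × ℝ) = 0`.
  set ψ : ℝ → ℝ := fun x => x ^ 2 * χ x with hψ
  set ψ' : ℝ → ℝ := fun x => 2 * x * χ x + x ^ 2 * χ' x with hψ'
  set ψ'' : ℝ → ℝ := fun x => 2 * χ x + 4 * x * χ' x + x ^ 2 * χ'' x with hψ''
  have hd : ∀ x, HasDerivAt ψ (ψ' x) x := fun x =>
    ((hasDerivAt_pow 2 x).mul (hχ.hasDerivAt x)).congr_deriv (by simp [hψ'])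
  have hd' : ∀ x, HasDerivAt ψ' (ψ'' x) x := fun x =>
    ((((hasDerivAt_id x).const_mul 2).mul (hχ.hasDerivAt x)).add
      ((hasDerivAt_pow 2 x).mul (hχ.hasDerivAt' x))).congr_deriv (by simp [hψ'']; ring)
  have hcont'' : Continuous ψ'' := by
    have := hχ.continuous.1
    have := hχ.continuous.2
    have := hχ.continuous''
    fun_prop
  have hcont' : Continuous ψ' := continuous_iff_continuousAt.2 fun x => (hd' x).continuousAt
  have hcont : Continuous ψ := continuous_iff_continuousAt.2 fun x => (hd x).continuousAt
  have hsupp : ∀ x, 2 < |x| → ψ x = 0 ∧ ψ' x = 0 ∧ ψ'' x = 0 := fun x hx => by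
    obtain ⟨h0, h1, h2⟩ := hχ.eq_zero x hx
    simp [hψ, hψ', hψ'', h0, h1, h2]
  have hcs : ∀ g : ℝ → ℝ, (∀ x, 2 < |x| → g x = 0) → HasCompactSupport g := fun g hg =>
    HasCompactSupport.intro (isCompact_closedBall (0 : ℝ) 2) fun x hx => hg x (by
      rw [Metric.mem_closedBall, Real.dist_eq, sub_zero, not_le] at hx; exact hx)
  obtain ⟨C0, hC0⟩ := (hcs ψ fun x hx => (hsupp x hx).1).exists_bound_of_continuous hcont
  obtain ⟨C1, hC1⟩ := (hcs ψ' fun x hx => (hsupp x hx).2.1).exists_bound_of_continuous hcont'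
  obtain ⟨C2, hC2⟩ := (hcs ψ'' fun x hx => (hsupp x hx).2.2).exists_bound_of_continuous hcont''
  have hC00 : 0 ≤ C0 := (norm_nonneg _).trans (hC0 0)
  have hC10 : 0 ≤ C1 := (norm_nonneg _).trans (hC1 0)
  set m : ℕ → ℝ := fun n => (n : ℝ) + 1 with hm
  have hm1 : ∀ n, 1 ≤ m n := fun n => by simp [hm]
  have hm0 : ∀ n, 0 < m n := fun n => zero_lt_one.trans_le (hm1 n)
  have hmtop : Tendsto m atTop atTop :=
    tendsto_atTop_add_const_right _ _ tendsto_natCast_atTop_atTop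
  set f : ℕ → ℝ → ℝ := fun n x => (m n)⁻¹ ^ 2 * ψ (m n * (x - y)) with hfdef
  have hlin : ∀ n x, HasDerivAt (fun x => m n * (x - y)) (m n) x := fun n x =>
    (((hasDerivAt_id x).sub_const y).const_mul (m n)).congr_deriv (by simp)
  have hfd : ∀ n x, HasDerivAt (f n) ((m n)⁻¹ * ψ' (m n * (x - y))) x := fun n x =>
    (((hd _).comp x (hlin n x)).const_mul ((m n)⁻¹ ^ 2)).congr_deriv (by
      have := (hm0 n).ne'; field_simp)
  have hfd' : ∀ n x, HasDerivAt (fun x => (m n)⁻¹ * ψ' (m n * (x - y)))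
      (ψ'' (m n * (x - y))) x := fun n x =>
    (((hd' _).comp x (hlin n x)).const_mul ((m n)⁻¹)).congr_deriv (by
      have := (hm0 n).ne'; field_simp)
  have hfC : ∀ n, ContDiff ℝ 2 (f n) := fun n =>
    contDiff_two_of_hasDerivAt (hfd n) (hfd' n) (by fun_prop)
  have hfS : ∀ n, HasCompactSupport (f n) := fun n => by
    refine HasCompactSupport.intro (isCompact_closedBall y 2) fun x hx => ?_
    rw [Metric.mem_closedBall, Real.dist_eq, not_le] at hx
    have : 2 < |m n * (x - y)| := by
      rw [abs_mul, abs_of_pos (hm0 n)]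
      nlinarith [hm1 n]
    simp [hfdef, (hsupp _ this).1]
  have hminv : Tendsto (fun n => (m n)⁻¹) atTop (𝓝 0) := tendsto_inv_atTop_zero.comp hmtop
  have hminv1 : ∀ n, (m n)⁻¹ ≤ 1 := fun n => inv_le_one_of_one_le₀ (hm1 n)
  have hgA : ∀ n x u, genA a (f n) x u
      = 1 / 2 * a * ψ'' (m n * (x - y)) + u * ((m n)⁻¹ * ψ' (m n * (x - y))) := fun n x u =>
    genA_of_hasDerivAt (hfd n) (hfd' n) a x u
  have hcA := integrable_costA hr hl hc
  have hTA : Tendsto (fun n => ∫ z, genA a (f n) z.1 z.2 ∂μ) atTop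
      (𝓝 (∫ z, ({y} ×ˢ (univ : Set ℝ)).indicator (fun _ => a) z ∂μ)) := by
    refine tendsto_integral_of_dominated_convergence
      (fun z => 1 / 2 * a * C2 + C1 * ((1 + 1 / l) * (1 + costA r l z.1 z.2)))
      (fun n => (hf.constraint (f n) (hfC n) (hfS n)).1.aestronglyMeasurable) ?_ ?_ ?_
    · exact (integrable_const _).add
        ((((integrable_const (1 : ℝ)).add hcA).const_mul _).const_mul _)
    · intro n
      refine Eventually.of_forall fun z => ?_
      rw [hgA, Real.norm_eq_abs]
      refine (abs_add_le _ _).trans (add_le_add ?_ ?_)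
      · rw [abs_mul, abs_of_pos (by positivity)]
        exact mul_le_mul_of_nonneg_left (hC2 _) (by positivity)
      · rw [abs_mul, abs_mul, abs_of_pos (inv_pos.2 (hm0 n)), mul_comm]
        have h1 := abs_le_one_add_costA hr hl z.1 z.2
        have h2 : (m n)⁻¹ * |ψ' (m n * (z.1 - y))| ≤ 1 * C1 :=
          mul_le_mul (hminv1 n) (hC1 _) (abs_nonneg _) zero_le_one
        rw [one_mul] at h2
        exact mul_le_mul h2 h1 (abs_nonneg _) hC10
    · refine Eventually.of_forall fun z => ?_
      obtain ⟨x, u⟩ := z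
      simp only [hgA]
      by_cases hx : x = y
      · subst hx
        obtain ⟨h0, h1, h2⟩ := hχ.eq_one 0 (by simp)
        have e1 : ψ'' 0 = 2 := by simp [hψ'', h0]
        have e2 : ψ' 0 = 0 := by simp [hψ']
        simp [e1, e2]
        ring
      · have hev : ∀ᶠ n in atTop, 2 < |m n * (x - y)| := by
          have : Tendsto (fun n => |m n * (x - y)|) atTop atTop := by
            simp_rw [abs_mul, abs_of_pos (hm0 _)]
            exact hmtop.atTop_mul_const (abs_pos.2 (sub_ne_zero.2 hx))
          exact this.eventually_gt_atTop 2
        have e : ({y} ×ˢ (univ : Set ℝ)).indicator (fun _ => a) (x, u) = 0 :=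
          indicator_of_notMem (by simpa using hx) _
        rw [e]
        refine tendsto_const_nhds.congr' ?_
        filter_upwards [hev] with n hn
        rw [(hsupp _ hn).2.1, (hsupp _ hn).2.2]; simp
  have hfb : ∀ n x, |f n x| ≤ (m n)⁻¹ * C0 := fun n x => by
    have h0 := inv_pos.2 (hm0 n)
    rw [hfdef]
    simp only
    rw [abs_mul, abs_of_pos (by positivity)]
    refine mul_le_mul ?_ (hC0 _) (abs_nonneg _) h0.le
    rw [sq]
    exact mul_le_of_le_one_left h0.le (hminv1 n)
  have hgB : ∀ n x ξ, |genB (f n) x ξ| ≤ (m n)⁻¹ * (2 * C0) := fun n x ξ => by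
    rw [genB]
    have := abs_sub (f n (x + ξ)) (f n x)
    linarith [hfb n (x + ξ), hfb n x]
  have hTB : Tendsto (fun n => ∫ z, genB (f n) z.1 z.2 ∂ρ) atTop
      (𝓝 (∫ _, (0 : ℝ) ∂ρ)) := by
    refine tendsto_integral_of_dominated_convergence (fun _ => 2 * C0)
      (fun n => (hf.constraint (f n) (hfC n) (hfS n)).2.1.aestronglyMeasurable)
      (integrable_const _) ?_ ?_
    · intro n
      refine Eventually.of_forall fun z => (hgB n _ _).trans ?_
      exact mul_le_of_le_one_left (by positivity) (hminv1 n)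
    · refine Eventually.of_forall fun z => ?_
      refine squeeze_zero_norm (hgB · z.1 z.2) ?_
      simpa using hminv.mul_const (2 * C0)
  have hT := hTA.add hTB
  simp only [fun n => (hf.constraint (f n) (hfC n) (hfS n)).2.2] at hT
  have h0 := tendsto_nhds_unique hT tendsto_const_nhds
  rw [integral_indicator_const _ ((measurableSet_singleton y).prod MeasurableSet.univ)] at h0
  simp only [smul_eq_mul, integral_zero, add_zero, mul_eq_zero, ha.ne', or_false] at h0
  exact (measureReal_eq_zero_iff).1 h0

/-! ### Verification -/

/-- The test functions of the linear program approximate `w` in the sense of pointwise convergence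
dominated by the cost. -/
def IsApproximable (a r l k h : ℝ) (N : Set ℝ) (w : ℝ → ℝ) : Prop :=
  ∃ (wn : ℕ → ℝ → ℝ) (θ : ℝ), 0 ≤ θ ∧
    (∀ n, ContDiff ℝ 2 (wn n) ∧ HasCompactSupport (wn n)) ∧
    (∀ x ∉ N, ∀ u : ℝ, Tendsto (fun n => genA a (wn n) x u) atTop (𝓝 (genA a w x u))) ∧
    (∀ x ξ : ℝ, ξ ≠ 0 → Tendsto (fun n => genB (wn n) x ξ) atTop (𝓝 (genB w x ξ))) ∧
    (∀ n, ∀ x ∉ N, ∀ u : ℝ, |genA a (wn n) x u| ≤ θ * (1 + costA r l x u)) ∧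
    (∀ n, ∀ x ξ : ℝ, ξ ≠ 0 → |genB (wn n) x ξ| ≤ θ * costB k h ξ)

theorem IsFeasible.ae_jump_ne_zero (hf : IsFeasible a μ ρ) : ∀ᵐ z ∂ρ, z.2 ≠ 0 := by
  rw [ae_iff]; simpa using hf.no_zero_jump

theorem IsFeasible.ae_notMem (hf : IsFeasible a μ ρ) (ha : 0 < a) (hr : 0 < r)
    (hl : 0 < l) (hc : cost r l k h μ ρ < ⊤) {N : Set ℝ} (hN : N.Countable) :
    μ (N ×ˢ (univ : Set ℝ)) = 0 ∧ ∀ᵐ z ∂μ, z.1 ∉ N := by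
  have h0 : μ (N ×ˢ (univ : Set ℝ)) = 0 := by
    rw [← biUnion_of_singleton N, iUnion₂_prod_const, measure_biUnion_null_iff hN]
    exact fun y _ => hf.measure_singleton_prod ha hr hl hc y
  refine ⟨h0, ?_⟩
  rw [ae_iff]
  convert h0 using 2
  ext z; simp

/-- Dominated convergence with the cost as majorant carries the constraint from the test functions
to `w`; the points of `N` do not matter because the state marginal has no atoms. -/
theorem IsFeasible.integral_eq_zero (hf : IsFeasible a μ ρ) (ha : 0 < a) (hr : 0 < r)
    (hl : 0 < l) (hk : 0 < k) (hh : 0 ≤ h) (hc : cost r l k h μ ρ < ⊤) {N : Set ℝ}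
    (hN : N.Countable) {w : ℝ → ℝ} (hw : IsApproximable a r l k h N w) :
    Integrable (fun z : ℝ × ℝ => genA a w z.1 z.2) μ ∧
      Integrable (fun z : ℝ × ℝ => genB w z.1 z.2) ρ ∧
      ∫ z, genA a w z.1 z.2 ∂μ + ∫ z, genB w z.1 z.2 ∂ρ = 0 := by
  have := hf.prob
  obtain ⟨wn, θ, hθ, hwn, hTA, hTB, hbA, hbB⟩ := hw
  have hcon := fun n => hf.constraint (wn n) (hwn n).1 (hwn n).2
  have hA := (hf.ae_notMem ha hr hl hc hN).2
  have hB := hf.ae_jump_ne_zero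
  have hiA : Integrable (fun z : ℝ × ℝ => θ * (1 + costA r l z.1 z.2)) μ :=
    ((integrable_const (1 : ℝ)).add (integrable_costA hr hl hc)).const_mul _
  have hiB : Integrable (fun z : ℝ × ℝ => θ * costB k h z.2) ρ :=
    (integrable_costB hk hh hc).const_mul _
  have hlA : ∀ᵐ z ∂μ, Tendsto (fun n => genA a (wn n) z.1 z.2) atTop (𝓝 (genA a w z.1 z.2)) := by
    filter_upwards [hA] with z hz using hTA z.1 hz z.2
  have hlB : ∀ᵐ z ∂ρ, Tendsto (fun n => genB (wn n) z.1 z.2) atTop (𝓝 (genB w z.1 z.2)) := by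
    filter_upwards [hB] with z hz using hTB z.1 z.2 hz
  have hT1 := tendsto_integral_of_dominated_convergence _
    (fun n => (hcon n).1.aestronglyMeasurable) hiA
    (fun n => by filter_upwards [hA] with z hz using hbA n z.1 hz z.2) hlA
  have hT2 := tendsto_integral_of_dominated_convergence _
    (fun n => (hcon n).2.1.aestronglyMeasurable) hiB
    (fun n => by filter_upwards [hB] with z hz using hbB n z.1 z.2 hz) hlB
  refine ⟨hiA.mono' (aestronglyMeasurable_of_tendsto_ae atTop
      (fun n => (hcon n).1.aestronglyMeasurable) hlA) ?_,
    hiB.mono' (aestronglyMeasurable_of_tendsto_ae atTop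
      (fun n => (hcon n).2.1.aestronglyMeasurable) hlB) ?_, ?_⟩
  · filter_upwards [hA, hlA] with z hz hlz
    exact le_of_tendsto hlz.norm (Eventually.of_forall fun n => hbA n z.1 hz z.2)
  · filter_upwards [hB, hlB] with z hz hlz
    exact le_of_tendsto hlz.norm (Eventually.of_forall fun n => hbB n z.1 z.2 hz)
  · have hT := hT1.add hT2
    simp only [fun n => (hcon n).2.2] at hT
    exact tendsto_nhds_unique hT tendsto_const_nhds

/-- Adding the zero `∫ A w dμ + ∫ B w dρ` rewrites the cost through exactly the two quantities that
the variational inequalities bound from below. -/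
theorem IsFeasible.cost_eq (hf : IsFeasible a μ ρ) (ha : 0 < a) (hr : 0 < r)
    (hl : 0 < l) (hk : 0 < k) (hh : 0 ≤ h) (hc : cost r l k h μ ρ < ⊤) {N : Set ℝ}
    (hN : N.Countable) {w : ℝ → ℝ} (hw : IsApproximable a r l k h N w) :
    Integrable (fun z : ℝ × ℝ => genA a w z.1 z.2 + costA r l z.1 z.2) μ ∧
    Integrable (fun z : ℝ × ℝ => genB w z.1 z.2 + costB k h z.2) ρ ∧
    cost r l k h μ ρ = ENNReal.ofReal (∫ z, (genA a w z.1 z.2 + costA r l z.1 z.2) ∂μ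
      + ∫ z, (genB w z.1 z.2 + costB k h z.2) ∂ρ) := by
  obtain ⟨h1, h2, h3⟩ := hf.integral_eq_zero ha hr hl hk hh hc hN hw
  have hA := integrable_costA hr hl hc
  have hB := integrable_costB hk hh hc
  refine ⟨h1.add hA, h2.add hB, ?_⟩
  rw [integral_add h1 hA, integral_add h2 hB]
  have hA0 : 0 ≤ ∫ z, costA r l z.1 z.2 ∂μ := integral_nonneg fun z => costA_nonneg hr hl _ _
  have hB0 : 0 ≤ ∫ z : ℝ × ℝ, costB k h z.2 ∂ρ := integral_nonneg fun z => (costB_pos hk hh _).le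
  rw [show ∀ p q s t : ℝ, p + q + (s + t) = (p + s) + (q + t) by intros; ring, h3, zero_add,
    ENNReal.ofReal_add hA0 hB0,
    ofReal_integral_eq_lintegral_ofReal hA (Eventually.of_forall fun z => costA_nonneg hr hl _ _),
    ofReal_integral_eq_lintegral_ofReal hB (Eventually.of_forall fun z => (costB_pos hk hh _).le),
    cost]

theorem IsFeasible.le_cost (hf : IsFeasible a μ ρ) (ha : 0 < a) (hr : 0 < r)
    (hl : 0 < l) (hk : 0 < k) (hh : 0 ≤ h) {N : Set ℝ}
    (hN : N.Countable) {w : ℝ → ℝ} (hw : IsApproximable a r l k h N w) {I : ℝ}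
    (hcA : ∀ x ∉ N, ∀ u : ℝ, I ≤ genA a w x u + costA r l x u)
    (hcB : ∀ x ξ : ℝ, ξ ≠ 0 → 0 ≤ genB w x ξ + costB k h ξ) :
    ENNReal.ofReal I ≤ cost r l k h μ ρ := by
  have := hf.prob
  by_cases hc : cost r l k h μ ρ < ⊤
  · obtain ⟨h1, h2, h3⟩ := hf.cost_eq ha hr hl hk hh hc hN hw
    rw [h3]
    refine ENNReal.ofReal_le_ofReal ?_
    have hA : I ≤ ∫ z, (genA a w z.1 z.2 + costA r l z.1 z.2) ∂μ := by
      have := integral_mono_ae (integrable_const I) h1 (by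
        filter_upwards [(hf.ae_notMem ha hr hl hc hN).2] with z hz using hcA z.1 hz z.2)
      simpa using this
    have hB : 0 ≤ ∫ z, (genB w z.1 z.2 + costB k h z.2) ∂ρ := integral_nonneg_of_ae (by
      filter_upwards [hf.ae_jump_ne_zero] with z hz using hcB z.1 z.2 hz)
    linarith
  · rw [not_lt_top_iff.1 hc]; exact le_top

theorem IsFeasible.cost_eq_of_ae (hf : IsFeasible a μ ρ) (ha : 0 < a) (hr : 0 < r)
    (hl : 0 < l) (hk : 0 < k) (hh : 0 ≤ h) (hc : cost r l k h μ ρ < ⊤) {N : Set ℝ}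
    (hN : N.Countable) {w : ℝ → ℝ} (hw : IsApproximable a r l k h N w) {I : ℝ}
    (hcA : ∀ᵐ z ∂μ, genA a w z.1 z.2 + costA r l z.1 z.2 = I)
    (hcB : ∀ᵐ z ∂ρ, genB w z.1 z.2 + costB k h z.2 = 0) :
    cost r l k h μ ρ = ENNReal.ofReal I := by
  have := hf.prob
  obtain ⟨-, -, h3⟩ := hf.cost_eq ha hr hl hk hh hc hN hw
  rw [h3, integral_congr_ae hcA, integral_congr_ae hcB]
  simp

end Cost

/-! ### Approximation by Steklov averages -/

/-- Forward difference quotient. -/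
def forwardQuotient (δ : ℝ) (f : ℝ → ℝ) (x : ℝ) : ℝ := δ⁻¹ * (f (x + δ) - f x)

theorem hasDerivAt_forwardQuotient {f f' : ℝ → ℝ} (hf : ∀ x, HasDerivAt f (f' x) x) (δ x : ℝ) :
    HasDerivAt (forwardQuotient δ f) (forwardQuotient δ f' x) x :=
  (((hf (x + δ)).comp_add_const x δ).sub (hf x)).const_mul _

theorem exists_forwardQuotient_eq {f f' : ℝ → ℝ} (hf : ∀ x, HasDerivAt f (f' x) x) {δ : ℝ} (hδ : 0 < δ)
    (x : ℝ) : ∃ t ∈ Ioo x (x + δ), forwardQuotient δ f x = f' t := by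
  obtain ⟨t, ht, h⟩ := exists_hasDerivAt_eq_slope f f' (show x < x + δ by linarith)
    (fun y _ => (hf y).continuousAt.continuousWithinAt) fun y _ => hf y
  refine ⟨t, ht, ?_⟩
  rw [h, forwardQuotient, add_sub_cancel_left, div_eq_inv_mul]

theorem tendsto_forwardQuotient {f : ℝ → ℝ} {f' x : ℝ} (hf : HasDerivAt f f' x) {δ : ℕ → ℝ}
    (hδ : ∀ n, 0 < δ n) (h0 : Tendsto δ atTop (𝓝 0)) :
    Tendsto (fun n => forwardQuotient (δ n) f x) atTop (𝓝 f') :=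
  hf.tendsto_slope_zero_right.comp
    (tendsto_nhdsWithin_iff.2 ⟨h0, Eventually.of_forall hδ⟩)

/-- A `C¹` function with bounded Lipschitz derivative is a limit of compactly supported `C²`
functions with uniformly bounded first two derivatives. -/
theorem exists_steklov_approx {w w' : ℝ → ℝ} (hw : ∀ x, HasDerivAt w (w' x) x) {C L : ℝ}
    (hC : ∀ x, |w' x| ≤ C) (hL : ∀ x y, |w' x - w' y| ≤ L * |x - y|) :
    ∃ (f f' f'' : ℕ → ℝ → ℝ) (K C₁ C₂ : ℝ),
      (∀ n x, HasDerivAt (f n) (f' n x) x) ∧ (∀ n x, HasDerivAt (f' n) (f'' n x) x) ∧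
      (∀ n, Continuous (f'' n)) ∧ (∀ n, HasCompactSupport (f n)) ∧
      (∀ x, Tendsto (fun n => f n x) atTop (𝓝 (w x))) ∧
      (∀ x, Tendsto (fun n => f' n x) atTop (𝓝 (w' x))) ∧
      (∀ x w'', HasDerivAt w' w'' x → Tendsto (fun n => f'' n x) atTop (𝓝 w'')) ∧
      (∀ n x, |f' n x| ≤ C₁) ∧ (∀ n x, |f'' n x| ≤ C₂) ∧
      (0 ≤ K ∧ ∀ M, (∀ x, |w x| ≤ M) → ∀ n x, |f n x| ≤ K * M) := by
  obtain ⟨χ, χ', χ'', K, hχ⟩ := exists_isCutoff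
  have hwc : Continuous w := continuous_iff_continuousAt.2 fun x => (hw x).continuousAt
  have hC0 : 0 ≤ C := (abs_nonneg _).trans (hC 0)
  have hL0 : 0 ≤ L := by
    have := (abs_nonneg _).trans (hL 1 0); simpa using this
  have hw'c : Continuous w' := by
    have : LipschitzWith L.toNNReal w' := LipschitzWith.of_dist_le_mul fun x y => by
      rw [Real.coe_toNNReal L hL0]; exact hL x y
    exact this.continuous
  -- The forward quotient of an antiderivative of `w` is the average of `w` over `[x, x + δ]`. It is
  -- `C²`, and its first two derivatives are the difference quotients of `w` and `w'`, bounded by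
  -- `C` and `L`.
  set Φ : ℝ → ℝ := fun x => ∫ t in (0 : ℝ)..x, w t
  have hΦ : ∀ x, HasDerivAt Φ (w x) x := fun x => (hwc.integral_hasStrictDerivAt 0 x).hasDerivAt
  set δ : ℕ → ℝ := fun n => 1 / ((n : ℝ) + 1) with hδ
  have hδ0 : ∀ n, 0 < δ n := fun n => by positivity
  have hδ1 : ∀ n, δ n ≤ 1 := fun n => by
    rw [hδ]; simp only; rw [div_le_one (by positivity)]; simp
  have hδt : Tendsto δ atTop (𝓝 0) := tendsto_one_div_add_atTop_nhds_zero_nat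
  set W : ℕ → ℝ → ℝ := fun n => forwardQuotient (δ n) Φ
  set W' : ℕ → ℝ → ℝ := fun n => forwardQuotient (δ n) w
  set W'' : ℕ → ℝ → ℝ := fun n => forwardQuotient (δ n) w'
  have hWd : ∀ n x, HasDerivAt (W n) (W' n x) x := fun n x => hasDerivAt_forwardQuotient hΦ _ _
  have hWd' : ∀ n x, HasDerivAt (W' n) (W'' n x) x := fun n x => hasDerivAt_forwardQuotient hw _ _
  have hW'b : ∀ n x, |W' n x| ≤ C := fun n x => by
    obtain ⟨t, -, ht⟩ := exists_forwardQuotient_eq hw (hδ0 n) x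
    exact (congrArg abs ht).trans_le (hC t)
  have hW''b : ∀ n x, |W'' n x| ≤ L := fun n x => by
    have h1 := hL (x + δ n) x
    rw [add_sub_cancel_left, abs_of_pos (hδ0 n)] at h1
    simp only [W'', forwardQuotient]
    rw [abs_mul, abs_of_pos (inv_pos.2 (hδ0 n)), inv_mul_le_iff₀ (hδ0 n)]
    linarith
  have hwlin : ∀ x, |w x| ≤ |w 0| + C * |x| := fun x => by
    have h1 := convex_univ.norm_image_sub_le_of_norm_hasDerivWithin_le (x := 0) (y := x)
      (fun y _ => (hw y).hasDerivWithinAt) (fun y _ => hC y) (mem_univ _) (mem_univ _)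
    rw [sub_zero, Real.norm_eq_abs, Real.norm_eq_abs] at h1
    have h2 := abs_add_le (w x - w 0) (w 0)
    rw [sub_add_cancel] at h2
    linarith
  -- The cutoff lives at scale `1 / δ`, where `w` may grow like `1 / δ`. Each derivative of the
  -- cutoff brings a factor `δ` that compensates, so `δ W` is bounded on its support.
  set M₁ : ℝ := |w 0| + 3 * C with hM₁
  have hWb : ∀ n x, |δ n * x| ≤ 2 → |δ n * W n x| ≤ M₁ := fun n x hx => by
    obtain ⟨t, ht, hWt⟩ := exists_forwardQuotient_eq hΦ (hδ0 n) x
    rw [abs_mul, abs_of_pos (hδ0 n)] at hx ⊢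
    simp only [W, hWt]
    have ht' : |t| ≤ |x| + δ n := by
      have h1 := abs_add_le (t - x) x
      rw [sub_add_cancel, abs_of_pos (sub_pos.2 ht.1)] at h1
      linarith [ht.2]
    have h1 : |t| ≤ |x| + 1 := ht'.trans (by linarith [hδ1 n])
    calc δ n * |w t| ≤ δ n * (|w 0| + C * (|x| + 1)) :=
          mul_le_mul_of_nonneg_left ((hwlin t).trans (by gcongr)) (hδ0 n).le
      _ = δ n * (|w 0| + C) + C * (δ n * |x|) := by ring
      _ ≤ 1 * (|w 0| + C) + C * 2 := by gcongr; exact hδ1 n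
      _ = M₁ := by rw [hM₁]; ring
  have hM₁0 : 0 ≤ M₁ := by positivity
  have hK := hχ.nonneg
  have hcut : ∀ (g : ℝ → ℝ), (∀ x, |g x| ≤ K) → (∀ x, 2 < |x| → g x = 0) → ∀ n x,
      |g (δ n * x) * (δ n * W n x)| ≤ K * M₁ := fun g hg hg0 n x => by
    rcases le_or_gt |δ n * x| 2 with h | h
    · rw [abs_mul]; exact mul_le_mul (hg _) (hWb n x h) (abs_nonneg _) hK
    · rw [hg0 _ h, zero_mul, abs_zero]; positivity
  set f : ℕ → ℝ → ℝ := fun n x => χ (δ n * x) * W n x with hf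
  set f' : ℕ → ℝ → ℝ := fun n x => χ' (δ n * x) * (δ n * W n x) + χ (δ n * x) * W' n x with hf'
  set f'' : ℕ → ℝ → ℝ := fun n x => δ n * (χ'' (δ n * x) * (δ n * W n x))
    + 2 * δ n * (χ' (δ n * x) * W' n x) + χ (δ n * x) * W'' n x with hf''
  have hlin : ∀ n x, HasDerivAt (fun x => δ n * x) (δ n) x := fun n x =>
    ((hasDerivAt_id x).const_mul (δ n)).congr_deriv (by simp)
  have hcd : ∀ n x, HasDerivAt (fun x => χ (δ n * x)) (χ' (δ n * x) * δ n) x := fun n x =>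
    (hχ.hasDerivAt _).comp x (hlin n x)
  have hcd' : ∀ n x, HasDerivAt (fun x => χ' (δ n * x)) (χ'' (δ n * x) * δ n) x := fun n x =>
    (hχ.hasDerivAt' _).comp x (hlin n x)
  have hone : ∀ x, ∀ᶠ n in atTop, |δ n * x| < 1 := fun x => by
    have : Tendsto (fun n => |δ n * x|) atTop (𝓝 0) := by
      simpa using (hδt.mul_const x).abs
    exact this.eventually_lt_const one_pos
  refine ⟨f, f', f'', K, K * M₁ + K * C, K * M₁ + 2 * (K * C) + K * L, ?_, ?_, ?_, ?_, ?_, ?_, ?_,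
    ?_, ?_, hK, ?_⟩
  · intro n x
    exact ((hcd n x).mul (hWd n x)).congr_deriv (by simp only [hf']; ring)
  · intro n x
    refine (((hcd' n x).mul ((hWd n x).const_mul (δ n))).add
      ((hcd n x).mul (hWd' n x))).congr_deriv ?_
    simp only [hf'']; ring
  · intro n
    have h1 := hχ.continuous.1
    have h2 := hχ.continuous.2
    have h3 := hχ.continuous''
    have h4 : Continuous (W n) := continuous_iff_continuousAt.2 fun x => (hWd n x).continuousAt
    have h5 : Continuous (W' n) := continuous_iff_continuousAt.2 fun x => (hWd' n x).continuousAt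
    have h6 : Continuous (W'' n) := by unfold W'' forwardQuotient; fun_prop
    fun_prop
  · intro n
    refine HasCompactSupport.intro (isCompact_closedBall (0 : ℝ) (2 / δ n)) fun x hx => ?_
    rw [Metric.mem_closedBall, Real.dist_eq, sub_zero, not_le, div_lt_iff₀ (hδ0 n)] at hx
    have : 2 < |δ n * x| := by rw [abs_mul, abs_of_pos (hδ0 n)]; linarith
    simp [hf, (hχ.eq_zero _ this).1]
  · intro x
    refine (tendsto_forwardQuotient (hΦ x) hδ0 hδt).congr' ?_
    filter_upwards [hone x] with n hn
    simp [hf, (hχ.eq_one _ hn).1, W]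
  · intro x
    refine (tendsto_forwardQuotient (hw x) hδ0 hδt).congr' ?_
    filter_upwards [hone x] with n hn
    simp [hf', (hχ.eq_one _ hn).1, (hχ.eq_one _ hn).2.1, W']
  · intro x w'' hx
    refine (tendsto_forwardQuotient hx hδ0 hδt).congr' ?_
    filter_upwards [hone x] with n hn
    simp [hf'', (hχ.eq_one _ hn).1, (hχ.eq_one _ hn).2.1, (hχ.eq_one _ hn).2.2, W'']
  · intro n x
    refine (abs_add_le _ _).trans (add_le_add
      (hcut χ' (fun x => (hχ.bound x).2.1) (fun x hx => (hχ.eq_zero x hx).2.1) n x) ?_)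
    rw [abs_mul]
    exact mul_le_mul (hχ.bound _).1 (hW'b n x) (abs_nonneg _) hK
  · intro n x
    refine (abs_add_le _ _).trans (add_le_add ((abs_add_le _ _).trans (add_le_add ?_ ?_)) ?_)
    · rw [abs_mul, abs_of_pos (hδ0 n)]
      exact (mul_le_of_le_one_left (abs_nonneg _) (hδ1 n)).trans
        (hcut χ'' (fun x => (hχ.bound x).2.2) (fun x hx => (hχ.eq_zero x hx).2.2) n x)
    · rw [abs_mul, abs_of_pos (by linarith [hδ0 n] : 0 < 2 * δ n), abs_mul]
      have h1 : |χ' (δ n * x)| * |W' n x| ≤ K * C :=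
        mul_le_mul (hχ.bound _).2.1 (hW'b n x) (abs_nonneg _) hK
      exact mul_le_mul (by linarith [hδ1 n]) h1 (by positivity) (by norm_num)
    · rw [abs_mul]
      exact mul_le_mul (hχ.bound _).1 (hW''b n x) (abs_nonneg _) hK
  · intro M hM n x
    obtain ⟨t, -, ht⟩ := exists_forwardQuotient_eq hΦ (hδ0 n) x
    simp only [hf, W]
    rw [abs_mul, ht]
    exact mul_le_mul (hχ.bound _).1 (hM t) (abs_nonneg _) hK

theorem isApproximable_of_lipschitz_deriv {a r l k h : ℝ} (ha : 0 < a) (hr : 0 < r) (hl : 0 < l)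
    (hk : 0 < k) (hh : 0 ≤ h) {w w' : ℝ → ℝ} (hw : ∀ x, HasDerivAt w (w' x) x) {C L : ℝ}
    (hC : ∀ x, |w' x| ≤ C) (hL : ∀ x y, |w' x - w' y| ≤ L * |x - y|) {N : Set ℝ}
    (hN : ∀ x ∉ N, DifferentiableAt ℝ w' x) (hb : h = 0 → ∃ M, ∀ x, |w x| ≤ M) :
    IsApproximable a r l k h N w := by
  obtain ⟨f, f', f'', K, C₁, C₂, hd, hd', hc, hs, ht, ht', ht'', hb1, hb2, hK, hbM⟩ :=
    exists_steklov_approx hw hC hL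
  have hC₁ : 0 ≤ C₁ := (abs_nonneg _).trans (hb1 0 0)
  have hC₂ : 0 ≤ C₂ := (abs_nonneg _).trans (hb2 0 0)
  obtain ⟨M, hM0, hM⟩ : ∃ M, 0 ≤ M ∧ (h = 0 → ∀ n x, |f n x| ≤ M) := by
    by_cases h0 : h = 0
    · obtain ⟨M, hM⟩ := hb h0
      exact ⟨K * M, mul_nonneg hK ((abs_nonneg _).trans (hM 0)), fun _ => hbM M hM⟩
    · exact ⟨0, le_rfl, fun h' => (h0 h').elim⟩
  set θA := 1 / 2 * a * C₂ + C₁ * (1 + 1 / l) with hθA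
  -- For `h = 0` the first term is `C₁ / 0 = 0`, and the sup bound `M` is compared with the fixed
  -- cost `k`. For `h > 0` the first term turns the Lipschitz bound `C₁ |ξ|` into a multiple of `h
  -- |ξ|`.
  set θB := C₁ / h + 2 * M / k with hθB
  have hA0 : 0 ≤ θA := by positivity
  have hB0 : 0 ≤ θB := by positivity
  refine ⟨f, θA + θB, by positivity,
    fun n => ⟨contDiff_two_of_hasDerivAt (hd n) (hd' n) (hc n), hs n⟩, ?_, ?_, ?_, ?_⟩
  · intro x hx u
    simp only [genA_of_hasDerivAt (hd _) (hd' _)]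
    rw [genA, funext fun x => (hw x).deriv]
    exact ((ht'' x _ (hN x hx).hasDerivAt).const_mul _).add ((ht' x).const_mul _)
  · intro x ξ _
    exact (ht (x + ξ)).sub (ht x)
  · intro n x _ u
    rw [genA_of_hasDerivAt (hd _) (hd' _)]
    have hcA := costA_nonneg hr hl x u
    have h1 : |1 / 2 * a * f'' n x| ≤ 1 / 2 * a * C₂ := by
      rw [abs_mul, abs_of_pos (by positivity)]
      exact mul_le_mul_of_nonneg_left (hb2 n x) (by positivity)
    have h2 : |u * f' n x| ≤ C₁ * ((1 + 1 / l) * (1 + costA r l x u)) := by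
      rw [abs_mul, mul_comm]
      exact mul_le_mul (hb1 n x) (abs_le_one_add_costA hr hl x u) (abs_nonneg _) hC₁
    have h3 : 1 / 2 * a * C₂ ≤ 1 / 2 * a * C₂ * (1 + costA r l x u) :=
      le_mul_of_one_le_right (by positivity) (by linarith)
    have h4 : 0 ≤ θB * (1 + costA r l x u) := by positivity
    have h5 := abs_add_le (1 / 2 * a * f'' n x) (u * f' n x)
    rw [hθA]
    nlinarith
  · intro n x ξ _
    have h4 : 0 ≤ θA * costB k h ξ := mul_nonneg hA0 (costB_pos hk hh ξ).le
    suffices |genB (f n) x ξ| ≤ θB * costB k h ξ by linarith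
    rcases hh.eq_or_lt with h0 | h0
    · have h1 := abs_sub (f n (x + ξ)) (f n x)
      have h2 := hM h0.symm n
      have h3 : θB * costB k h ξ = 2 * M := by
        rw [hθB, costB, ← h0]; field_simp; ring
      rw [h3, genB]
      linarith [h2 (x + ξ), h2 x]
    · have h1 := convex_univ.norm_image_sub_le_of_norm_hasDerivWithin_le (x := x) (y := x + ξ)
        (fun y _ => (hd n y).hasDerivWithinAt) (fun y _ => hb1 n y) (mem_univ _) (mem_univ _)
      rw [add_sub_cancel_left, Real.norm_eq_abs, Real.norm_eq_abs] at h1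
      have h2 : θB * costB k h ξ = C₁ * |ξ| + (C₁ / h * k + 2 * M / k * (k + h * |ξ|)) := by
        rw [hθB, costB]; field_simp; ring
      have h3 : 0 ≤ C₁ / h * k + 2 * M / k * (k + h * |ξ|) := by positivity
      rw [h2, genB]
      linarith

/-! ### The value function -/

namespace IsWeberFreeBoundary

variable {a r l k h ι b U : ℝ} (ha : 0 < a) (hr : 0 < r) (hl : 0 < l) (hk : 0 < k)
  (F : IsWeberFreeBoundary √(r / (a ^ 2 * l)) (h / (2 * a * l)) (k / (2 * a * l)) ι b U)

-- Clamping is 1-Lipschitz into a compact interval on which `s` and `s'` are bounded, so `w'` is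
-- bounded and Lipschitz. When `h = 0`, `w` is constant beyond each of `±U`, hence bounded.
include ha hr hl hk F in
theorem isApproximable_wFun : IsApproximable a r l k h {-U, U} (wFun a r l h ι U) := by
  set c := √(r / (a ^ 2 * l)) with hc
  have hU := F.U_pos
  have hκ : 0 < 2 * a * l := by positivity
  have hcomp : IsCompact (Icc (-U) U) := isCompact_Icc
  obtain ⟨S, hS⟩ := hcomp.exists_bound_of_continuousOn F.continuous_s.continuousOn
  obtain ⟨D, hD⟩ := hcomp.exists_bound_of_continuousOn
    (continuous_weberD F.c_pos.le F.mem_param).continuousOn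
  have hmem : ∀ x, clampTo U x ∈ Icc (-U) U := fun x => abs_le.1 (clampTo_mem hU.le x)
  have hD0 : 0 ≤ D := (norm_nonneg _).trans (hD _ (hmem 0))
  refine isApproximable_of_lipschitz_deriv ha hr hl hk (nonneg_h ha hl F)
    (hasDerivAt_wFun ha hr hl F) (C := 2 * a * l * S) (L := 2 * a * l * D) ?_ ?_ ?_ ?_
  · intro x
    rw [abs_mul, abs_of_pos hκ]
    exact mul_le_mul_of_nonneg_left (hS _ (hmem x)) hκ.le
  · intro x y
    rw [← mul_sub, abs_mul, abs_of_pos hκ, mul_assoc (2 * a * l)]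
    refine mul_le_mul_of_nonneg_left ?_ hκ.le
    have h1 := (convex_Icc (-U) U).norm_image_sub_le_of_norm_hasDerivWithin_le
      (fun z _ => (hasDerivAt_weberS F.c_pos.le F.mem_param z).hasDerivWithinAt) hD
      (hmem y) (hmem x)
    refine h1.trans (mul_le_mul_of_nonneg_left ?_ hD0)
    have h2 := (lipschitzWith_clampTo U).dist_le_mul x y
    simpa [Real.dist_eq] using h2
  · intro x hx
    have h1 := (contDiffAt_deriv_wFun ha hr hl F hx).differentiableAt (by norm_num)
    rwa [deriv_wFun ha hr hl F] at h1
  · intro h0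
    have hwc : Continuous (wFun a r l h ι U) := (contDiff_one_wFun ha hr hl F).continuous
    obtain ⟨M, hM⟩ := hcomp.exists_bound_of_continuousOn hwc.continuousOn
    have hpos : ∀ x, 0 ≤ x → |wFun a r l h ι U x| ≤ M := by
      intro x hx
      rcases le_total x U with h1 | h1
      · exact hM x ⟨by linarith, h1⟩
      · rw [wFun_of_ge F h1, h0, zero_mul, add_zero, ← h0]
        exact hM U ⟨by linarith, le_rfl⟩
    refine ⟨M, fun x => ?_⟩
    rcases le_total 0 x with h1 | h1
    · exact hpos x h1
    · rw [← wFun_neg]; exact hpos (-x) (by linarith)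

end IsWeberFreeBoundary

/-! ### The adjoint equation -/

/-- `v` is a positive even `C²` function whose logarithmic derivative is `u / a` on `[-U, U]`. -/
structure IsDriftPotential (a U : ℝ) (u v v' v'' : ℝ → ℝ) : Prop where
  a_pos : 0 < a
  U_pos : 0 < U
  continuous_drift : Continuous u
  hasDerivAt : ∀ x, HasDerivAt v (v' x) x
  hasDerivAt' : ∀ x, HasDerivAt v' (v'' x) x
  continuous'' : Continuous v''
  pos : ∀ x, 0 < v x
  even : ∀ x, v (-x) = v x
  drift : ∀ x, |x| ≤ U → u x = a * (v' x / v x)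

/-- The scale function with density `1 / v²`. -/
def scaleFun (v : ℝ → ℝ) (x : ℝ) : ℝ := ∫ t in (0 : ℝ)..x, (v t ^ 2)⁻¹

/-- The general solution `v² (α + β E)` of the adjoint equation. -/
def adjBranch (v : ℝ → ℝ) (α β x : ℝ) : ℝ := v x ^ 2 * (α + β * scaleFun v x)

/-- The derivative of `adjBranch`. -/
def adjBranch' (v v' : ℝ → ℝ) (α β x : ℝ) : ℝ := 2 * v x * v' x * (α + β * scaleFun v x) + β

/-- The second derivative of `adjBranch`. -/
def adjBranch'' (v v' v'' : ℝ → ℝ) (α β x : ℝ) : ℝ :=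
  2 * (v' x ^ 2 + v x * v'' x) * (α + β * scaleFun v x) + 2 * β * (v' x / v x)

/-- The profile `v(x)² (E(U) - E(|x| ∨ b))`. -/
def adjProfile (v : ℝ → ℝ) (b U x : ℝ) : ℝ :=
  v x ^ 2 * (scaleFun v U - scaleFun v (max |x| b))

namespace IsDriftPotential

variable {a U : ℝ} {u v v' v'' : ℝ → ℝ} (V : IsDriftPotential a U u v v' v'')
include V

theorem continuous : Continuous v := continuous_iff_continuousAt.2 fun x =>
  (V.hasDerivAt x).continuousAt

theorem continuous' : Continuous v' := continuous_iff_continuousAt.2 fun x =>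
  (V.hasDerivAt' x).continuousAt

theorem continuous_scaleDensity : Continuous fun t => (v t ^ 2)⁻¹ :=
  (V.continuous.pow 2).inv₀ fun x => (pow_pos (V.pos x) 2).ne'

theorem hasDerivAt_scaleFun (x : ℝ) : HasDerivAt (scaleFun v) ((v x ^ 2)⁻¹) x :=
  (V.continuous_scaleDensity.integral_hasStrictDerivAt 0 x).hasDerivAt

theorem continuous_scaleFun : Continuous (scaleFun v) := continuous_iff_continuousAt.2 fun x =>
  (V.hasDerivAt_scaleFun x).continuousAt

theorem strictMono_scaleFun : StrictMono (scaleFun v) := strictMono_of_deriv_pos fun x => by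
  rw [(V.hasDerivAt_scaleFun x).deriv]
  exact inv_pos.2 (pow_pos (V.pos x) 2)

theorem scaleFun_neg (x : ℝ) : scaleFun v (-x) = -scaleFun v x := by
  have h1 := intervalIntegral.integral_comp_neg (a := 0) (b := x) (f := fun t => (v t ^ 2)⁻¹)
  simp only [V.even, neg_zero] at h1
  rw [scaleFun, scaleFun, h1, intervalIntegral.integral_symm]

theorem hasDerivAt_adjBranch (α β x : ℝ) :
    HasDerivAt (adjBranch v α β) (adjBranch' v v' α β x) x := by
  have hv := (V.pos x).ne'
  refine (((V.hasDerivAt x).pow 2).mul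
    (((V.hasDerivAt_scaleFun x).const_mul β).const_add α)).congr_deriv ?_
  simp only [adjBranch', Pi.pow_apply]
  push_cast
  field_simp

theorem hasDerivAt_adjBranch' (α β x : ℝ) :
    HasDerivAt (adjBranch' v v' α β) (adjBranch'' v v' v'' α β x) x := by
  have hv := (V.pos x).ne'
  refine (((((V.hasDerivAt x).const_mul 2).mul (V.hasDerivAt' x)).mul
    (((V.hasDerivAt_scaleFun x).const_mul β).const_add α)).add_const β).congr_deriv ?_
  simp only [adjBranch'', Pi.mul_apply]
  field_simp

theorem continuous_adjBranch'' (α β : ℝ) : Continuous (adjBranch'' v v' v'' α β) := by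
  have h1 := V.continuous
  have h2 := V.continuous'
  have h3 := V.continuous''
  have h4 := V.continuous_scaleFun
  have h5 : Continuous fun x => v' x / v x := h2.div₀ h1 fun x => (V.pos x).ne'
  unfold adjBranch''
  fun_prop

theorem continuous_adjBranch (α β : ℝ) : Continuous (adjBranch v α β) :=
  continuous_iff_continuousAt.2 fun x => (V.hasDerivAt_adjBranch α β x).continuousAt

theorem continuous_adjBranch' (α β : ℝ) : Continuous (adjBranch' v v' α β) :=
  continuous_iff_continuousAt.2 fun x => (V.hasDerivAt_adjBranch' α β x).continuousAt

theorem contDiff_adjBranch (α β : ℝ) : ContDiff ℝ 2 (adjBranch v α β) :=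
  contDiff_two_of_hasDerivAt (V.hasDerivAt_adjBranch α β) (V.hasDerivAt_adjBranch' α β)
    (V.continuous_adjBranch'' α β)

/-- The flux `½ a p' - u p` of a branch is constant. -/
theorem flux_adjBranch {x : ℝ} (hx : |x| ≤ U) (α β : ℝ) :
    1 / 2 * a * adjBranch' v v' α β x - u x * adjBranch v α β x = 1 / 2 * a * β := by
  have hv := (V.pos x).ne'
  rw [V.drift x hx, adjBranch', adjBranch]
  field_simp
  ring

theorem hasDerivAt_drift {x : ℝ} (hx : |x| < U) :
    HasDerivAt u (a * ((v'' x * v x - v' x * v' x) / v x ^ 2)) x := by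
  refine (((V.hasDerivAt' x).div (V.hasDerivAt x) (V.pos x).ne').const_mul a).congr_of_eventuallyEq
    ?_
  filter_upwards [(isOpen_lt continuous_abs continuous_const).mem_nhds hx] with y hy
  exact V.drift y (le_of_lt hy)

theorem ode_adjBranch {x : ℝ} (hx : |x| < U) (α β : ℝ) :
    1 / 2 * a * adjBranch'' v v' v'' α β x - deriv (fun y => u y * adjBranch v α β y) x = 0 := by
  have hv := (V.pos x).ne'
  have hd : HasDerivAt (fun y => u y * adjBranch v α β y) _ x :=
    (V.hasDerivAt_drift hx).mul (V.hasDerivAt_adjBranch α β x)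
  rw [hd.deriv, V.drift x hx.le,
    adjBranch'', adjBranch', adjBranch]
  field_simp
  ring

/-- Integration by parts against a branch. -/
theorem integral_genA_mul_adjBranch {f : ℝ → ℝ} (hf : ContDiff ℝ 2 f) (α β : ℝ) {x₁ x₂ : ℝ}
    (h₁ : -U ≤ x₁) (h12 : x₁ ≤ x₂) (h₂ : x₂ ≤ U) :
    ∫ x in x₁..x₂, genA a f x (u x) * adjBranch v α β x
      = (1 / 2 * a * deriv f x₂ * adjBranch v α β x₂ - 1 / 2 * a * β * f x₂)
        - (1 / 2 * a * deriv f x₁ * adjBranch v α β x₁ - 1 / 2 * a * β * f x₁) := by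
  have hf1 : ContDiff ℝ 1 (deriv f) := ((contDiff_succ_iff_deriv (n := 1)).1 hf).2.2
  have hf2 : Continuous (deriv (deriv f)) := hf1.continuous_deriv le_rfl
  have hcu := V.continuous_drift
  refine intervalIntegral.integral_eq_sub_of_hasDerivAt
    (f := fun x => 1 / 2 * a * deriv f x * adjBranch v α β x - 1 / 2 * a * β * f x) ?_ ?_
  · intro x hx
    rw [uIcc_of_le h12] at hx
    have hxU : |x| ≤ U := abs_le.2 ⟨h₁.trans hx.1, hx.2.trans h₂⟩
    have d1 : HasDerivAt f (deriv f x) x := (hf.differentiable (by norm_num) x).hasDerivAt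
    have d2 : HasDerivAt (deriv f) (deriv (deriv f) x) x :=
      (hf1.differentiable (by norm_num) x).hasDerivAt
    refine (((d2.const_mul (1 / 2 * a)).mul (V.hasDerivAt_adjBranch α β x)).sub
      (d1.const_mul (1 / 2 * a * β))).congr_deriv ?_
    rw [← V.flux_adjBranch hxU α β, genA]
    ring
  · have h1 := V.continuous_adjBranch α β
    have h2 := hf1.continuous
    apply Continuous.intervalIntegrable
    unfold genA
    fun_prop

/-! #### The profile -/

section Profile
variable {b : ℝ} (hb : 0 ≤ b) (hbU : b < U)

-- On the three intervals cut by `±b`, the profile times `N` is a branch with `β = N`, `0`, `-N`.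
-- Probability thus flows from `b` out to `U`, and symmetrically on the left, at rate `½ a N`, with
-- no flux in the middle; the jumps bring it back.
omit V in
theorem adjProfile_right {x : ℝ} (hb : 0 ≤ b) (hx : b ≤ x) (N : ℝ) :
    N * adjProfile v b U x = adjBranch v (N * scaleFun v U) (-N) x := by
  rw [adjProfile, adjBranch, abs_of_nonneg (hb.trans hx), max_eq_left hx]; ring

omit V in
theorem adjProfile_mid {x : ℝ} (hx : |x| ≤ b) (N : ℝ) :
    N * adjProfile v b U x = adjBranch v (N * (scaleFun v U - scaleFun v b)) 0 x := by
  rw [adjProfile, adjBranch, max_eq_right hx]; ring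

theorem adjProfile_left {x : ℝ} (hb : 0 ≤ b) (hx : x ≤ -b) (N : ℝ) :
    N * adjProfile v b U x = adjBranch v (N * scaleFun v U) N x := by
  rw [adjProfile, adjBranch, abs_of_nonpos (by linarith), max_eq_left (by linarith),
    V.scaleFun_neg]
  ring

theorem continuous_adjProfile (b U : ℝ) : Continuous (adjProfile v b U) := by
  have h1 := V.continuous
  have h2 := V.continuous_scaleFun
  unfold adjProfile
  fun_prop

include hbU in
theorem adjProfile_nonneg {x : ℝ} (hx : |x| ≤ U) : 0 ≤ adjProfile v b U x :=
  mul_nonneg (sq_nonneg _) (sub_nonneg.2 (V.strictMono_scaleFun.monotone (max_le hx hbU.le)))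

include hbU in
theorem adjProfile_pos {x : ℝ} (hx : |x| < U) : 0 < adjProfile v b U x :=
  mul_pos (pow_pos (V.pos x) 2) (sub_pos.2 (V.strictMono_scaleFun (max_lt hx hbU)))

include hbU in
theorem integral_adjProfile_pos : 0 < ∫ x in (-U)..U, adjProfile v b U x :=
  intervalIntegral.intervalIntegral_pos_of_pos_on
    ((V.continuous_adjProfile b U).intervalIntegrable _ _)
    (fun _ hx => V.adjProfile_pos hbU (abs_lt.2 hx)) (by linarith [V.U_pos])

/-- The normalised profile. -/
def density (_ : IsDriftPotential a U u v v' v'') (b : ℝ) (x : ℝ) : ℝ :=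
  (∫ x in (-U)..U, adjProfile v b U x)⁻¹ * adjProfile v b U x

theorem continuous_density : Continuous (V.density b) :=
  continuous_const.mul (V.continuous_adjProfile b U)

include hbU in
theorem density_nonneg {x : ℝ} (hx : |x| ≤ U) : 0 ≤ V.density b x :=
  mul_nonneg (inv_nonneg.2 (V.integral_adjProfile_pos hbU).le) (V.adjProfile_nonneg hbU hx)

include hbU in
theorem integral_density : ∫ x in (-U)..U, V.density b x = 1 := by
  simp only [density]
  rw [intervalIntegral.integral_const_mul,
    inv_mul_cancel₀ (V.integral_adjProfile_pos hbU).ne']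

/-- The common weight of the two boundary points. -/
def weight (_ : IsDriftPotential a U u v v' v'') (b : ℝ) : ℝ :=
  1 / 2 * a * (∫ x in (-U)..U, adjProfile v b U x)⁻¹

include hbU in
theorem weight_pos : 0 < V.weight b := by
  have h1 := inv_pos.2 (V.integral_adjProfile_pos hbU)
  have h2 := V.a_pos
  unfold weight
  positivity

include hb hbU in
/-- The weak form of the adjoint equation. -/
theorem integral_genA_mul_density {f : ℝ → ℝ} (hf : ContDiff ℝ 2 f) :
    (∫ x in (-U)..U, genA a f x (u x) * V.density b x)
      + V.weight b * genB f (-U) (U - b) + V.weight b * genB f U (-(U - b)) = 0 := by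
  set N := (∫ x in (-U)..U, adjProfile v b U x)⁻¹ with hN
  have hf1 : ContDiff ℝ 1 (deriv f) := ((contDiff_succ_iff_deriv (n := 1)).1 hf).2.2
  have hf2 : Continuous (deriv (deriv f)) := hf1.continuous_deriv le_rfl
  have hcont : Continuous fun x => genA a f x (u x) * V.density b x := by
    have h1 := V.continuous_density (b := b)
    have h2 := hf1.continuous
    have h3 := V.continuous_drift
    unfold genA
    fun_prop
  have hi := fun p q : ℝ => hcont.intervalIntegrable (μ := volume) p q
  have hU := V.U_pos
  have e1 : ∫ x in (-U)..(-b), genA a f x (u x) * V.density b x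
      = ∫ x in (-U)..(-b), genA a f x (u x) * adjBranch v (N * scaleFun v U) N x := by
    refine intervalIntegral.integral_congr fun x hx => ?_
    rw [uIcc_of_le (by linarith)] at hx
    simp only [density, V.adjProfile_left hb hx.2, hN]
  have e2 : ∫ x in (-b)..b, genA a f x (u x) * V.density b x
      = ∫ x in (-b)..b, genA a f x (u x)
        * adjBranch v (N * (scaleFun v U - scaleFun v b)) 0 x := by
    refine intervalIntegral.integral_congr fun x hx => ?_
    rw [uIcc_of_le (by linarith)] at hx
    simp only [density, adjProfile_mid (abs_le.2 hx), hN]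
  have e3 : ∫ x in b..U, genA a f x (u x) * V.density b x
      = ∫ x in b..U, genA a f x (u x) * adjBranch v (N * scaleFun v U) (-N) x := by
    refine intervalIntegral.integral_congr fun x hx => ?_
    rw [uIcc_of_le (by linarith)] at hx
    simp only [density, adjProfile_right hb hx.1, hN]
  -- In the boundary terms, those with `f'` cancel at `±b` by continuity of the profile and vanish
  -- at `±U` with it. Those with `f` combine into the two jump terms.
  rw [← intervalIntegral.integral_add_adjacent_intervals (hi (-U) b) (hi b U),
    ← intervalIntegral.integral_add_adjacent_intervals (hi (-U) (-b)) (hi (-b) b), e1, e2, e3,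
    V.integral_genA_mul_adjBranch hf _ _ le_rfl (by linarith) (by linarith),
    V.integral_genA_mul_adjBranch hf _ _ (by linarith) (by linarith) (by linarith),
    V.integral_genA_mul_adjBranch hf _ _ (by linarith) (by linarith) le_rfl]
  simp only [adjBranch, weight, genB, V.scaleFun_neg, ← hN]
  rw [show -U + (U - b) = -b by ring, show U + -(U - b) = b by ring]
  ring

end Profile

/-! #### Existence and uniqueness for the adjoint problem -/

section Adjoint
variable {b : ℝ} (hb : 0 ≤ b) (hbU : b < U)

include hb hbU in
theorem isAdjointSolution_density :
    IsAdjointSolution a U (U - b) u (V.density b) (V.weight b) (V.weight b) := by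
  have hU := V.U_pos
  set N := (∫ x in (-U)..U, adjProfile v b U x)⁻¹ with hN
  have hloc : ∀ x ∈ Ioo (-U) U \ {-b, b}, ∃ α β, V.density b =ᶠ[𝓝 x] adjBranch v α β := by
    intro x hx
    have hx1 : x ≠ -b := fun h => hx.2 (by simp [h])
    have hx2 : x ≠ b := fun h => hx.2 (by simp [h])
    rcases lt_or_gt_of_ne hx1 with h1 | h1
    · exact ⟨_, _, by filter_upwards [gt_mem_nhds h1] with y hy using
        V.adjProfile_left hb (le_of_lt hy) _⟩
    rcases lt_or_gt_of_ne hx2 with h2 | h2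
    · exact ⟨_, _, by filter_upwards [Ioo_mem_nhds h1 h2] with y hy using
        adjProfile_mid (abs_le.2 ⟨hy.1.le, hy.2.le⟩) _⟩
    · exact ⟨_, _, by filter_upwards [lt_mem_nhds h2] with y hy using
        adjProfile_right hb (le_of_lt hy) _⟩
  have hR : ∀ x, b < x → deriv (V.density b) x = adjBranch' v v' (N * scaleFun v U) (-N) x := by
    intro x hx
    have hev : V.density b =ᶠ[𝓝 x] adjBranch v (N * scaleFun v U) (-N) := by
      filter_upwards [lt_mem_nhds hx] with y hy using adjProfile_right hb (le_of_lt hy) _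
    rw [hev.deriv_eq, (V.hasDerivAt_adjBranch _ _ x).deriv]
  have hLft : ∀ x, x < -b → deriv (V.density b) x = adjBranch' v v' (N * scaleFun v U) N x := by
    intro x hx
    have hev : V.density b =ᶠ[𝓝 x] adjBranch v (N * scaleFun v U) N := by
      filter_upwards [gt_mem_nhds hx] with y hy using V.adjProfile_left hb (le_of_lt hy) _
    rw [hev.deriv_eq, (V.hasDerivAt_adjBranch _ _ x).deriv]
  have hM : ∀ x ∈ Ioo (-b) b, deriv (V.density b) x
      = adjBranch' v v' (N * (scaleFun v U - scaleFun v b)) 0 x := by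
    intro x hx
    have hev : V.density b =ᶠ[𝓝 x] adjBranch v (N * (scaleFun v U - scaleFun v b)) 0 := by
      filter_upwards [Ioo_mem_nhds hx.1 hx.2] with y hy using
        adjProfile_mid (abs_le.2 ⟨hy.1.le, hy.2.le⟩) _
    rw [hev.deriv_eq, (V.hasDerivAt_adjBranch _ _ x).deriv]
  have hlim : ∀ {α β x : ℝ} {l : Filter ℝ}, l ≤ 𝓝 x →
      (∀ᶠ y in l, deriv (V.density b) y = adjBranch' v v' α β y) →
      Tendsto (deriv (V.density b)) l (𝓝 (adjBranch' v v' α β x)) := by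
    intro α β x l hl hev
    exact (((V.continuous_adjBranch' α β).tendsto x).mono_left hl).congr'
      (hev.mono fun y hy => hy.symm)
  have e1 : -U + (U - b) = -b := by ring
  have e2 : U - (U - b) = b := by ring
  refine ⟨V.continuous_density.continuousOn, ?_, ?_, ?_, ?_, V.integral_density hbU⟩
  · rw [e1, e2]
    intro x hx
    obtain ⟨α, β, hev⟩ := hloc x hx
    exact ((V.contDiff_adjBranch α β).contDiffAt.congr_of_eventuallyEq hev).contDiffWithinAt
  · rw [e1, e2]
    intro x hx
    obtain ⟨α, β, hev⟩ := hloc x hx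
    have h1 : (fun y => u y * V.density b y) =ᶠ[𝓝 x] fun y => u y * adjBranch v α β y :=
      hev.mono fun y hy => by simp only [hy]
    rw [hev.deriv.deriv_eq, funext fun x => (V.hasDerivAt_adjBranch α β x).deriv,
      (V.hasDerivAt_adjBranch' α β x).deriv, h1.deriv_eq]
    exact V.ode_adjBranch (abs_lt.2 hx.1) α β
  · constructor
    · rw [density, V.adjProfile_left hb (by linarith), adjBranch, V.scaleFun_neg]; ring
    · rw [density, adjProfile_right hb hbU.le, adjBranch]; ring
  · rw [e1, e2]
    have hdl : Tendsto (deriv (V.density b)) (𝓝[>] (-U)) (𝓝 N) := by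
      have := hlim (x := -U) (l := 𝓝[>] (-U)) nhdsWithin_le_nhds
        (by filter_upwards [Ioo_mem_nhdsGT (show -U < -b by linarith)] with y hy
            using hLft y hy.2)
      convert this using 2
      rw [adjBranch', V.scaleFun_neg]; ring
    have hdr : Tendsto (deriv (V.density b)) (𝓝[<] U) (𝓝 (-N)) := by
      have := hlim (x := U) (l := 𝓝[<] U) nhdsWithin_le_nhds
        (by filter_upwards [Ioo_mem_nhdsLT hbU] with y hy using hR y hy.1)
      convert this using 2
      rw [adjBranch']; ring
    have hel := hlim (x := -b) (l := 𝓝[<] (-b)) nhdsWithin_le_nhds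
      (by filter_upwards [self_mem_nhdsWithin] with y hy using hLft y hy)
    have her' := hlim (x := b) (l := 𝓝[>] b) nhdsWithin_le_nhds
      (by filter_upwards [self_mem_nhdsWithin] with y hy using hR y hy)
    rcases hb.eq_or_lt with h0 | h0
    · subst h0
      simp only [neg_zero] at hel hlim ⊢
      -- For `b = 0` both landing points are the origin, so its left and right limits serve for both
      -- pairs.
      refine ⟨N, -N, _, _, _, _, hdl, hdr, hel, her', hel, her', fun h => by linarith, ?_, ?_, ?_⟩
      · intro _; simp only [adjBranch', scaleFun, intervalIntegral.integral_same]; ring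
      · rw [weight]
      · rw [weight]; ring
    · have hel' := hlim (x := -b) (l := 𝓝[>] (-b)) nhdsWithin_le_nhds
        (by filter_upwards [Ioo_mem_nhdsGT (show -b < b by linarith)] with y hy using hM y hy)
      have her := hlim (x := b) (l := 𝓝[<] b) nhdsWithin_le_nhds
        (by filter_upwards [Ioo_mem_nhdsLT (show -b < b by linarith)] with y hy using hM y hy)
      refine ⟨N, -N, _, _, _, _, hdl, hdr, hel, hel', her, her', fun _ => ⟨?_, ?_⟩,
        fun h => by linarith, ?_, ?_⟩
      · simp only [adjBranch', V.scaleFun_neg]; ring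
      · simp only [adjBranch']; ring
      · rw [weight]
      · rw [weight]; ring

/-- A solution of the adjoint equation on an interval is a branch. -/
theorem exists_eqOn_adjBranch {q : ℝ → ℝ} {x₁ x₂ : ℝ} (h12 : x₁ < x₂) (h₁ : -U ≤ x₁) (h₂ : x₂ ≤ U)
    (hqc : ContinuousOn q (Icc (-U) U)) (hq : ContDiffOn ℝ 2 q (Ioo x₁ x₂))
    (hode : ∀ x ∈ Ioo x₁ x₂, 1 / 2 * a * deriv (deriv q) x - deriv (fun y => u y * q y) x = 0) :
    ∃ α β, EqOn q (adjBranch v α β) (Icc x₁ x₂) ∧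
      EqOn (deriv q) (adjBranch' v v' α β) (Ioo x₁ x₂) := by
  have ha := V.a_pos
  have hxU : ∀ x ∈ Ioo x₁ x₂, |x| < U := fun x hx =>
    abs_lt.2 ⟨h₁.trans_lt hx.1, hx.2.trans_le h₂⟩
  have hq1 : ∀ x ∈ Ioo x₁ x₂, HasDerivAt q (deriv q x) x := fun x hx =>
    ((hq.contDiffAt (isOpen_Ioo.mem_nhds hx)).differentiableAt (by norm_num)).hasDerivAt
  have hq2 : ∀ x ∈ Ioo x₁ x₂, HasDerivAt (deriv q) (deriv (deriv q) x) x := fun x hx => by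
    have h1 : ContDiffOn ℝ 1 (deriv q) (Ioo x₁ x₂) :=
      ((contDiffOn_succ_iff_deriv_of_isOpen (n := 1) isOpen_Ioo).1 hq).2.2
    exact ((h1.contDiffAt (isOpen_Ioo.mem_nhds hx)).differentiableAt (by norm_num)).hasDerivAt
  set J : ℝ → ℝ := fun x => 1 / 2 * a * deriv q x - u x * q x with hJ
  have hJd : ∀ x ∈ Ioo x₁ x₂, HasDerivAt J 0 x := fun x hx => by
    have h1 := (V.hasDerivAt_drift (hxU x hx)).mul (hq1 x hx)
    refine (((hq2 x hx).const_mul (1 / 2 * a)).sub h1).congr_deriv ?_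
    rw [← h1.deriv]
    exact hode x hx
  have hmid : (x₁ + x₂) / 2 ∈ Ioo x₁ x₂ := ⟨by linarith, by linarith⟩
  have hJc : ∀ x ∈ Ioo x₁ x₂, J x = J ((x₁ + x₂) / 2) := fun x hx =>
    isOpen_Ioo.is_const_of_deriv_eq_zero isPreconnected_Ioo
      (fun y hy => (hJd y hy).differentiableAt.differentiableWithinAt)
      (fun y hy => (hJd y hy).deriv) hx hmid
  set β : ℝ := 2 / a * J ((x₁ + x₂) / 2) with hβ
  set Y : ℝ → ℝ := fun x => q x / v x ^ 2 - β * scaleFun v x with hY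
  have hYd : ∀ x ∈ Ioo x₁ x₂, HasDerivAt Y 0 x := fun x hx => by
    have hv := (V.pos x).ne'
    refine (((hq1 x hx).div ((V.hasDerivAt x).pow 2) (pow_ne_zero 2 hv)).sub
      ((V.hasDerivAt_scaleFun x).const_mul β)).congr_deriv ?_
    rw [hβ, ← hJc x hx, hJ]
    simp only [Pi.pow_apply]
    rw [V.drift x (hxU x hx).le]
    push_cast
    field_simp
    ring
  have hYc : ∀ x ∈ Ioo x₁ x₂, Y x = Y ((x₁ + x₂) / 2) := fun x hx =>
    isOpen_Ioo.is_const_of_deriv_eq_zero isPreconnected_Ioo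
      (fun y hy => (hYd y hy).differentiableAt.differentiableWithinAt)
      (fun y hy => (hYd y hy).deriv) hx hmid
  have heq : EqOn q (adjBranch v (Y ((x₁ + x₂) / 2)) β) (Ioo x₁ x₂) := fun x hx => by
    have hv := (V.pos x).ne'
    rw [adjBranch, ← hYc x hx, hY]
    field_simp
    ring
  refine ⟨Y ((x₁ + x₂) / 2), β, ?_, fun x hx => ?_⟩
  · refine heq.of_subset_closure (hqc.mono (Icc_subset_Icc h₁ h₂))
      (V.continuous_adjBranch _ _).continuousOn Ioo_subset_Icc_self ?_
    rw [closure_Ioo h12.ne]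
  · rw [(heq.eventuallyEq_of_mem (isOpen_Ioo.mem_nhds hx)).deriv_eq]
    exact (V.hasDerivAt_adjBranch _ _ x).deriv

-- Vanishing at `±U` leaves one constant on each outer interval. The jump condition at `-b` removes
-- the scale function from the middle branch, and continuity at `±b` makes the outer constants
-- opposite; for `b = 0` continuity at the origin suffices. Hence `q` is a multiple of the profile,
-- and the mass fixes the multiple.
include hb hbU in
theorem eq_density_of_isAdjointSolution {q : ℝ → ℝ} {σm σp : ℝ}
    (hq : IsAdjointSolution a U (U - b) u q σm σp) :
    EqOn q (V.density b) (Icc (-U) U) ∧ σm = V.weight b ∧ σp = V.weight b := by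
  have hU := V.U_pos
  obtain ⟨hqc, hqd, hode, hbd, hjump, hmass⟩ := hq
  rw [show -U + (U - b) = -b by ring, show U - (U - b) = b by ring] at hqd hode hjump
  obtain ⟨dl, dr, el, el', er, er', hdl, hdr, hel, hel', -, -, hj1, -, hσm, hσp⟩ := hjump
  have hsub1 : Ioo (-U) (-b) ⊆ Ioo (-U) U \ {-b, b} := fun x hx =>
    ⟨⟨hx.1, by linarith [hx.2]⟩, by
      simp only [mem_insert_iff, mem_singleton_iff, not_or]
      exact ⟨hx.2.ne, (by linarith [hx.2] : x < b).ne⟩⟩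
  have hsub2 : Ioo (-b) b ⊆ Ioo (-U) U \ {-b, b} := fun x hx =>
    ⟨⟨by linarith [hx.1], by linarith [hx.2]⟩, by
      simp only [mem_insert_iff, mem_singleton_iff, not_or]
      exact ⟨hx.1.ne', hx.2.ne⟩⟩
  have hsub3 : Ioo b U ⊆ Ioo (-U) U \ {-b, b} := fun x hx =>
    ⟨⟨by linarith [hx.1], hx.2⟩, by
      simp only [mem_insert_iff, mem_singleton_iff, not_or]
      exact ⟨(by linarith [hx.1] : -b < x).ne', hx.1.ne'⟩⟩
  obtain ⟨α₁, β₁, hq1, hq1'⟩ := V.exists_eqOn_adjBranch (q := q) (show -U < -b by linarith) le_rfl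
    (by linarith) hqc (hqd.mono hsub1) fun x hx => hode x (hsub1 hx)
  obtain ⟨α₃, β₃, hq3, hq3'⟩ := V.exists_eqOn_adjBranch (q := q) hbU (by linarith) le_rfl hqc
    (hqd.mono hsub3) fun x hx => hode x (hsub3 hx)
  have hv : ∀ x, v x ^ 2 ≠ 0 := fun x => (pow_pos (V.pos x) 2).ne'
  have hα₁ : α₁ = β₁ * scaleFun v U := by
    have h1 := hq1 (left_mem_Icc.2 (by linarith))
    rw [hbd.1, adjBranch, V.scaleFun_neg, eq_comm, mul_eq_zero] at h1
    linarith [h1.resolve_left (hv _)]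
  have hα₃ : α₃ = -β₃ * scaleFun v U := by
    have h1 := hq3 (right_mem_Icc.2 hbU.le)
    rw [hbd.2, adjBranch, eq_comm, mul_eq_zero] at h1
    linarith [h1.resolve_left (hv _)]
  have hlim : ∀ {α β x d : ℝ} {l : Filter ℝ} [l.NeBot], l ≤ 𝓝 x → Tendsto (deriv q) l (𝓝 d) →
      (∀ᶠ y in l, deriv q y = adjBranch' v v' α β y) → d = adjBranch' v v' α β x := by
    intro α β x d l _ hl hd hev
    exact tendsto_nhds_unique hd ((((V.continuous_adjBranch' α β).tendsto x).mono_left hl).congr'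
      (hev.mono fun y hy => hy.symm))
  have hdl' : dl = β₁ := by
    rw [hlim nhdsWithin_le_nhds hdl (by
      filter_upwards [Ioo_mem_nhdsGT (show -U < -b by linarith)] with y hy using hq1' hy),
      adjBranch', V.scaleFun_neg, hα₁]
    ring
  have hdr' : dr = β₃ := by
    rw [hlim nhdsWithin_le_nhds hdr (by
      filter_upwards [Ioo_mem_nhdsLT hbU] with y hy using hq3' hy), adjBranch', hα₃]
    ring
  have hE : scaleFun v b < scaleFun v U := V.strictMono_scaleFun hbU
  have hq1b : q (-b) = v b ^ 2 * (β₁ * (scaleFun v U - scaleFun v b)) := by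
    rw [hq1 (right_mem_Icc.2 (by linarith)), adjBranch, V.scaleFun_neg, V.even, hα₁]; ring
  have hq3b : q b = v b ^ 2 * (-β₃ * (scaleFun v U - scaleFun v b)) := by
    rw [hq3 (left_mem_Icc.2 hbU.le), adjBranch, hα₃]; ring
  have hmid : ∀ x ∈ Icc (-b) b, q x = v x ^ 2 * (β₁ * (scaleFun v U - scaleFun v b)) := by
    rcases hb.eq_or_lt with h0 | h0
    · intro x hx
      have : x = -b := by linarith [hx.1, hx.2]
      rw [this, hq1b, V.even]
    · obtain ⟨α₂, β₂, hq2, hq2'⟩ := V.exists_eqOn_adjBranch (q := q) (show -b < b by linarith)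
        (by linarith) hbU.le hqc (hqd.mono hsub2) fun x hx => hode x (hsub2 hx)
      have h1 := hlim nhdsWithin_le_nhds hel (by
        filter_upwards [Ioo_mem_nhdsLT (show -U < -b by linarith)] with y hy using hq1' hy)
      have h2 := hlim nhdsWithin_le_nhds hel' (by
        filter_upwards [Ioo_mem_nhdsGT (show -b < b by linarith)] with y hy using hq2' hy)
      have h3 : α₁ + β₁ * scaleFun v (-b) = α₂ + β₂ * scaleFun v (-b) := by
        have h4 := hq1 (right_mem_Icc.2 (by linarith))
        rw [hq2 (left_mem_Icc.2 (by linarith)), adjBranch, adjBranch] at h4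
        exact (mul_left_cancel₀ (hv _) h4).symm
      have h5 := (hj1 (by linarith)).1
      have hβ₂ : β₂ = 0 := by
        rw [h1, h2, hdl', adjBranch', adjBranch', h3] at h5
        have h6 : a * β₂ = 0 := by linarith
        exact (mul_eq_zero.1 h6).resolve_left V.a_pos.ne'
      intro x hx
      rw [hq2 hx, adjBranch]
      rw [hβ₂, V.scaleFun_neg, hα₁] at h3
      rw [hβ₂]
      congr 1
      linarith
  have hβ₃ : β₃ = -β₁ := by
    have h1 := hmid b (right_mem_Icc.2 (by linarith))
    rw [hq3b] at h1
    have h2 := mul_right_cancel₀ (sub_pos.2 hE).ne' (mul_left_cancel₀ (hv b) h1)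
    linarith
  have hprof : ∀ x ∈ Icc (-U) U, q x = β₁ * adjProfile v b U x := by
    intro x hx
    rcases le_total x (-b) with h1 | h1
    · rw [V.adjProfile_left hb h1, hq1 ⟨hx.1, h1⟩, hα₁]
    rcases le_total x b with h2 | h2
    · rw [adjProfile_mid (abs_le.2 ⟨h1, h2⟩), hmid x ⟨h1, h2⟩, adjBranch]; ring
    · rw [adjProfile_right hb h2, hq3 ⟨h2, hx.2⟩, hα₃, hβ₃, neg_neg]
  have hβ₁ : β₁ = (∫ x in (-U)..U, adjProfile v b U x)⁻¹ := by
    rw [intervalIntegral.integral_congr (g := fun x => β₁ * adjProfile v b U x),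
      intervalIntegral.integral_const_mul] at hmass
    · exact eq_inv_of_mul_eq_one_left hmass
    · intro x hx
      rw [uIcc_of_le (by linarith)] at hx
      exact hprof x hx
  refine ⟨fun x hx => by rw [hprof x hx, hβ₁, density], ?_, ?_⟩
  · rw [hσm, hdl', hβ₁, weight]
  · rw [hσp, hdr', hβ₃, hβ₁, weight]; ring

end Adjoint

end IsDriftPotential

/-! ### Integration against the stationary pair -/

section DensMeasure
variable {U : ℝ} {p : ℝ → ℝ}

theorem integral_densMeasure (hU : 0 < U) (hp : Continuous p) (hp0 : ∀ x, |x| ≤ U → 0 ≤ p x)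
    (g : ℝ → ℝ) : ∫ x, g x ∂(densMeasure U p) = ∫ x in (-U)..U, g x * p x := by
  rw [densMeasure, integral_withDensity_eq_integral_toReal_smul hp.measurable.ennreal_ofReal
    (Eventually.of_forall fun _ => ENNReal.ofReal_lt_top), integral_Icc_eq_integral_Ioc,
    intervalIntegral.integral_of_le (by linarith)]
  refine setIntegral_congr_fun measurableSet_Ioc fun x hx => ?_
  simp only [smul_eq_mul]
  rw [ENNReal.toReal_ofReal (hp0 x (abs_le.2 ⟨hx.1.le, hx.2⟩)), mul_comm]

theorem isProbabilityMeasure_densMeasure (hU : 0 < U) (hp : Continuous p)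
    (hp0 : ∀ x, |x| ≤ U → 0 ≤ p x) (hp1 : ∫ x in (-U)..U, p x = 1) :
    IsProbabilityMeasure (densMeasure U p) := by
  refine ⟨?_⟩
  have hint : Integrable p (volume.restrict (Icc (-U) U)) :=
    hp.continuousOn.integrableOn_compact isCompact_Icc
  have hnn : 0 ≤ᵐ[volume.restrict (Icc (-U) U)] p := by
    filter_upwards [ae_restrict_mem measurableSet_Icc] with x hx using hp0 x (abs_le.2 hx)
  rw [densMeasure, withDensity_apply _ MeasurableSet.univ, Measure.restrict_univ,
    ← ofReal_integral_eq_lintegral_ofReal hint hnn, integral_Icc_eq_integral_Ioc,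
    ← intervalIntegral.integral_of_le (by linarith), hp1, ENNReal.ofReal_one]

/-- The open interval matters: the dynamic programming equality is available only for `|x| < U`, and
the endpoints are Lebesgue null. -/
theorem ae_densMeasure_mem : ∀ᵐ x ∂(densMeasure U p), x ∈ Ioo (-U) U := by
  have h1 : ∀ᵐ x ∂(volume.restrict (Icc (-U) U)), x ∈ Ioo (-U) U := by
    rw [← restrict_Ioo_eq_restrict_Icc]
    exact ae_restrict_mem measurableSet_Ioo
  exact (withDensity_absolutelyContinuous _ _).ae_le h1

theorem integrable_of_continuous_of_ae_mem {π : Measure ℝ} [IsFiniteMeasure π]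
    (hπ : ∀ᵐ x ∂π, x ∈ Icc (-U) U) {g : ℝ → ℝ} (hg : Continuous g) : Integrable g π := by
  obtain ⟨C, hC⟩ := isCompact_Icc.exists_bound_of_continuousOn (s := Icc (-U) U) hg.continuousOn
  exact Integrable.of_bound hg.aestronglyMeasurable C (hπ.mono hC)

end DensMeasure

section RhoStar
variable {U ξ ρm ρp : ℝ}

instance isFiniteMeasure_rhoStar : IsFiniteMeasure (rhoStar U ξ ρm ρp) := by
  refine ⟨?_⟩
  simp [rhoStar]

theorem integrable_rhoStar (g : ℝ × ℝ → ℝ) : Integrable g (rhoStar U ξ ρm ρp) :=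
  ((integrable_dirac (by simp)).smul_measure ENNReal.ofReal_ne_top).add_measure
    ((integrable_dirac (by simp)).smul_measure ENNReal.ofReal_ne_top)

theorem integral_rhoStar (hm : 0 ≤ ρm) (hp : 0 ≤ ρp) (g : ℝ × ℝ → ℝ) :
    ∫ z, g z ∂(rhoStar U ξ ρm ρp) = ρm * g (-U, ξ) + ρp * g (U, -ξ) := by
  rw [rhoStar, integral_add_measure
    ((integrable_dirac (by simp)).smul_measure ENNReal.ofReal_ne_top)
    ((integrable_dirac (by simp)).smul_measure ENNReal.ofReal_ne_top), integral_smul_measure,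
    integral_smul_measure, integral_dirac, integral_dirac, ENNReal.toReal_ofReal hm,
    ENNReal.toReal_ofReal hp, smul_eq_mul, smul_eq_mul]

theorem ae_rhoStar {q : ℝ × ℝ → Prop} (h1 : q (-U, ξ)) (h2 : q (U, -ξ)) :
    ∀ᵐ z ∂(rhoStar U ξ ρm ρp), q z := by
  rw [rhoStar, ae_add_measure_iff]
  constructor
  · exact Measure.ae_smul_measure (by rw [ae_dirac_eq]; exact h1) _
  · exact Measure.ae_smul_measure (by rw [ae_dirac_eq]; exact h2) _

end RhoStar

theorem continuous_genA {a : ℝ} {f u : ℝ → ℝ} (hf : ContDiff ℝ 2 f) (hu : Continuous u) :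
    Continuous fun x => genA a f x (u x) := by
  have hf1 : ContDiff ℝ 1 (deriv f) := ((contDiff_succ_iff_deriv (n := 1)).1 hf).2.2
  have h1 : Continuous (deriv (deriv f)) := hf1.continuous_deriv le_rfl
  have h2 := hf1.continuous
  unfold genA
  fun_prop

/-! ### Feasibility and finite cost of the stationary pair -/

namespace IsDriftPotential

variable {a U : ℝ} {u v v' v'' : ℝ → ℝ} (V : IsDriftPotential a U u v v' v'') {b : ℝ}
include V

theorem isProbabilityMeasure_density (hbU : b < U) :
    IsProbabilityMeasure (densMeasure U (V.density b)) :=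
  isProbabilityMeasure_densMeasure V.U_pos V.continuous_density
    (fun _ hx => V.density_nonneg hbU hx) (V.integral_density hbU)

theorem isFeasible_star (hb : 0 ≤ b) (hbU : b < U) :
    IsFeasible a (muStar U (V.density b) u) (rhoStar U (U - b) (V.weight b) (V.weight b)) := by
  have hprob := V.isProbabilityMeasure_density hbU
  have hgm : Measurable fun x => (x, u x) := measurable_id.prodMk V.continuous_drift.measurable
  have hw := V.weight_pos hbU
  refine ⟨Measure.isProbabilityMeasure_map hgm.aemeasurable, inferInstance, ?_, ?_⟩
  · have h := ae_rhoStar (U := U) (ξ := U - b) (ρm := V.weight b) (ρp := V.weight b)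
      (q := fun z => z.2 ≠ 0) (by simp only; linarith) (by simp only; linarith)
    rw [ae_iff] at h
    simpa using h
  · intro f hf hfs
    have hf1 : ContDiff ℝ 1 (deriv f) := ((contDiff_succ_iff_deriv (n := 1)).1 hf).2.2
    have h1 : Continuous (deriv (deriv f)) := hf1.continuous_deriv le_rfl
    have h2 := hf1.continuous
    have hAm : AEStronglyMeasurable (fun z : ℝ × ℝ => genA a f z.1 z.2)
        (muStar U (V.density b) u) := by
      apply Continuous.aestronglyMeasurable
      unfold genA
      fun_prop
    refine ⟨?_, integrable_rhoStar _, ?_⟩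
    · rw [muStar, integrable_map_measure hAm hgm.aemeasurable]
      exact integrable_of_continuous_of_ae_mem
        (ae_densMeasure_mem.mono fun x hx => Ioo_subset_Icc_self hx)
        (continuous_genA hf V.continuous_drift)
    · rw [integral_rhoStar hw.le hw.le, muStar, integral_map hgm.aemeasurable hAm,
        integral_densMeasure V.U_pos V.continuous_density fun _ hx => V.density_nonneg hbU hx]
      have := V.integral_genA_mul_density hb hbU hf
      simp only
      linarith

theorem cost_star_lt_top (hbU : b < U) (r l k h : ℝ) :
    cost r l k h (muStar U (V.density b) u) (rhoStar U (U - b) (V.weight b) (V.weight b)) < ⊤ := by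
  have hprob := V.isProbabilityMeasure_density hbU
  have hgm : Measurable fun x => (x, u x) := measurable_id.prodMk V.continuous_drift.measurable
  refine ENNReal.add_lt_top.2 ⟨?_, (integrable_rhoStar _).lintegral_lt_top⟩
  refine Integrable.lintegral_lt_top ?_
  have hu := V.continuous_drift
  rw [muStar, integrable_map_measure (Continuous.aestronglyMeasurable (by unfold costA; fun_prop))
    hgm.aemeasurable]
  refine integrable_of_continuous_of_ae_mem
    (ae_densMeasure_mem.mono fun x hx => Ioo_subset_Icc_self hx) ?_
  simp only [costA, Function.comp_def]
  fun_prop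

theorem ae_muStar {q : ℝ × ℝ → Prop} (hq : MeasurableSet {z | q z})
    (h : ∀ x ∈ Ioo (-U) U, q (x, u x)) : ∀ᵐ z ∂(muStar U (V.density b) u), q z := by
  have hgm : Measurable fun x => (x, u x) := measurable_id.prodMk V.continuous_drift.measurable
  rw [muStar, ae_map_iff hgm.aemeasurable hq]
  exact ae_densMeasure_mem.mono h

/-! ### The Poisson equation -/

/-- For continuous `φ` there is a test function solving `A f = φ - ∫ φ p` on `[-U, U]` that takes
the same values before and after each jump. -/
theorem exists_poisson_solution (hb : 0 ≤ b) (hbU : b < U) {φ : ℝ → ℝ} (hφ : Continuous φ) :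
    ∃ f, ContDiff ℝ 2 f ∧ HasCompactSupport f ∧
      (∀ x, |x| ≤ U → genA a f x (u x) = φ x - ∫ y in (-U)..U, φ y * V.density b y) ∧
      genB f (-U) (U - b) = 0 ∧ genB f U (-(U - b)) = 0 := by
  have hU := V.U_pos
  have ha := V.a_pos
  have hvc := V.continuous
  have hvc' := V.continuous'
  set m := ∫ y in (-U)..U, φ y * V.density b y with hm
  -- With `d = f'` the equation is `½ a d' + a (v' / v) d = φ - m`, and `v²` is an integrating
  -- factor: `(v² d)' = (2 / a) v² (φ - m)`.
  set G : ℝ → ℝ := fun x => ∫ t in (0 : ℝ)..x, 2 / a * v t ^ 2 * (φ t - m) with hG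
  have hGd : ∀ x, HasDerivAt G (2 / a * v x ^ 2 * (φ x - m)) x := fun x =>
    ((show Continuous fun t => 2 / a * v t ^ 2 * (φ t - m) by
      fun_prop).integral_hasStrictDerivAt 0 x).hasDerivAt
  have hGc : Continuous G := continuous_iff_continuousAt.2 fun x => (hGd x).continuousAt
  have hv0 : ∀ x, v x ^ 2 ≠ 0 := fun x => (pow_pos (V.pos x) 2).ne'
  have hE : 0 < scaleFun v (-b) - scaleFun v (-U) :=
    sub_pos.2 (V.strictMono_scaleFun (by linarith))
  have hGv : Continuous fun t => G t / v t ^ 2 := hGc.div₀ (hvc.pow 2) hv0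
  -- The free constant is chosen so that `d` integrates to zero over `[-U, -b]`, which makes the
  -- left jump term vanish.
  set C : ℝ := -(∫ t in (-U)..(-b), G t / v t ^ 2) / (scaleFun v (-b) - scaleFun v (-U)) with hC
  set d : ℝ → ℝ := fun x => (C + G x) / v x ^ 2 with hd
  have hdd : ∀ x, HasDerivAt d (2 / a * (φ x - m) - 2 * (v' x / v x) * d x) x := fun x => by
    refine (((hGd x).const_add C).div ((V.hasDerivAt x).pow 2) (hv0 x)).congr_deriv ?_
    have := (V.pos x).ne'
    simp only [hd, Pi.pow_apply]
    push_cast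
    field_simp
  have hdc : Continuous d := continuous_iff_continuousAt.2 fun x => (hdd x).continuousAt
  set g : ℝ → ℝ := fun x => ∫ t in (0 : ℝ)..x, d t with hg
  have hgd : ∀ x, HasDerivAt g (d x) x := fun x => (hdc.integral_hasStrictDerivAt 0 x).hasDerivAt
  have hgC : ContDiff ℝ 2 g := by
    refine contDiff_two_of_hasDerivAt hgd hdd ?_
    have : Continuous fun x => v' x / v x := hvc'.div₀ hvc fun x => (V.pos x).ne'
    fun_prop
  let χ : ContDiffBump (0 : ℝ) := ⟨U + 1, U + 2, by linarith, by linarith⟩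
  have hχ : ContDiff ℝ 2 (χ : ℝ → ℝ) := χ.contDiff
  have hev : ∀ x, |x| ≤ U → (fun y => χ y * g y) =ᶠ[𝓝 x] g := by
    intro x hx
    filter_upwards [(isOpen_lt continuous_abs continuous_const).mem_nhds
      (show |x| < U + 1 by linarith)] with y hy
    rw [χ.one_of_mem_closedBall, one_mul]
    rw [Metric.mem_closedBall, Real.dist_eq, sub_zero]
    exact le_of_lt hy
  have hgA : ∀ x, |x| ≤ U → genA a (fun y => χ y * g y) x (u x) = φ x - m := by
    intro x hx
    have e1 : genA a (fun y => χ y * g y) x (u x) = genA a g x (u x) := by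
      rw [genA, genA, (hev x hx).deriv.deriv_eq, (hev x hx).deriv_eq]
    rw [e1, genA_of_hasDerivAt hgd hdd, V.drift x hx]
    field_simp
    ring
  have hB1 : genB (fun y => χ y * g y) (-U) (U - b) = 0 := by
    have h1 := (hev (-U) (by rw [abs_neg, abs_of_pos hU])).self_of_nhds
    have h2 := (hev (-b) (by rw [abs_neg, abs_of_nonneg hb]; exact hbU.le)).self_of_nhds
    simp only at h1 h2
    rw [genB, show -U + (U - b) = -b by ring, h1, h2, hg]
    simp only
    rw [intervalIntegral.integral_interval_sub_left (hdc.intervalIntegrable _ _)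
      (hdc.intervalIntegrable _ _)]
    have e1 : ∀ t ∈ uIcc (-U) (-b), d t = C * (v t ^ 2)⁻¹ + G t / v t ^ 2 := fun t _ => by
      rw [hd]; simp only; rw [add_div, div_eq_mul_inv C]
    have e2 : ∫ t in (-U)..(-b), (v t ^ 2)⁻¹ = scaleFun v (-b) - scaleFun v (-U) := by
      rw [scaleFun, scaleFun, intervalIntegral.integral_interval_sub_left
        (V.continuous_scaleDensity.intervalIntegrable _ _)
        (V.continuous_scaleDensity.intervalIntegrable _ _)]
    have i1 : IntervalIntegrable (fun t => C * (v t ^ 2)⁻¹) volume (-U) (-b) :=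
      (continuous_const.mul V.continuous_scaleDensity).intervalIntegrable _ _
    rw [intervalIntegral.integral_congr e1, intervalIntegral.integral_add i1
      (hGv.intervalIntegrable _ _), intervalIntegral.integral_const_mul, e2, hC,
      div_mul_cancel₀ _ hE.ne']
    ring
  have hfC : ContDiff ℝ 2 fun y => χ y * g y := hχ.mul hgC
  refine ⟨fun y => χ y * g y, hfC, χ.hasCompactSupport.mul_right, hgA, hB1, ?_⟩
  -- The right jump term needs no second constant: `A f` has mean zero under the density and the
  -- left jump term is zero, so the weak adjoint identity leaves a positive weight times the right
  -- one.
  have h1 := V.integral_genA_mul_density hb hbU hfC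
  have hpc := V.continuous_density (b := b)
  have i1 : IntervalIntegrable (fun x => φ x * V.density b x) volume (-U) U :=
    (hφ.mul hpc).intervalIntegrable _ _
  have i2 : IntervalIntegrable (fun x => m * V.density b x) volume (-U) U :=
    (continuous_const.mul hpc).intervalIntegrable _ _
  have h2 : ∫ x in (-U)..U, genA a (fun y => χ y * g y) x (u x) * V.density b x = 0 := by
    rw [intervalIntegral.integral_congr (g := fun x => φ x * V.density b x - m * V.density b x),
      intervalIntegral.integral_sub i1 i2,
      intervalIntegral.integral_const_mul, V.integral_density hbU, ← hm]
    · ring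
    · intro x hx
      rw [uIcc_of_le (by linarith)] at hx
      simp only [hgA x (abs_le.2 hx)]
      ring
  rw [h2, hB1, mul_zero, zero_add, zero_add, mul_eq_zero] at h1
  exact h1.resolve_left (V.weight_pos hbU).ne'

/-- The adjoint equation in weak form has only one solution among probability measures on
`[-U, U]` and pairs of boundary weights. -/
theorem eq_of_weak_adjoint (hb : 0 ≤ b) (hbU : b < U) {π : Measure ℝ} [IsProbabilityMeasure π]
    (hπ : ∀ᵐ x ∂π, x ∈ Icc (-U) U) {cm cp : ℝ}
    (hweak : ∀ f : ℝ → ℝ, ContDiff ℝ 2 f → HasCompactSupport f →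
      ∫ x, genA a f x (u x) ∂π + genB f (-U) (U - b) * cm + genB f U (-(U - b)) * cp = 0) :
    π = densMeasure U (V.density b) := by
  have := V.isProbabilityMeasure_density hbU
  refine ext_of_forall_integral_eq_of_IsFiniteMeasure fun φ => ?_
  -- Testing with a Poisson solution eliminates the unknown boundary weights, leaving equality of
  -- the integrals of `φ`.
  obtain ⟨f, hf, hfs, hA, hB1, hB2⟩ := V.exists_poisson_solution hb hbU φ.continuous
  have h1 := hweak f hf hfs
  rw [hB1, hB2, zero_mul, zero_mul, add_zero, add_zero,
    integral_congr_ae (hπ.mono fun x hx => hA x (abs_le.2 hx)),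
    integral_sub (integrable_of_continuous_of_ae_mem hπ φ.continuous) (integrable_const _)] at h1
  rw [integral_densMeasure V.U_pos V.continuous_density fun _ hx => V.density_nonneg hbU hx]
  simp at h1
  linarith

end IsDriftPotential

/-! ### The controlled process -/

/-- A test function that equals `1` at `y` and vanishes at distance at least `ε`. -/
theorem exists_test_function (y : ℝ) {ε : ℝ} (hε : 0 < ε) :
    ∃ f : ℝ → ℝ, ContDiff ℝ 2 f ∧ HasCompactSupport f ∧ f y = 1 ∧ ∀ x, ε ≤ |x - y| → f x = 0 := by
  let χ : ContDiffBump y := ⟨ε / 2, ε, by linarith, by linarith⟩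
  exact ⟨χ, χ.contDiff, χ.hasCompactSupport,
    χ.one_of_mem_closedBall (Metric.mem_closedBall_self (by positivity)),
    fun x hx => χ.zero_of_le_dist (by rw [Real.dist_eq]; exact hx)⟩

namespace IsStationaryControlled

variable {a U ξ : ℝ} {u : ℝ → ℝ} {Ω : Type*} {m : MeasurableSpace Ω} {P : Measure Ω}
  [IsProbabilityMeasure P] {𝓕 : Filtration NNReal m} {X : NNReal → Ω → ℝ} {Nm Np : NNReal → Ω → ℕ}
  (S : IsStationaryControlled a U ξ u P 𝓕 X Nm Np)
include S

omit [IsProbabilityMeasure P] in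
theorem measurable (t : NNReal) : Measurable (X t) :=
  ((S.progressive.stronglyAdapted t).mono (𝓕.le t)).measurable

omit [IsProbabilityMeasure P] in
-- Progressive measurability gives joint measurability only on `[0, t] × Ω`, so time is truncated at
-- `t`.
theorem measurable_uncurry_min (t : NNReal) :
    Measurable fun p : ℝ × Ω => X (min p.1.toNNReal t) p.2 := by
  have h1 : Measurable fun p : Iic t × Ω => X p.1 p.2 :=
    (S.progressive t).measurable.mono
      (sup_le_sup le_rfl (MeasurableSpace.comap_mono (𝓕.le t))) le_rfl
  have h2 : Measurable fun p : ℝ × Ω =>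
      ((⟨min p.1.toNNReal t, mem_Iic.2 (min_le_right _ _)⟩ : Iic t), p.2) :=
    (Measurable.subtype_mk (by fun_prop)).prodMk measurable_snd
  exact h1.comp h2

omit [IsProbabilityMeasure P] in
theorem integral_comp {g : ℝ → ℝ} (hg : Continuous g) (t : NNReal) :
    ∫ ω, g (X t ω) ∂P = ∫ x, g x ∂(P.map (X 0)) := by
  rw [← S.stationary t, integral_map (S.measurable t).aemeasurable hg.aestronglyMeasurable]

omit [IsProbabilityMeasure P] in
theorem ae_mem : ∀ᵐ x ∂(P.map (X 0)), x ∈ Icc (-U) U := by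
  exact (ae_map_iff (S.measurable 0).aemeasurable measurableSet_Icc).2
    (Eventually.of_forall fun ω => S.mem 0 ω)

theorem integrable_uncurry {g : ℝ → ℝ} (hg : Continuous g) (t : NNReal) :
    Integrable (fun p : ℝ × Ω => g (X (min p.1.toNNReal t) p.2))
      ((volume.restrict (Ioc (0 : ℝ) t)).prod P) := by
  obtain ⟨C, hC⟩ := isCompact_Icc.exists_bound_of_continuousOn (s := Icc (-U) U) hg.continuousOn
  exact Integrable.of_bound (hg.measurable.comp (S.measurable_uncurry_min t)).aestronglyMeasurable C
    (Eventually.of_forall fun p => hC _ (S.mem _ _))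

omit S in
theorem intervalIntegral_eq (X : NNReal → Ω → ℝ) (g : ℝ → ℝ) (t : NNReal) (ω : Ω) :
    ∫ s in (0 : ℝ)..t, g (X s.toNNReal ω)
      = ∫ s in Ioc (0 : ℝ) t, g (X (min s.toNNReal t) ω) := by
  rw [intervalIntegral.integral_of_le t.coe_nonneg]
  refine setIntegral_congr_fun measurableSet_Ioc fun s hs => ?_
  rw [min_eq_left (Real.toNNReal_le_iff_le_coe.2 hs.2)]

theorem integrable_intervalIntegral {g : ℝ → ℝ} (hg : Continuous g) (t : NNReal) :
    Integrable (fun ω => ∫ s in (0 : ℝ)..t, g (X s.toNNReal ω)) P := by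
  simp_rw [intervalIntegral_eq X g t]
  exact (S.integrable_uncurry hg t).integral_prod_right

theorem integral_intervalIntegral {g : ℝ → ℝ} (hg : Continuous g) (t : NNReal) :
    ∫ ω, (∫ s in (0 : ℝ)..t, g (X s.toNNReal ω)) ∂P = t * ∫ x, g x ∂(P.map (X 0)) := by
  simp_rw [intervalIntegral_eq X g t]
  rw [integral_integral_swap (f := fun (ω : Ω) (s : ℝ) => g (X (min s.toNNReal t) ω))
    (S.integrable_uncurry hg t).swap]
  simp_rw [S.integral_comp hg]
  simp

/-- The martingale, `f (X t)` and the time integral are integrable, hence so is the combination of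
counts in the identity. A test function concentrated within `ξ` of one endpoint isolates one count:
`ξ ≤ U` keeps the other endpoint and both landing points at distance at least `ξ`. -/
theorem integrable_count (hξ : 0 < ξ) (hξU : ξ ≤ U) (hu : Continuous u) (t : NNReal) :
    Integrable (fun ω => (Nm t ω : ℝ)) P ∧ Integrable (fun ω => (Np t ω : ℝ)) P := by
  have hint : ∀ f : ℝ → ℝ, ContDiff ℝ 2 f → HasCompactSupport f →
      Integrable (fun ω => genB f (-U) ξ * (Nm t ω : ℝ) + genB f U (-ξ) * (Np t ω : ℝ)) P := by
    intro f hf hfs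
    obtain ⟨C, hC⟩ := hfs.exists_bound_of_continuous hf.continuous
    have h1 : Integrable (fun ω => f (X t ω)) P := Integrable.of_bound
      (hf.continuous.measurable.comp (S.measurable t)).aestronglyMeasurable C
      (Eventually.of_forall fun ω => hC _)
    have h2 := S.integrable_intervalIntegral (continuous_genA (a := a) hf hu) t
    have h3 := (S.martingale f hf hfs).integrable t
    refine ((h1.sub h2).sub h3).congr (Eventually.of_forall fun ω => ?_)
    simp only [Pi.sub_apply]
    ring
  constructor
  · obtain ⟨f, hf, hfs, h1, h0⟩ := exists_test_function (-U) hξ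
    have e1 : genB f (-U) ξ = -1 := by
      rw [genB, h1, h0 _ (by rw [add_sub_cancel_left, abs_of_pos hξ])]; ring
    have e2 : genB f U (-ξ) = 0 := by
      rw [genB, h0 _ (by rw [abs_of_nonneg] <;> linarith),
        h0 _ (by rw [abs_of_nonneg] <;> linarith)]; ring
    refine (hint f hf hfs).neg.congr (Eventually.of_forall fun ω => ?_)
    simp only [Pi.neg_apply, e1, e2]
    ring
  · obtain ⟨f, hf, hfs, h1, h0⟩ := exists_test_function U hξ
    have e1 : genB f U (-ξ) = -1 := by
      rw [genB, h1, h0 _ (by rw [add_sub_cancel_left, abs_neg, abs_of_pos hξ])]; ring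
    have e2 : genB f (-U) ξ = 0 := by
      rw [genB, h0 _ (by rw [abs_of_nonpos] <;> linarith),
        h0 _ (by rw [abs_of_nonpos] <;> linarith)]; ring
    refine (hint f hf hfs).neg.congr (Eventually.of_forall fun ω => ?_)
    simp only [Pi.neg_apply, e1, e2]
    ring

/-- The expectation of the martingale identity. -/
theorem weak_adjoint (hξ : 0 < ξ) (hξU : ξ ≤ U) (hu : Continuous u) (t : NNReal) {f : ℝ → ℝ}
    (hf : ContDiff ℝ 2 f) (hfs : HasCompactSupport f) :
    t * ∫ x, genA a f x (u x) ∂(P.map (X 0)) + genB f (-U) ξ * ∫ ω, (Nm t ω : ℝ) ∂P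
      + genB f U (-ξ) * ∫ ω, (Np t ω : ℝ) ∂P = 0 := by
  obtain ⟨hNm, hNp⟩ := S.integrable_count hξ hξU hu t
  have hg := continuous_genA (a := a) hf hu
  have hM := S.martingale f hf hfs
  have h1 := hM.setIntegral_eq (zero_le : 0 ≤ t) MeasurableSet.univ
  rw [setIntegral_univ, setIntegral_univ] at h1
  obtain ⟨C, hC⟩ := hfs.exists_bound_of_continuous hf.continuous
  have hfi : Integrable (fun ω => f (X t ω)) P := Integrable.of_bound
    (hf.continuous.measurable.comp (S.measurable t)).aestronglyMeasurable C
    (Eventually.of_forall fun ω => hC _)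
  have hAi := S.integrable_intervalIntegral hg t
  have i1 : Integrable (fun ω => f (X t ω)
      - ∫ s in (0 : ℝ)..t, genA a f (X s.toNNReal ω) (u (X s.toNNReal ω))) P := hfi.sub hAi
  have i2 : Integrable (fun ω => f (X t ω)
      - (∫ s in (0 : ℝ)..t, genA a f (X s.toNNReal ω) (u (X s.toNNReal ω)))
      - genB f (-U) ξ * (Nm t ω : ℝ)) P := i1.sub (hNm.const_mul _)
  rw [eq_comm, integral_sub i2 (hNp.const_mul _), integral_sub i1 (hNm.const_mul _),
    integral_sub hfi hAi,
    integral_const_mul, integral_const_mul, S.integral_intervalIntegral hg,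
    S.integral_comp hf.continuous] at h1
  simp only [NNReal.coe_zero, intervalIntegral.integral_same, (S.count_zero _).1,
    (S.count_zero _).2, Nat.cast_zero, mul_zero, sub_zero, S.integral_comp hf.continuous] at h1
  linarith

/-- Uniqueness for the weak adjoint equation, applied at time `1`, gives the law. Subtracting `t`
times the weak identity for the density then cancels the `A f` terms and leaves only jump terms,
which test functions near one endpoint separate. -/
theorem law_and_counts {v v' v'' : ℝ → ℝ} (V : IsDriftPotential a U u v v' v'') {b : ℝ}
    (hb : 0 ≤ b) (hbU : b < U) (hξ : ξ = U - b) (t : NNReal) :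
    P.map (fun ω => (X t ω, u (X t ω))) = muStar U (V.density b) u ∧
      ∫⁻ ω, (Nm t ω : ENNReal) ∂P = ENNReal.ofReal (V.weight b * t) ∧
      ∫⁻ ω, (Np t ω : ENNReal) ∂P = ENNReal.ofReal (V.weight b * t) := by
  have hu := V.continuous_drift
  have hξ0 : 0 < ξ := by linarith
  have hξU : ξ ≤ U := by linarith
  have := Measure.isProbabilityMeasure_map (μ := P) (S.measurable 0).aemeasurable
  have hlaw : P.map (X 0) = densMeasure U (V.density b) := by
    refine V.eq_of_weak_adjoint hb hbU S.ae_mem (cm := ∫ ω, (Nm 1 ω : ℝ) ∂P)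
      (cp := ∫ ω, (Np 1 ω : ℝ) ∂P) fun f hf hfs => ?_
    have := S.weak_adjoint hξ0 hξU hu 1 hf hfs
    rwa [NNReal.coe_one, one_mul, hξ] at this
  have hid : ∀ f : ℝ → ℝ, ContDiff ℝ 2 f → HasCompactSupport f →
      genB f (-U) ξ * (∫ ω, (Nm t ω : ℝ) ∂P - V.weight b * t)
        + genB f U (-ξ) * (∫ ω, (Np t ω : ℝ) ∂P - V.weight b * t) = 0 := by
    intro f hf hfs
    have h1 := S.weak_adjoint hξ0 hξU hu t hf hfs
    have h2 := V.integral_genA_mul_density hb hbU hf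
    rw [hlaw, integral_densMeasure V.U_pos V.continuous_density
      fun _ hx => V.density_nonneg hbU hx] at h1
    rw [← hξ] at h2
    linear_combination h1 - t * h2
  obtain ⟨hNm, hNp⟩ := S.integrable_count hξ0 hξU hu t
  have hconv : ∀ N : Ω → ℕ, Integrable (fun ω => (N ω : ℝ)) P →
      ∫⁻ ω, (N ω : ENNReal) ∂P = ENNReal.ofReal (∫ ω, (N ω : ℝ) ∂P) := by
    intro N hN
    rw [ofReal_integral_eq_lintegral_ofReal hN (Eventually.of_forall fun ω => Nat.cast_nonneg _)]
    simp
  refine ⟨?_, ?_, ?_⟩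
  · have hgm : Measurable fun x => (x, u x) := measurable_id.prodMk hu.measurable
    rw [muStar, ← hlaw, ← S.stationary t, Measure.map_map hgm (S.measurable t)]
    rfl
  · rw [hconv _ hNm]
    congr 1
    obtain ⟨f, hf, hfs, h1, h0⟩ := exists_test_function (-U) hξ0
    have h2 := hid f hf hfs
    have e1 : genB f (-U) ξ = -1 := by
      rw [genB, h1, h0 _ (by rw [add_sub_cancel_left, abs_of_pos hξ0])]; ring
    have e2 : genB f U (-ξ) = 0 := by
      rw [genB, h0 _ (by rw [abs_of_nonneg] <;> linarith),
        h0 _ (by rw [abs_of_nonneg] <;> linarith)]; ring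
    rw [e1, e2] at h2
    linarith
  · rw [hconv _ hNp]
    congr 1
    obtain ⟨f, hf, hfs, h1, h0⟩ := exists_test_function U hξ0
    have h2 := hid f hf hfs
    have e1 : genB f U (-ξ) = -1 := by
      rw [genB, h1, h0 _ (by rw [add_sub_cancel_left, abs_neg, abs_of_pos hξ0])]; ring
    have e2 : genB f (-U) ξ = 0 := by
      rw [genB, h0 _ (by rw [abs_of_nonpos] <;> linarith),
        h0 _ (by rw [abs_of_nonpos] <;> linarith)]; ring
    rw [e1, e2] at h2
    linarith

end IsStationaryControlled

/-! ### The optimal drift, complementarity and the value function -/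

namespace IsWeberFreeBoundary

variable {a r l k h ι b U : ℝ} (ha : 0 < a) (hr : 0 < r) (hl : 0 < l) (hk : 0 < k)
  (F : IsWeberFreeBoundary √(r / (a ^ 2 * l)) (h / (2 * a * l)) (k / (2 * a * l)) ι b U)

-- On `[-U, U]` the feedback is `-w' / (2 l) = -a s = a v' / v`, so the function that linearises the
-- Riccati equation also solves the adjoint problem.
include ha hr hl F in
theorem isDriftPotential : IsDriftPotential a U (uStar l (wFun a r l h ι U))
    (weberV √(r / (a ^ 2 * l)) ι) (weberV' √(r / (a ^ 2 * l)) ι)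
    (fun x => (√(r / (a ^ 2 * l)) ^ 2 * x ^ 2 - ι * √(r / (a ^ 2 * l)))
      * weberV √(r / (a ^ 2 * l)) ι x) where
  a_pos := ha
  U_pos := F.U_pos
  continuous_drift :=
    ((contDiff_one_wFun ha hr hl F).continuous_deriv le_rfl).neg.div_const _
  hasDerivAt := hasDerivAt_weberV F.mem_param
  hasDerivAt' := hasDerivAt_weberV' F.mem_param
  continuous'' := by
    have h1 : Continuous (weberV √(r / (a ^ 2 * l)) ι) := continuous_iff_continuousAt.2
      fun x => (hasDerivAt_weberV F.mem_param x).continuousAt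
    fun_prop
  pos := weberV_pos F.c_pos.le F.mem_param
  even := weberV_neg
  drift := fun x hx => by
    rw [uStar, deriv_wFun_of_abs_le ha hr hl F hx, weberS]
    field_simp

/-- The candidate pair of measures satisfies the complementarity conditions. -/
theorem ae_complementarity {u v v' v'' : ℝ → ℝ} (V : IsDriftPotential a U u v v' v'') {p : ℝ}
    {I : ℝ} {w : ℝ → ℝ} (hw : IsFreeBoundarySolution a r l k h U (U - b) w I)
    (hu : u = uStar l w) :
    (∀ᵐ z ∂(muStar U (V.density b) u), genA a w z.1 z.2 + costA r l z.1 z.2 = I) ∧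
      ∀ᵐ z ∂(rhoStar U (U - b) p p), genB w z.1 z.2 + costB k h z.2 = 0 := by
  refine ⟨V.ae_muStar ?_ fun x hx => ?_, ae_rhoStar hw.value_fit.2 hw.value_fit.1⟩
  · refine measurableSet_eq_fun ?_ measurable_const
    have h1 : Measurable (deriv (deriv w)) := measurable_deriv _
    have h2 : Measurable (deriv w) := measurable_deriv _
    unfold genA costA
    fun_prop
  · rw [hu]; exact hw.pde x hx

include ha hr hl hk F in
theorem isValueFunction_wFun : IsValueFunction a r l k h {-U, U} (wFun a r l h ι U)
    (ι * a * √(r * l)) where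
  contDiff_one := contDiff_one_wFun ha hr hl F
  contDiffOn_two := contDiffOn_two_wFun ha hr hl F
  null := fun _ _ hf hc => (hf.ae_notMem ha hr hl hc (toFinite _).countable).1
  approx := isApproximable_wFun ha hr hl hk F
  continuation := fun _ hx u => le_genA_add_costA ha hr hl F hx u
  intervention := fun x ξ _ => genB_add_costB_nonneg ha hr hl F x ξ
  attained := by
    have V := isDriftPotential ha hr hl F
    obtain ⟨h1, h2⟩ := ae_complementarity V (isFreeBoundarySolution ha hr hl F) rfl
    exact ⟨_, _, V.isFeasible_star F.b_nonneg F.b_lt, h1, h2⟩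

end IsWeberFreeBoundary

end ImpulseLP

end

theorem mainTheorem7 (a r l k h : ℝ) (ha : 0 < a) (hr : 0 < r) (hl : 0 < l) (hk : 0 < k)
    (hh : 0 ≤ h) :
    ∃ ι U ξ : ℝ, ι ∈ Ioo (0 : ℝ) 1 ∧ 0 < ξ ∧ ξ ≤ U ∧ (ξ = U ↔ h = 0) ∧
      -- the function `w` and the constant `ι a √(r l)` solve the HJB free boundary problem
      IsFreeBoundarySolution a r l k h U ξ (wFun a r l h ι U) (ι * a * √(r * l)) ∧
      IsValueFunction a r l k h {-U, U} (wFun a r l h ι U) (ι * a * √(r * l)) ∧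
      -- `u*` is the unique minimiser of the Hamiltonian
      (∀ x ∉ ({-U, U} : Set ℝ), ∀ v : ℝ, v ≠ uStar l (wFun a r l h ι U) x →
        genA a (wFun a r l h ι U) x (uStar l (wFun a r l h ι U) x)
            + costA r l x (uStar l (wFun a r l h ι U) x)
          < genA a (wFun a r l h ι U) x v + costA r l x v) ∧
      -- the value of the linear program
      lpValue a r l k h = ENNReal.ofReal (ι * a * √(r * l)) ∧
      -- the adjoint problem has exactly one solution, and it gives an optimal pair
      ∃ (p : ℝ → ℝ) (ρm ρp : ℝ),
        IsAdjointSolution a U ξ (uStar l (wFun a r l h ι U)) p ρm ρp ∧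
        (∀ (q : ℝ → ℝ) (σm σp : ℝ),
          IsAdjointSolution a U ξ (uStar l (wFun a r l h ι U)) q σm σp →
            EqOn q p (Icc (-U) U) ∧ σm = ρm ∧ σp = ρp) ∧
        (∀ x ∈ Icc (-U) U, 0 ≤ p x) ∧ 0 ≤ ρm ∧ 0 ≤ ρp ∧
        IsFeasible a (muStar U p (uStar l (wFun a r l h ι U))) (rhoStar U ξ ρm ρp) ∧
        cost r l k h (muStar U p (uStar l (wFun a r l h ι U))) (rhoStar U ξ ρm ρp)
          = lpValue a r l k h ∧
        -- stationary distribution and boundary measure of the optimally controlled process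
        ∀ {Ω : Type*} {m : MeasurableSpace Ω} (P : Measure Ω) [IsProbabilityMeasure P]
          (𝓕 : Filtration NNReal m) (X : NNReal → Ω → ℝ) (Nm Np : NNReal → Ω → ℕ),
          IsStationaryControlled a U ξ (uStar l (wFun a r l h ι U)) P 𝓕 X Nm Np →
          ∀ t : NNReal,
            P.map (fun ω => (X t ω, uStar l (wFun a r l h ι U) (X t ω)))
              = muStar U p (uStar l (wFun a r l h ι U)) ∧
            ∫⁻ ω, (Nm t ω : ENNReal) ∂P = ENNReal.ofReal (ρm * t) ∧
            ∫⁻ ω, (Np t ω : ENNReal) ∂P = ENNReal.ofReal (ρp * t) := by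
  -- Because `w' = 2 a l s`, the slope `h` and the fixed cost `k` become a level and an area for `s`
  -- after division by `2 a l`.
  obtain ⟨ι, b, U, F⟩ := exists_isWeberFreeBoundary (c := √(r / (a ^ 2 * l)))
    (H := h / (2 * a * l)) (K := k / (2 * a * l)) (by positivity) (by positivity) (by positivity)
  have hb := F.b_nonneg
  have hbU := F.b_lt
  have V := IsWeberFreeBoundary.isDriftPotential ha hr hl F
  have hw := IsWeberFreeBoundary.isFreeBoundarySolution ha hr hl F
  have hval := IsWeberFreeBoundary.isValueFunction_wFun ha hr hl hk F
  have hfeas := V.isFeasible_star hb hbU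
  have hN : ({-U, U} : Set ℝ).Countable := (toFinite _).countable
  obtain ⟨hcA, hcB⟩ := IsWeberFreeBoundary.ae_complementarity V (p := V.weight b) hw rfl
  have hcost := hfeas.cost_eq_of_ae ha hr hl hk hh (V.cost_star_lt_top hbU r l k h) hN hval.approx
    hcA hcB
  have hlp : lpValue a r l k h = ENNReal.ofReal (ι * a * √(r * l)) := by
    refine le_antisymm (hcost ▸ iInf₂_le_of_le _ _ (iInf_le _ hfeas))
      (le_iInf₂ fun μ ρ => le_iInf fun hf => ?_)
    exact hf.le_cost ha hr hl hk hh hN hval.approx hval.continuation hval.intervention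
  refine ⟨ι, U, U - b, F.param, by linarith, by linarith, ?_, hw, hval,
    fun x hx v hv => IsWeberFreeBoundary.genA_uStar_lt ha hr hl F hx hv, hlp,
    V.density b, V.weight b, V.weight b, V.isAdjointSolution_density hb hbU,
    fun q σm σp hq => V.eq_density_of_isAdjointSolution hb hbU hq,
    fun x hx => V.density_nonneg hbU (abs_le.2 hx), (V.weight_pos hbU).le,
    (V.weight_pos hbU).le, hfeas, hcost.trans hlp.symm,
    fun P _ 𝓕 X Nm Np S t => S.law_and_counts V hb hbU rfl t⟩
  rw [sub_eq_self, F.b_eq_zero_iff, div_eq_zero_iff, or_iff_left (by positivity)]
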